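/- Let $X_1,X_2,\dots$ be i.i.d. real random variables that are almost surely bounded by a constant, with $\mathbb E X_1=0$ and $\eta^2=\operatorname{Var}(X_1)>0$. For $\alpha>0$ and $N\in\mathbb N$ let $H_{\alpha,N}$ be the $N\times N$ tridiagonal matrix with diagonal entries $X_n/n^\alpha$ ($1\le n\le N$) and all entries next to the diagonal equal to $1$. For a real polynomial $P$ put $S_N(P)=\operatorname{Tr}P(H_{\alpha,N})-\mathbb E\operatorname{Tr}P(H_{\alpha,N})$. For $0<t\le 1$ let $g_t(N)\ge 0$ be given by $g_t(N)^2=\log N$ if $t=1$ and $g_t(N)^2=N^{1-t}/(1-t)$ if $t<1$. $N(0,\sigma^2)$ denotes the normal law (the point mass at $0$ if $\sigma^2=0$). Let $m$ be an odd positive integer, $\mathcal V_m$ the space of real polynomials of degree at most $m$ with $\langle\sum a_kx^k,\sum b_kx^k\rangle=\sum a_kb_k$, $\mathcal E_m$ and $\mathcal O_m$ the subspaces of polynomials with only even, respectively only odd, powers of $x$, $Q_m(x)=\sum_{j=0}^{(m-1)/2}\frac{(2j+1)!}{j!^2}x^{2j+1}$, $\mathcal Q_m=\mathbb R Q_m$,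 and $\mathcal Q_m^\perp$ the orthogonal complement of $\mathcal Q_m$ in $\mathcal O_m$. For a finitely supported $\beta:\mathbb Z\to\mathbb N\cup\{0\}$ let $p^k(\beta)$ be the number of integer sequences $(y_0,\dots,y_k)$ with $y_0=y_k=0$ and $|y_t-y_{t-1}|\le 1$ for which there is $i\in\mathbb Z$ such that for all $h\in\mathbb Z$ the number of $t$ with $y_{t-1}=y_t=h$ is $\beta_{h-i}$. Let $\delta^j$ be the indicator function of $\{j\}$, and $\delta=\delta^0$. For even $k,\ell$ put $$C_{\mathcal E}(k,\ell)=p^k(2\delta)p^\ell(2\delta)\left(\mathbb E X_1^4-\eta^4\right)+\eta^4\sum_{s\ge1}p^k(\delta+\delta^s)p^\ell(\delta+\delta^s),$$ and $C_{\mathcal E}(k,\ell)=0$ for other $k,\ell$. For odd $k,\ell\ge3$ put $$C_{\perp}(k,\ell)=q_6\left(\mathbb E X_1^6-(\mathbb E X_1^3)^2\right)+q_{3,3}(\mathbb E X_1^3)^2+q_{4,2}\,\mathbb E X_1^4\,\mathbb E X_1^2+q_{2,2,2}(\mathbb E X_1^2)^3,$$ and $C_\perp(k,\ell)=0$ for other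 $k,\ell$. Here, with $a_k=p^k(3\delta)$, $b_k(t)=p^k(2\delta+\delta^t)$, $c_k(s)=p^k(\delta+2\delta^s)$, $d_k(s,t)=p^k(\delta+\delta^s+\delta^{s+t})$, $$q_6=a_ka_\ell,\qquad q_{3,3}=\sum_{t\ge1}\left(b_k(t)c_\ell(t)+b_\ell(t)c_k(t)\right),$$ $$q_{4,2}=\sum_{t\ge1}\left(a_kb_\ell(t)+a_\ell b_k(t)+a_kc_\ell(t)+a_\ell c_k(t)+b_k(t)b_\ell(t)+c_k(t)c_\ell(t)\right),$$ $$q_{2,2,2}=\sum_{s,t\ge1}\left(b_k(s+t)b_\ell(t)+b_\ell(s+t)b_k(t)+b_k(t)c_\ell(s)+b_\ell(t)c_k(s)+c_k(s)c_\ell(s+t)+c_\ell(s)c_k(s+t)+d_k(s,t)d_\ell(s,t)\right)$$ (all sums are finite). For $P=\sum_k a_kx^k\in\mathcal V_m$ let $\sigma_{\mathcal Q}(P)^2=|\langle P,Q_m\rangle|^2\eta^2$, $\sigma_{\mathcal E}(P)^2=\sum_{k,\ell=0}^m a_kC_{\mathcal E}(k,\ell)a_\ell$ and $\sigma_{\perp}(P)^2=\sum_{k,\ell=0}^m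 a_kC_{\perp}(k,\ell)a_\ell$. Theorem. $\mathcal V_m=\mathcal Q_m\oplus\mathcal Q_m^\perp\oplus\mathcal E_m$. Moreover, for every $P\in\mathcal V_m$ with $\deg P>0$ and every $\alpha>0$: (a) If $\alpha\le\frac12$, then $S_N(P)/g_{2\alpha}(N)\to N(0,\sigma_{\mathcal Q}(P)^2)$ in distribution as $N\to\infty$. If $\alpha>\frac12$, then $S_N(P)$ converges almost surely to a random variable with finite variance. (b) Suppose $P\in\mathcal E_m$. If $\alpha\le\frac14$, then $S_N(P)/g_{4\alpha}(N)\to N(0,\sigma_{\mathcal E}(P)^2)$ in distribution. One has $\sigma_{\mathcal E}(P)^2>0$ if and only if $\operatorname{Var}(X_1^2)>0$ or $\deg P>2$. If $\alpha>\frac14$, then $S_N(P)$ converges almost surely to a random variable with finite variance. (c) Suppose $P\in\mathcal Q_m^\perp$. If $\alpha\le\frac16$, then $S_N(P)/g_{6\alpha}(N)\to N(0,\sigma_{\perp}(P)^2)$ in distribution. One has $\sigma_{\perp}(P)^2>0$ unless both $\operatorname{Var}(X_1^2)=0$ and $P(x)=a\left(\frac{x^5}{5}-4x^3+18x\right)$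 for some constant $a$, in which case $\sigma_\perp(P)^2=0$. If $\alpha>\frac16$, then $S_N(P)$ converges almost surely to a random variable with finite variance. -/

import Mathlib

open MeasureTheory ProbabilityTheory Filter Topology Polynomial

namespace DecayingSchrodinger

noncomputable section

/-! ### The polynomial spaces -/

/-- The space of real polynomials of degree at most `m`. -/
def polySpace (m : ℕ) : Submodule ℝ ℝ[X] := Polynomial.degreeLE ℝ (m : WithBot ℕ)

/-- The inner product `⟨∑ aₖ xᵏ, ∑ bₖ xᵏ⟩ = ∑ aₖ bₖ` on polynomials of degree at most `m`. -/
def coeffInner (m : ℕ) (P R : ℝ[X]) : ℝ :=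
  ∑ k ∈ Finset.range (m + 1), P.coeff k * R.coeff k

/-- The polynomials of degree at most `m` in which only even powers of `x` occur. -/
def evenSpace (m : ℕ) : Submodule ℝ ℝ[X] where
  carrier := {P | P ∈ polySpace m ∧ ∀ k, Odd k → P.coeff k = 0}
  zero_mem' := ⟨Submodule.zero_mem _, fun _ _ => by simp⟩
  add_mem' := fun ha hb => ⟨Submodule.add_mem _ ha.1 hb.1, fun k hk => by
    rw [coeff_add, ha.2 k hk, hb.2 k hk, add_zero]⟩
  smul_mem' := fun c _ ha => ⟨Submodule.smul_mem _ c ha.1, fun k hk => by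
    rw [coeff_smul, ha.2 k hk, smul_zero]⟩

/-- The polynomials of degree at most `m` in which only odd powers of `x` occur. -/
def oddSpace (m : ℕ) : Submodule ℝ ℝ[X] where
  carrier := {P | P ∈ polySpace m ∧ ∀ k, Even k → P.coeff k = 0}
  zero_mem' := ⟨Submodule.zero_mem _, fun _ _ => by simp⟩
  add_mem' := fun ha hb => ⟨Submodule.add_mem _ ha.1 hb.1, fun k hk => by
    rw [coeff_add, ha.2 k hk, hb.2 k hk, add_zero]⟩
  smul_mem' := fun c _ ha => ⟨Submodule.smul_mem _ c ha.1, fun k hk => by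
    rw [coeff_smul, ha.2 k hk, smul_zero]⟩

/-- `Q_m(x) = ∑_{j=0}^{(m-1)/2} (2j+1)! / (j!)² x^{2j+1}` (for odd `m`). -/
def Qpoly (m : ℕ) : ℝ[X] :=
  ∑ j ∈ Finset.range ((m - 1) / 2 + 1),
    C (((2 * j + 1).factorial : ℝ) / ((j.factorial : ℝ)) ^ 2) * X ^ (2 * j + 1)

/-- The line spanned by `Q_m`. -/
def QSpace (m : ℕ) : Submodule ℝ ℝ[X] := Submodule.span ℝ {Qpoly m}

/-- The orthogonal complement of the line spanned by `Q_m` inside the odd polynomials. -/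
def QPerpSpace (m : ℕ) : Submodule ℝ ℝ[X] where
  carrier := {P | P ∈ oddSpace m ∧ ∀ R ∈ QSpace m, coeffInner m P R = 0}
  zero_mem' := ⟨Submodule.zero_mem _, fun _ _ => by simp [coeffInner]⟩
  add_mem' := fun {a b} ha hb => ⟨Submodule.add_mem _ ha.1 hb.1, fun R hR => by
    have h1 := ha.2 R hR
    have h2 := hb.2 R hR
    simp only [coeffInner] at h1 h2 ⊢
    simp only [coeff_add, add_mul, Finset.sum_add_distrib, h1, h2, add_zero]⟩
  smul_mem' := fun c a ha => ⟨Submodule.smul_mem _ c ha.1, fun R hR => by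
    have h1 := ha.2 R hR
    simp only [coeffInner] at h1 ⊢
    simp only [coeff_smul, smul_eq_mul, mul_assoc, ← Finset.mul_sum, h1, mul_zero]⟩

/-! ### The operator and its linear statistics -/

/-- The truncated operator `H_{α,N}` for the sample `x₁, x₂, …`, where `xₙ` is stored as
`x (n - 1)`: the diagonal entry at site `n = i + 1` is `xₙ / n ^ α`, and the entries next to the
diagonal are `1`. -/
def hamiltonian (α : ℝ) (x : ℕ → ℝ) (N : ℕ) : Matrix (Fin N) (Fin N) ℝ :=
  Matrix.of fun i j =>
    if i = j then x i / ((i : ℝ) + 1) ^ α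
    else if (i : ℕ) + 1 = j ∨ (j : ℕ) + 1 = i then 1 else 0

/-- The linear statistic `Tr P(H_{α,N})`. -/
def linStat {Ω : Type*} (X : ℕ → Ω → ℝ) (α : ℝ) (P : ℝ[X]) (N : ℕ) (ω : Ω) : ℝ :=
  (Polynomial.aeval (hamiltonian α (fun n => X n ω) N) P).trace

/-- The centred linear statistic `Tr P(H_{α,N}) - E Tr P(H_{α,N})`. -/
def centredStat {Ω : Type*} [MeasurableSpace Ω] (μ : Measure Ω) (X : ℕ → Ω → ℝ) (α : ℝ)
    (P : ℝ[X]) (N : ℕ) (ω : Ω) : ℝ :=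
  linStat X α P N ω - ∫ ω', linStat X α P N ω' ∂μ

/-- The normalisation `g_t(N)`, for `0 < t ≤ 1`. -/
def growth (t : ℝ) (N : ℕ) : ℝ :=
  Real.sqrt (if t = 1 then Real.log N else (N : ℝ) ^ (1 - t) / (1 - t))

/-- The centred statistic, divided by `g_t(N)`, converges in distribution to the normal law with
mean `0` and variance `v` (for `v ≥ 0`; it is the Dirac mass at `0` when `v = 0`). -/
def GaussianLimit {Ω : Type*} [MeasurableSpace Ω] (μ : Measure Ω) [IsProbabilityMeasure μ]
    (X : ℕ → Ω → ℝ) (α : ℝ) (P : ℝ[X]) (t v : ℝ) : Prop :=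
  0 ≤ v ∧
    TendstoInDistribution (fun N ω => centredStat μ X α P N ω / growth t N) atTop
      (id : ℝ → ℝ) (fun _ => μ) (gaussianReal 0 v.toNNReal)

/-- The centred statistic converges almost surely to a random variable with finite variance. -/
def AlmostSureLimit {Ω : Type*} [MeasurableSpace Ω] (μ : Measure Ω)
    (X : ℕ → Ω → ℝ) (α : ℝ) (P : ℝ[X]) : Prop :=
  ∃ Y : Ω → ℝ, MemLp Y 2 μ ∧
    ∀ᵐ ω ∂μ, Tendsto (fun N => centredStat μ X α P N ω) atTop (𝓝 (Y ω))

/-! ### Path counts -/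

/-- The multi-index `δ^j`, equal to `1` at `j` and to `0` elsewhere. -/
def del (j : ℕ) : ℤ →₀ ℕ := Finsupp.single (j : ℤ) 1

/-- The set of paths `(0 = y₀, y₁, …, y_k = 0)` of integers with `|y_{t+1} - y_t| ≤ 1` whose
numbers of flat steps at each level are given by some shift of `β`. -/
def pathSet (k : ℕ) (β : ℤ →₀ ℕ) : Set (Fin (k + 1) → ℤ) :=
  {y | y 0 = 0 ∧ y (Fin.last k) = 0 ∧ (∀ t : Fin k, |y t.succ - y t.castSucc| ≤ 1) ∧
    ∃ i : ℤ, ∀ h : ℤ,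
      β (h - i) =
        (Finset.univ.filter fun t : Fin k => y t.castSucc = h ∧ y t.succ = h).card}

/-- The number `p^k(β)` of such paths (a finite number), as a real number. -/
def pathCount (k : ℕ) (β : ℤ →₀ ℕ) : ℝ := ((pathSet k β).ncard : ℝ)

/-! ### The limiting variances -/

/-- The moment `E[Y ^ j]`. -/
def mom {Ω : Type*} [MeasurableSpace Ω] (μ : Measure Ω) (Y : Ω → ℝ) (j : ℕ) : ℝ :=
  ∫ ω, Y ω ^ j ∂μ

/-- The limiting variance for general polynomials, `|⟨P, Q_m⟩|² η²`. -/
def varQ {Ω : Type*} [MeasurableSpace Ω] (μ : Measure Ω) (Y : Ω → ℝ) (m : ℕ) (P : ℝ[X]) : ℝ :=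
  |coeffInner m P (Qpoly m)| ^ 2 * variance Y μ

/-- The quadratic form `⟨P, K P⟩` of an `(m+1) × (m+1)` matrix `K` on polynomials of degree at
most `m`. -/
def quadForm (m : ℕ) (K : ℕ → ℕ → ℝ) (P : ℝ[X]) : ℝ :=
  ∑ k ∈ Finset.range (m + 1), ∑ l ∈ Finset.range (m + 1), P.coeff k * K k l * P.coeff l

/-- The covariance matrix for even polynomials. -/
def covE {Ω : Type*} [MeasurableSpace Ω] (μ : Measure Ω) (Y : Ω → ℝ) (k l : ℕ) : ℝ :=
  if Even k ∧ Even l then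
    pathCount k (2 • del 0) * pathCount l (2 • del 0) * (mom μ Y 4 - variance Y μ ^ 2)
      + (∑' s : ℕ, pathCount k (del 0 + del (s + 1)) * pathCount l (del 0 + del (s + 1)))
        * variance Y μ ^ 2
  else 0

/-- The limiting variance for even polynomials. -/
def varE {Ω : Type*} [MeasurableSpace Ω] (μ : Measure Ω) (Y : Ω → ℝ) (m : ℕ) (P : ℝ[X]) : ℝ :=
  quadForm m (covE μ Y) P

/-- `p^k(3δ)`. -/
def pThree (k : ℕ) : ℝ := pathCount k (3 • del 0)

/-- `p^k(2δ + δ^t)`. -/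
def pTwoOne (k t : ℕ) : ℝ := pathCount k (2 • del 0 + del t)

/-- `p^k(δ + 2δ^t)`. -/
def pOneTwo (k t : ℕ) : ℝ := pathCount k (del 0 + 2 • del t)

/-- `p^k(δ + δ^s + δ^{s+t})`. -/
def pOneOneOne (k s t : ℕ) : ℝ := pathCount k (del 0 + del s + del (s + t))

def q6 (k l : ℕ) : ℝ := pThree k * pThree l

/-! In the sums below, the summation indices `s, t ≥ 1` are written as `s + 1, t + 1` with
`s, t : ℕ`; all but finitely many terms vanish. -/

def q33 (k l : ℕ) : ℝ :=
  ∑' t : ℕ, (pTwoOne k (t + 1) * pOneTwo l (t + 1) + pTwoOne l (t + 1) * pOneTwo k (t + 1))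

def q42 (k l : ℕ) : ℝ :=
  (∑' t : ℕ, (pThree k * pTwoOne l (t + 1) + pThree l * pTwoOne k (t + 1)))
    + (∑' s : ℕ, (pThree k * pOneTwo l (s + 1) + pThree l * pOneTwo k (s + 1)))
    + (∑' t : ℕ, pTwoOne k (t + 1) * pTwoOne l (t + 1))
    + (∑' s : ℕ, pOneTwo k (s + 1) * pOneTwo l (s + 1))

def q222 (k l : ℕ) : ℝ :=
  (∑' (s : ℕ) (t : ℕ), (pTwoOne k ((s + 1) + (t + 1)) * pTwoOne l (t + 1)
      + pTwoOne l ((s + 1) + (t + 1)) * pTwoOne k (t + 1)))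
    + (∑' (s : ℕ) (t : ℕ), (pTwoOne k (t + 1) * pOneTwo l (s + 1)
      + pTwoOne l (t + 1) * pOneTwo k (s + 1)))
    + (∑' (s : ℕ) (t : ℕ), (pOneTwo k (s + 1) * pOneTwo l ((s + 1) + (t + 1))
      + pOneTwo l (s + 1) * pOneTwo k ((s + 1) + (t + 1))))
    + (∑' (s : ℕ) (t : ℕ), pOneOneOne k (s + 1) (t + 1) * pOneOneOne l (s + 1) (t + 1))

/-- The covariance matrix for odd polynomials orthogonal to `Q_m`. -/
def covPerp {Ω : Type*} [MeasurableSpace Ω] (μ : Measure Ω) (Y : Ω → ℝ) (k l : ℕ) : ℝ :=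
  if Odd k ∧ Odd l ∧ 3 ≤ k ∧ 3 ≤ l then
    q6 k l * (mom μ Y 6 - mom μ Y 3 ^ 2) + q33 k l * mom μ Y 3 ^ 2
      + q42 k l * (mom μ Y 4 * mom μ Y 2) + q222 k l * mom μ Y 2 ^ 3
  else 0

/-- The limiting variance for odd polynomials orthogonal to `Q_m`. -/
def varPerp {Ω : Type*} [MeasurableSpace Ω] (μ : Measure Ω) (Y : Ω → ℝ) (m : ℕ)
    (P : ℝ[X]) : ℝ :=
  quadForm m (covPerp μ Y) P

end

end DecayingSchrodinger

/-!
# Gaussian fluctuations of linear statistics with a decaying random potential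

Expanding a power of the tridiagonal matrix (`trace_pow_eq`) writes `Tr P(H)` exactly as a finite
sum over closed paths `y` with steps in `{-1, 0, 1}`; every path contributes a sum over its positions
of the product of the potential `Xₙ / n ^ α` over the flat steps of `y`. The centred statistic is
therefore a finite combination of sums of a product of decaying weights with a centred monomial in
the `Xₙ` at nearby sites (`BoundedIID.centredStat_eq`). A path of length `k` has a number of flat
steps of the parity of `k`, and a path with `j` of them has weights of order `n ^ (-jα)`. Sums of a
centred function of finite range against square-summable weights converge almost surely
(`FiniteRange.ae_tendsto`); otherwise their second moment is at most of the order of the sum of the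
squared weights (`FiniteRange.integral_sq_sum_le`), which is `g_{2jα}(N) ^ 2`. So the paths with the
least number of flat steps decide: `j = 1` in general and `j = 2` for even polynomials. For odd
polynomials, the coefficient of the paths with `j = 1` is `⟨P, Q_m⟩` (`coeffInner_Qpoly`, by counting
walks with one flat step). If it vanishes, the leading terms cancel, what is left of them comes from
shifts of the weights and is summable, and the paths with `j = 3` decide.

For the central limit theorems, the dominant paths are sorted by the shape of their set of flat
steps. Replacing the product of the weights by the weight of a single site, and shifting the
summation index, changes the sums only by a bounded amount (`abs_sum_weight_shift_le`) or by a term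
with smaller weights. The statistic thus agrees, up to an error that vanishes after normalisation,
with `∑ i, n_i ^ (-jα) F(Xᵢ, Xᵢ₊₁, …)` for one window function `F` that is centred given all but its
last variable (`lastCentred`). These are bounded martingale differences whose squares have finite
range of dependence, and McLeish's argument with the product `∏ (1 + i x)` bounds the distance of
the characteristic function from the Gaussian one (`FiniteRange.norm_integral_exp_sub_le`,
`FiniteRange.tendstoInDistribution`). The variance is the second moment of `F`
(`BoundedIID.expect_lastCentred_sq`), which is matched with the quadratic forms of the statement by
`varE_eq` and `varPerp_eq`.

Positivity of the variance in high degree comes from extremal paths: there is a shape that only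
paths of maximal length attain, so that only the leading coefficient contributes to it
(`pathCount_two_pos`, `pathCount_three_pos`), and its coefficient enters through a square. In degree
at most five the variance is an explicit quadratic form, which the Cauchy–Schwarz inequalities
between `X`, `X²` and `X³` show to vanish only in the exceptional case
(`BoundedIID.cubic_form_pos_iff`). Finally, variables that are bounded almost surely are replaced by
variables that are bounded everywhere (`exists_boundedIID`).
-/

namespace DecayingSchrodinger

/-! ### Closed paths and the trace formula -/

/-- The closed integer paths `(0 = y₀, …, y_k = 0)` with steps in `{-1, 0, 1}`, as a finite set. -/
noncomputable def paths (k : ℕ) : Finset (Fin (k + 1) → ℤ) :=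
  (Fintype.piFinset fun _ => Finset.Icc (-k : ℤ) k).filter fun y =>
    y 0 = 0 ∧ y (Fin.last k) = 0 ∧ ∀ t : Fin k, |y t.succ - y t.castSucc| ≤ 1

/-- The levels of the flat steps of a path, with multiplicity. -/
def flats {k : ℕ} (y : Fin (k + 1) → ℤ) : Multiset ℤ :=
  (Finset.univ.filter fun t : Fin k => y t.castSucc = y t.succ).val.map fun t => y t.castSucc

/-- The depth `-min y` of a path starting at `0`. -/
def depth {k : ℕ} (y : Fin (k + 1) → ℤ) : ℕ := Finset.univ.sup fun t => (-(y t)).toNat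

/-- The height `max y` of a path starting at `0`. -/
def height {k : ℕ} (y : Fin (k + 1) → ℤ) : ℕ := Finset.univ.sup fun t => (y t).toNat

/-- The levels of the flat steps of a path, measured from the lowest point of the path. -/
def offsets {k : ℕ} (y : Fin (k + 1) → ℤ) : Multiset ℕ :=
  (flats y).map fun h => (h + (depth y : ℤ)).toNat

lemma abs_path_le {k : ℕ} {y : Fin (k + 1) → ℤ} (h0 : y 0 = 0)
    (hs : ∀ t : Fin k, |y t.succ - y t.castSucc| ≤ 1) (t : Fin (k + 1)) : |y t| ≤ (t : ℕ) := by
  induction t using Fin.induction with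
  | zero => simp [h0]
  | succ i ih =>
    have := hs i
    rw [abs_le] at *
    simp only [Fin.val_castSucc, Fin.val_succ] at *
    push_cast at *
    constructor <;> linarith

lemma mem_paths {k : ℕ} {y : Fin (k + 1) → ℤ} : y ∈ paths k ↔
    y 0 = 0 ∧ y (Fin.last k) = 0 ∧ ∀ t : Fin k, |y t.succ - y t.castSucc| ≤ 1 := by
  rw [paths, Finset.mem_filter, Fintype.mem_piFinset]
  refine ⟨fun h => h.2, fun h => ⟨fun t => ?_, h⟩⟩
  have h1 := abs_path_le h.1 h.2.2 t
  have h2 : (t : ℕ) ≤ k := Nat.lt_succ_iff.mp t.2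
  rw [abs_le] at h1
  rw [Finset.mem_Icc]
  constructor <;> omega

lemma neg_depth_le {k : ℕ} (y : Fin (k + 1) → ℤ) (t : Fin (k + 1)) : -(depth y : ℤ) ≤ y t := by
  have : (-(y t)).toNat ≤ depth y :=
    Finset.le_sup (f := fun t => (-(y t)).toNat) (Finset.mem_univ t)
  omega

lemma le_height {k : ℕ} (y : Fin (k + 1) → ℤ) (t : Fin (k + 1)) : y t ≤ height y := by
  have : (y t).toNat ≤ height y :=
    Finset.le_sup (f := fun t => (y t).toNat) (Finset.mem_univ t)
  omega

lemma exists_eq_neg_depth {k : ℕ} {y : Fin (k + 1) → ℤ} (h0 : y 0 = 0) :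
    ∃ t, y t = -(depth y : ℤ) := by
  obtain ⟨t, -, ht⟩ := Finset.exists_mem_eq_sup (Finset.univ : Finset (Fin (k + 1)))
    Finset.univ_nonempty (fun t => (-(y t)).toNat)
  have ht' : depth y = (-(y t)).toNat := ht
  rcases le_or_gt (y t) 0 with h | h
  · exact ⟨t, by omega⟩
  · exact ⟨0, by omega⟩

lemma exists_eq_height {k : ℕ} {y : Fin (k + 1) → ℤ} (h0 : y 0 = 0) :
    ∃ t, y t = height y := by
  obtain ⟨t, -, ht⟩ := Finset.exists_mem_eq_sup (Finset.univ : Finset (Fin (k + 1)))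
    Finset.univ_nonempty (fun t => (y t).toNat)
  have ht' : height y = (y t).toNat := ht
  rcases le_or_gt 0 (y t) with h | h
  · exact ⟨t, by omega⟩
  · exact ⟨0, by omega⟩

/-- Entries of a matrix power as a sum over walks. -/
lemma matrix_pow_apply {N : ℕ} (H : Matrix (Fin N) (Fin N) ℝ) (k : ℕ) (i j : Fin N) :
    (H ^ k) i j = ∑ p : Fin (k + 1) → Fin N,
      if p 0 = i ∧ p (Fin.last k) = j then ∏ t : Fin k, H (p t.castSucc) (p t.succ) else 0 := by
  induction k generalizing i j with
  | zero =>
    rw [pow_zero, ← (Equiv.funUnique (Fin 1) (Fin N)).symm.sum_comp]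
    simp only [Matrix.one_apply, Finset.univ_eq_empty, Finset.prod_empty]
    simp only [Equiv.funUnique_symm_apply, Fin.last_zero, uniqueElim_const]
    rw [Finset.sum_ite, Finset.sum_const_zero, add_zero, Finset.sum_const]
    split_ifs with h
    · subst h
      simp [Finset.filter_eq']
    · rw [Finset.filter_eq_empty_iff.mpr]
      · simp
      · rintro x - ⟨rfl, rfl⟩
        exact h rfl
  | succ k ih =>
    rw [pow_succ', Matrix.mul_apply, ← (Fin.consEquiv (fun _ => Fin N)).sum_comp,
      Fintype.sum_prod_type]
    simp only [Fin.consEquiv, Equiv.coe_fn_mk, Fin.prod_univ_succ, Fin.cons_zero, Fin.cons_succ,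
      Fin.castSucc_zero, ← Fin.succ_castSucc, ← Fin.succ_last]
    symm
    rw [Finset.sum_eq_single i]
    · simp only [ih, Finset.mul_sum, true_and]
      rw [Finset.sum_comm]
      refine Finset.sum_congr rfl fun p _ => ?_
      symm
      rw [Finset.sum_eq_single (p 0)]
      · simp
      · intro l _ hl
        simp [hl.symm]
      · simp
    · intro a _ ha
      simp [ha]
    · simp

/-- The trace of a power as a sum over closed paths: each path contributes the sum, over its
positions inside `{0, …, N - 1}`, of the product of the potential over its flat steps. Positions are
labelled by the site of the lowest point. -/
lemma trace_pow_eq {N : ℕ} (H : Matrix (Fin N) (Fin N) ℝ) (v : ℕ → ℝ)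
    (hH : ∀ i j : Fin N, H i j =
      if i = j then v i else if (i : ℕ) + 1 = j ∨ (j : ℕ) + 1 = i then 1 else 0) (k : ℕ) :
    (H ^ k).trace = ∑ y ∈ paths k, ∑ i ∈ Finset.range (N - (depth y + height y)),
      ((offsets y).map fun s => v (i + s)).prod := by
  have h1 : (H ^ k).trace = ∑ p : Fin (k + 1) → Fin N,
      if p 0 = p (Fin.last k) then ∏ t : Fin k, H (p t.castSucc) (p t.succ) else 0 := by
    simp only [Matrix.trace, Matrix.diag_apply, matrix_pow_apply]
    rw [Finset.sum_comm]
    refine Finset.sum_congr rfl fun p _ => ?_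
    rw [Finset.sum_eq_single (p 0)]
    · simp [eq_comm]
    · intro l _ hl
      simp [hl.symm]
    · simp
  have h2 : (H ^ k).trace = ∑ p ∈ Finset.univ.filter (fun p : Fin (k + 1) → Fin N =>
      p 0 = p (Fin.last k) ∧ ∀ t : Fin k, |((p t.succ : ℕ) : ℤ) - (p t.castSucc : ℕ)| ≤ 1),
      ∏ t : Fin k, H (p t.castSucc) (p t.succ) := by
    rw [h1, Finset.sum_filter]
    refine Finset.sum_congr rfl fun p _ => ?_
    by_cases h : p 0 = p (Fin.last k)
    · simp only [h, if_true, true_and]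
      split_ifs with h'
      · rfl
      · push Not at h'
        obtain ⟨t, ht⟩ := h'
        refine Finset.prod_eq_zero (Finset.mem_univ t) ?_
        rw [hH, if_neg, if_neg]
        · rintro (h | h) <;> rw [lt_abs] at ht <;> omega
        · intro h
          rw [h] at ht
          simp at ht
    · simp [h]
  rw [h2, Finset.sum_sigma']
  have hmem : ∀ a : (Σ _ : Fin (k + 1) → ℤ, ℕ), a ∈ (paths k).sigma
      (fun y => Finset.range (N - (depth y + height y))) → ∀ t,
      ((a.2 : ℤ) + depth a.1 + a.1 t).toNat < N := by
    intro a ha t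
    rw [Finset.mem_sigma, Finset.mem_range] at ha
    have := le_height a.1 t
    omega
  refine Finset.sum_bij' (fun p _ => ⟨fun t => ((p t : ℕ) : ℤ) - (p 0 : ℕ),
      (p 0 : ℕ) - depth (fun t => ((p t : ℕ) : ℤ) - (p 0 : ℕ))⟩)
    (fun a ha t => ⟨_, hmem a ha t⟩) ?_ ?_ ?_ ?_ ?_
  · intro p hp
    rw [Finset.mem_filter] at hp
    rw [Finset.mem_sigma, mem_paths, Finset.mem_range]
    refine ⟨⟨by simp, by simp [hp.2.1], fun t => ?_⟩, ?_⟩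
    · have := hp.2.2 t
      convert this using 2
      ring
    · dsimp only
      obtain ⟨a, ha⟩ := exists_eq_neg_depth
        (y := fun t => ((p t : ℕ) : ℤ) - (p 0 : ℕ)) (by simp)
      obtain ⟨b, hb⟩ := exists_eq_height
        (y := fun t => ((p t : ℕ) : ℤ) - (p 0 : ℕ)) (by simp)
      have h3 := (p b).2
      omega
  · intro a ha
    rw [Finset.mem_sigma, mem_paths] at ha
    rw [Finset.mem_filter]
    refine ⟨Finset.mem_univ _, ?_, fun t => ?_⟩
    · ext
      simp [ha.1.1, ha.1.2.1]
    · have h1 := neg_depth_le a.1 t.succ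
      have h2 := neg_depth_le a.1 t.castSucc
      have h3 := ha.1.2.2 t
      change |(((a.2 : ℤ) + depth a.1 + a.1 t.succ).toNat : ℤ)
        - (((a.2 : ℤ) + depth a.1 + a.1 t.castSucc).toNat : ℕ)| ≤ 1
      rw [abs_le] at h3 ⊢
      omega
  · intro p hp
    obtain ⟨a, ha⟩ := exists_eq_neg_depth
        (y := fun t => ((p t : ℕ) : ℤ) - (p 0 : ℕ)) (by simp)
    funext t
    ext
    have h3 : depth (fun t => ((p t : ℕ) : ℤ) - (p 0 : ℕ)) ≤ (p 0 : ℕ) := by omega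
    push_cast [h3]
    omega
  · rintro ⟨y, i⟩ ha
    rw [Finset.mem_sigma, mem_paths] at ha
    have hy0 : y 0 = 0 := ha.1.1
    have h0 : ∀ t, ((((i : ℤ) + depth y + y t).toNat : ℕ) : ℤ)
        - (((i : ℤ) + depth y + y 0).toNat : ℕ) = y t := by
      intro t
      have h1 := neg_depth_le y t
      rw [hy0]
      omega
    refine Sigma.ext (funext h0) (heq_of_eq ?_)
    change (((i : ℤ) + depth y + y 0).toNat - depth (fun t =>
      ((((i : ℤ) + depth y + y t).toNat : ℕ) : ℤ) - (((i : ℤ) + depth y + y 0).toNat : ℕ))) = i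
    rw [funext h0, hy0]
    omega
  · intro p hp
    rw [Finset.mem_filter] at hp
    obtain ⟨a, ha⟩ := exists_eq_neg_depth
        (y := fun t => ((p t : ℕ) : ℤ) - (p 0 : ℕ)) (by simp)
    have hlow := neg_depth_le (fun t => ((p t : ℕ) : ℤ) - (p 0 : ℕ))
    simp only [offsets, flats, Multiset.map_map]
    generalize depth (fun t => ((p t : ℕ) : ℤ) - (p 0 : ℕ)) = d at ha hlow ⊢
    have : ∀ t : Fin k, H (p t.castSucc) (p t.succ) =
        if ((p t.castSucc : ℕ) : ℤ) - (p 0 : ℕ) = ((p t.succ : ℕ) : ℤ) - (p 0 : ℕ) then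
          v ((p 0 : ℕ) - d + (((p t.castSucc : ℕ) : ℤ) - (p 0 : ℕ) + d).toNat) else 1 := by
      intro t
      rw [hH]
      have h4 := hp.2.2 t
      have h5 := hlow t.castSucc
      rw [abs_le] at h4
      by_cases h : p t.castSucc = p t.succ
      · have h6 : (p 0 : ℕ) - d + (((p t.castSucc : ℕ) : ℤ) - (p 0 : ℕ) + d).toNat =
          (p t.castSucc : ℕ) := by omega
        rw [if_pos h, h6, if_pos (by rw [h])]
      · have h' : (p t.castSucc : ℕ) ≠ p t.succ := fun h' => h (Fin.ext h')
        have h6 : (p t.castSucc : ℕ) + 1 = p t.succ ∨ (p t.succ : ℕ) + 1 = p t.castSucc := by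
          omega
        have h7 : ¬ ((p t.castSucc : ℕ) : ℤ) - (p 0 : ℕ) = ((p t.succ : ℕ) : ℤ) - (p 0 : ℕ) := by
          omega
        rw [if_neg h, if_pos h6, if_neg h7]
    simp only [this]
    rw [← Finset.prod_filter]
    rfl

/-! ### Shapes of paths -/

lemma mem_pathSet {k : ℕ} {β : ℤ →₀ ℕ} {y : Fin (k + 1) → ℤ} : y ∈ pathSet k β ↔
    y ∈ paths k ∧ ∃ i : ℤ, ∀ h : ℤ, β (h - i) = (flats y).count h := by
  rw [mem_paths, pathSet, Set.mem_ofPred_eq, and_assoc, and_assoc]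
  have : ∀ h : ℤ, (Finset.univ.filter fun t : Fin k => y t.castSucc = h ∧ y t.succ = h).card =
      (flats y).count h := by
    intro h
    rw [flats, Multiset.count_map, Finset.card_def, Finset.filter_val, Finset.filter_val,
      Multiset.filter_filter]
    congr 1
    refine Multiset.filter_congr fun t _ => ?_
    constructor <;> rintro ⟨h1, h2⟩ <;> constructor <;> omega
  simp only [this]

lemma pathCount_eq {k : ℕ} {β : ℤ →₀ ℕ} {p : (Fin (k + 1) → ℤ) → Prop} [DecidablePred p]
    (h : ∀ y ∈ paths k, y ∈ pathSet k β ↔ p y) :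
    pathCount k β = ((paths k).filter p).card := by
  rw [pathCount, ← Set.ncard_coe_finset]
  congr 2
  ext y
  rw [Finset.mem_coe, Finset.mem_filter]
  exact ⟨fun hy => ⟨(mem_pathSet.mp hy).1, (h y (mem_pathSet.mp hy).1).mp hy⟩,
    fun hy => (h y hy.1).mpr hy.2⟩

lemma mem_pathSet_one {k : ℕ} {y : Fin (k + 1) → ℤ} (hy : y ∈ paths k) :
    y ∈ pathSet k (del 0) ↔ ∃ i : ℤ, flats y = {i} := by
  rw [mem_pathSet, and_iff_right hy]
  refine exists_congr fun i => ?_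
  rw [Multiset.ext]
  refine forall_congr' fun h => ?_
  simp only [del, Finsupp.single_apply, Multiset.count_singleton]
  split_ifs <;> omega

lemma mem_pathSet_two {k s : ℕ} {y : Fin (k + 1) → ℤ} (hy : y ∈ paths k) :
    y ∈ pathSet k (del 0 + del s) ↔ ∃ i : ℤ, flats y = {i, i + s} := by
  rw [mem_pathSet, and_iff_right hy]
  refine exists_congr fun i => ?_
  rw [Multiset.ext]
  refine forall_congr' fun h => ?_
  simp only [del, Finsupp.add_apply, Finsupp.single_apply, Multiset.insert_eq_cons,
    Multiset.count_cons, Multiset.count_singleton]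
  split_ifs <;> omega

lemma mem_pathSet_three {k s t : ℕ} {y : Fin (k + 1) → ℤ} (hy : y ∈ paths k) :
    y ∈ pathSet k (del 0 + del s + del (s + t)) ↔
      ∃ i : ℤ, flats y = {i, i + s, i + s + t} := by
  rw [mem_pathSet, and_iff_right hy]
  refine exists_congr fun i => ?_
  rw [Multiset.ext]
  refine forall_congr' fun h => ?_
  simp only [del, Finsupp.add_apply, Finsupp.single_apply, Multiset.insert_eq_cons,
    Multiset.count_cons, Multiset.count_singleton]
  split_ifs <;> omega

/-- The number of non-flat steps of a path is the length of its variation. -/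
lemma sum_abs_step {k : ℕ} {y : Fin (k + 1) → ℤ} (hy : y ∈ paths k) :
    ∑ t : Fin k, |y t.succ - y t.castSucc| + (flats y).card = k := by
  have h1 : ∀ t : Fin k, |y t.succ - y t.castSucc| =
      1 - if y t.castSucc = y t.succ then 1 else 0 := by
    intro t
    have := (mem_paths.mp hy).2.2 t
    have h0 := abs_nonneg (y t.succ - y t.castSucc)
    split_ifs with h
    · simp [h]
    · have : |y t.succ - y t.castSucc| ≠ 0 := by
        rw [abs_ne_zero]
        omega
      omega
  rw [Finset.sum_congr rfl fun t _ => h1 t, Finset.sum_sub_distrib, flats, Multiset.card_map,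
    ← Finset.sum_filter, ← Finset.card_def]
  simp

/-- A path with its time extended constantly, as a function of a natural number. -/
def extend {k : ℕ} (y : Fin (k + 1) → ℤ) (n : ℕ) : ℤ := y (Fin.ofNat (k + 1) (min n k))

lemma extend_castSucc {k : ℕ} (y : Fin (k + 1) → ℤ) (t : Fin k) :
    extend y t = y t.castSucc := by
  rw [extend]
  congr 1
  ext
  have := t.2
  simp only [Fin.ofNat, Fin.val_castSucc]
  rw [min_eq_left (by omega), Nat.mod_eq_of_lt (by omega)]

lemma extend_val {k : ℕ} (y : Fin (k + 1) → ℤ) (t : Fin (k + 1)) :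
    extend y t = y t := by
  rw [extend]
  congr 1
  ext
  have := t.2
  simp only [Fin.ofNat]
  rw [min_eq_left (by omega), Nat.mod_eq_of_lt (by omega)]

lemma extend_zero {k : ℕ} {y : Fin (k + 1) → ℤ} (hy : y ∈ paths k) : extend y 0 = 0 := by
  have := extend_val y 0
  rw [Fin.val_zero] at this
  rw [this, (mem_paths.mp hy).1]

lemma extend_last {k : ℕ} {y : Fin (k + 1) → ℤ} (hy : y ∈ paths k) : extend y k = 0 := by
  have := extend_val y (Fin.last k)
  rw [Fin.val_last] at this
  rw [this, (mem_paths.mp hy).2.1]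

lemma sum_range_step {k : ℕ} (y : Fin (k + 1) → ℤ) (g : ℤ → ℤ) :
    ∑ t : Fin k, g (y t.succ - y t.castSucc) =
      ∑ n ∈ Finset.range k, g (extend y (n + 1) - extend y n) := by
  rw [Finset.sum_range]
  refine Finset.sum_congr rfl fun t _ => ?_
  rw [extend_castSucc, ← extend_val y t.succ, Fin.val_succ]

/-- The number of flat steps of a closed path of length `k` has the parity of `k`. -/
lemma even_sub_card_flats {k : ℕ} {y : Fin (k + 1) → ℤ} (hy : y ∈ paths k) :
    Even ((k : ℤ) - (flats y).card) := by
  have h1 := sum_abs_step hy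
  have h2 : ∑ t : Fin k, (y t.succ - y t.castSucc) = 0 := by
    rw [show ∑ t : Fin k, (y t.succ - y t.castSucc) =
      ∑ n ∈ Finset.range k, (extend y (n + 1) - extend y n) from sum_range_step y id, Finset.sum_range_sub,
      extend_zero hy, extend_last hy, sub_zero]
  have h3 : (k : ℤ) - (flats y).card =
      ∑ t : Fin k, (|y t.succ - y t.castSucc| - (y t.succ - y t.castSucc)) := by
    rw [Finset.sum_sub_distrib, h2]
    linarith
  rw [h3]
  refine Finset.even_sum _ fun t _ => ?_
  rcases abs_choice (y t.succ - y t.castSucc) with h | h <;> rw [h]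
  · simp
  · exact ⟨-(y t.succ - y t.castSucc), by ring⟩

/-- A closed path covers the distance between any two of its levels at least twice. -/
lemma two_mul_dist_le {k : ℕ} {y : Fin (k + 1) → ℤ} (hy : y ∈ paths k) (a b : Fin (k + 1)) :
    2 * (y b - y a) + (flats y).card ≤ k := by
  have h1 := sum_abs_step hy
  rw [sum_range_step y (fun x => |x|)] at h1
  have key : ∀ m n : ℕ, m ≤ n → |extend y m - extend y n| ≤
      ∑ i ∈ Finset.Ico m n, |extend y (i + 1) - extend y i| := by
    intro m n hmn
    have := dist_le_Ico_sum_dist (extend y) hmn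
    simp only [Int.dist_eq] at this
    have h2 : ∀ i, |(extend y i : ℝ) - extend y (i + 1)| =
        ((|extend y (i + 1) - extend y i| : ℤ) : ℝ) := by
      intro i
      push_cast
      rw [abs_sub_comm]
    simp only [h2] at this
    exact_mod_cast this
  have h0 := extend_zero hy
  have hk := extend_last hy
  have main : ∀ m n : ℕ, m ≤ n → n ≤ k → 2 * |extend y m - extend y n| + (flats y).card ≤ k := by
    intro m n hmn hn
    have e1 := key 0 m (Nat.zero_le _)
    have e2 := key m n hmn
    have e3 := key n k hn
    have e4 : ∑ i ∈ Finset.Ico 0 m, |extend y (i + 1) - extend y i|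
        + ∑ i ∈ Finset.Ico m n, |extend y (i + 1) - extend y i|
        + ∑ i ∈ Finset.Ico n k, |extend y (i + 1) - extend y i|
        = ∑ i ∈ Finset.range k, |extend y (i + 1) - extend y i| := by
      rw [Finset.sum_Ico_consecutive _ (Nat.zero_le _) hmn,
        Finset.sum_Ico_consecutive _ (Nat.zero_le _) hn, Finset.range_eq_Ico]
    have e5 : |extend y m - extend y n| ≤ |extend y 0 - extend y m| + |extend y n - extend y k| := by
      rw [h0, hk, zero_sub, sub_zero, abs_neg]
      exact abs_sub _ _
    linarith
  rw [← extend_val y a, ← extend_val y b]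
  have ha := a.2
  have hb := b.2
  rcases le_total (a : ℕ) b with h | h
  · have := main a b h (by omega)
    have := neg_abs_le (extend y a - extend y b)
    linarith
  · have := main b a h (by omega)
    have := le_abs_self (extend y b - extend y a)
    linarith

lemma mem_flats {k : ℕ} {y : Fin (k + 1) → ℤ} {h : ℤ} (hh : h ∈ flats y) : ∃ t, y t = h := by
  rw [flats, Multiset.mem_map] at hh
  obtain ⟨t, -, rfl⟩ := hh
  exact ⟨_, rfl⟩


/-! ### Bounded sequences with finite range of dependence -/

section FiniteRange

variable {Ω : Type*} {mΩ : MeasurableSpace Ω} {μ : Measure Ω}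
  {ℱ : Filtration ℕ mΩ} {L : ℕ} {K : ℝ} {Z : ℕ → Ω → ℝ}

/-- A uniformly bounded sequence that is centred with respect to a filtration and looks at most
`L` steps ahead of it. For `L = 0` these are bounded martingale differences. -/
structure FiniteRange (μ : Measure Ω) (ℱ : Filtration ℕ mΩ) (L : ℕ) (K : ℝ) (Z : ℕ → Ω → ℝ) :
    Prop where
  adapted : ∀ i, StronglyMeasurable[ℱ (i + L + 1)] (Z i)
  bound : ∀ i ω, |Z i ω| ≤ K
  condExp : ∀ i, μ[Z i | ℱ i] =ᵐ[μ] 0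

lemma FiniteRange.measurable (hZ : FiniteRange μ ℱ L K Z) (i : ℕ) : StronglyMeasurable (Z i) :=
  (hZ.adapted i).mono (ℱ.le _)

lemma FiniteRange.measurable_sum (hZ : FiniteRange μ ℱ L K Z) (c : ℕ → ℝ) (N : ℕ) :
    StronglyMeasurable fun ω => ∑ i ∈ Finset.range N, c i * Z i ω :=
  Finset.stronglyMeasurable_fun_sum _ fun i _ => (hZ.measurable i).const_mul _

lemma eLpNorm_two_le {f : Ω → ℝ} (hf : AEStronglyMeasurable f μ)
    (hint : Integrable (fun ω => f ω ^ 2) μ)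
    {C : ℝ} (hC : ∫ ω, f ω ^ 2 ∂μ ≤ C) :
    eLpNorm f 2 μ ≤ (Real.toNNReal (Real.sqrt C) : ENNReal) := by
  have h2 : MemLp f 2 μ := (memLp_two_iff_integrable_sq hf).mpr hint
  rw [h2.eLpNorm_eq_integral_rpow_norm (by norm_num) (by norm_num)]
  change ENNReal.ofReal _ ≤ ENNReal.ofReal _
  refine ENNReal.ofReal_le_ofReal ?_
  simp only [ENNReal.toReal_ofNat, Real.norm_eq_abs]
  rw [Real.sqrt_eq_rpow, one_div]
  refine Real.rpow_le_rpow ?_ ?_ (by norm_num)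
  · exact integral_nonneg fun ω => by positivity
  · refine le_trans (le_of_eq ?_) hC
    congr 1
    ext ω
    rw [← sq_abs]
    norm_cast

variable [IsProbabilityMeasure μ]

lemma integrable_of_abs_le {f : Ω → ℝ} (hf : AEStronglyMeasurable f μ) {C : ℝ}
    (hb : ∀ ω, |f ω| ≤ C) : Integrable f μ :=
  Integrable.of_bound hf C (ae_of_all _ hb)

lemma FiniteRange.integrable (hZ : FiniteRange μ ℱ L K Z) (i : ℕ) : Integrable (Z i) μ :=
  integrable_of_abs_le (hZ.measurable i).aestronglyMeasurable (hZ.bound i)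

lemma FiniteRange.integral_mul_eq_zero (hZ : FiniteRange μ ℱ L K Z) {i : ℕ} {f : Ω → ℝ}
    (hf : StronglyMeasurable[ℱ i] f) {C : ℝ} (hb : ∀ ω, |f ω| ≤ C) :
    ∫ ω, f ω * Z i ω ∂μ = 0 := by
  have hint : Integrable (f * Z i) μ :=
    integrable_of_abs_le (C := C * K)
      ((hf.mono (ℱ.le _)).mul (hZ.measurable i)).aestronglyMeasurable fun ω => by
        rw [Pi.mul_apply, abs_mul]
        exact mul_le_mul (hb ω) (hZ.bound i ω) (abs_nonneg _) ((abs_nonneg _).trans (hb ω))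
  have h := condExp_mul_of_stronglyMeasurable_left hf hint (hZ.integrable i)
  change ∫ ω, (f * Z i) ω ∂μ = 0
  rw [← integral_condExp (ℱ.le i), integral_congr_ae h]
  have h2 : f * μ[Z i | ℱ i] =ᵐ[μ] 0 := by
    filter_upwards [hZ.condExp i] with ω hω
    simp [hω]
  rw [integral_congr_ae h2]
  simp

lemma abs_sum_mul_le {c : ℕ → ℝ} (hb : ∀ i ω, |Z i ω| ≤ K) (N : ℕ) (ω : Ω) :
    |∑ i ∈ Finset.range N, c i * Z i ω| ≤ (∑ i ∈ Finset.range N, |c i|) * K := by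
  refine (Finset.abs_sum_le_sum_abs _ _).trans ?_
  rw [Finset.sum_mul]
  refine Finset.sum_le_sum fun i _ => ?_
  rw [abs_mul]
  exact mul_le_mul_of_nonneg_left (hb i ω) (abs_nonneg _)

lemma FiniteRange.integrable_sum (hZ : FiniteRange μ ℱ L K Z) (c : ℕ → ℝ) (N : ℕ) :
    Integrable (fun ω => ∑ i ∈ Finset.range N, c i * Z i ω) μ :=
  integrable_of_abs_le (hZ.measurable_sum c N).aestronglyMeasurable (abs_sum_mul_le hZ.bound N)

lemma le_of_modEq {L r n N : ℕ} (hn : n % (L + 1) = r) (hN : N % (L + 1) = r) (h : n < N) :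
    n + L + 1 ≤ N := by
  have h1 := Nat.div_add_mod n (L + 1)
  have h2 := Nat.div_add_mod N (L + 1)
  rw [hn] at h1
  rw [hN] at h2
  have h3 : n / (L + 1) < N / (L + 1) := by
    by_contra h4
    push Not at h4
    have := Nat.mul_le_mul_left (L + 1) h4
    omega
  have := Nat.mul_le_mul_left (L + 1) (Nat.succ_le_of_lt h3)
  rw [Nat.mul_succ] at this
  omega

/-- Along a residue class modulo `L + 1` the terms are orthogonal. -/
lemma FiniteRange.integral_sq_sum_le_of_residue (hZ : FiniteRange μ ℱ L K Z) {r : ℕ} {c : ℕ → ℝ}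
    (hc : ∀ n, n % (L + 1) ≠ r → c n = 0) (N : ℕ) :
    ∫ ω, (∑ i ∈ Finset.range N, c i * Z i ω) ^ 2 ∂μ ≤
      K ^ 2 * ∑ i ∈ Finset.range N, c i ^ 2 := by
  induction N with
  | zero => simp
  | succ N ih =>
    have hS := hZ.integrable_sum c N
    by_cases hN : N % (L + 1) = r
    · have hmeas : StronglyMeasurable[ℱ N] fun ω => ∑ i ∈ Finset.range N, c i * Z i ω := by
        refine Finset.stronglyMeasurable_fun_sum _ fun i hi => ?_
        by_cases hi' : i % (L + 1) = r
        · exact ((hZ.adapted i).mono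
            (ℱ.mono (le_of_modEq hi' hN (Finset.mem_range.mp hi)))).const_mul _
        · simp only [hc i hi', zero_mul]
          exact stronglyMeasurable_const
      have h0 := hZ.integral_mul_eq_zero hmeas (abs_sum_mul_le hZ.bound N)
      have hI1 : Integrable (fun ω => (∑ i ∈ Finset.range N, c i * Z i ω) ^ 2) μ :=
        integrable_of_abs_le (C := ((∑ i ∈ Finset.range N, |c i|) * K) ^ 2)
          ((hZ.measurable_sum c N).pow 2).aestronglyMeasurable fun ω => by
            rw [abs_pow]
            exact pow_le_pow_left₀ (abs_nonneg _) (abs_sum_mul_le hZ.bound N ω) 2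
      have hI2 : Integrable (fun ω => (∑ i ∈ Finset.range N, c i * Z i ω) * Z N ω) μ :=
        integrable_of_abs_le (C := ((∑ i ∈ Finset.range N, |c i|) * K) * K)
          ((hZ.measurable_sum c N).mul (hZ.measurable N)).aestronglyMeasurable fun ω => by
            rw [abs_mul]
            exact mul_le_mul (abs_sum_mul_le hZ.bound N ω) (hZ.bound N ω) (abs_nonneg _)
              ((abs_nonneg _).trans (abs_sum_mul_le hZ.bound N ω))
      have hI3 : Integrable (fun ω => Z N ω ^ 2) μ :=
        integrable_of_abs_le (C := K ^ 2) ((hZ.measurable N).pow 2).aestronglyMeasurable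
          fun ω => by
            rw [abs_pow]
            exact pow_le_pow_left₀ (abs_nonneg _) (hZ.bound N ω) 2
      have h3 : ∫ ω, Z N ω ^ 2 ∂μ ≤ K ^ 2 := by
        calc ∫ ω, Z N ω ^ 2 ∂μ ≤ ∫ _, K ^ 2 ∂μ :=
              integral_mono hI3 (integrable_const _) fun ω => by
                have := pow_le_pow_left₀ (abs_nonneg _) (hZ.bound N ω) 2
                rwa [sq_abs] at this
          _ = K ^ 2 := by simp
      have hexp : ∀ ω, (∑ i ∈ Finset.range (N + 1), c i * Z i ω) ^ 2 =
          (∑ i ∈ Finset.range N, c i * Z i ω) ^ 2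
            + 2 * c N * ((∑ i ∈ Finset.range N, c i * Z i ω) * Z N ω) + c N ^ 2 * Z N ω ^ 2 := by
        intro ω
        rw [Finset.sum_range_succ]
        ring
      have hI12 : Integrable (fun ω => (∑ i ∈ Finset.range N, c i * Z i ω) ^ 2
          + 2 * c N * ((∑ i ∈ Finset.range N, c i * Z i ω) * Z N ω)) μ :=
        hI1.add (hI2.const_mul _)
      simp only [hexp]
      rw [integral_add hI12 (hI3.const_mul _),
        integral_add hI1 (hI2.const_mul _), integral_const_mul, integral_const_mul, h0,
        Finset.sum_range_succ]
      nlinarith [mul_le_mul_of_nonneg_left h3 (sq_nonneg (c N))]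
    · simp only [Finset.sum_range_succ, hc N hN, zero_mul, add_zero]
      simpa using ih

/-- The part of a sequence of coefficients on one residue class. -/
def residuePart (L : ℕ) (c : ℕ → ℝ) (r n : ℕ) : ℝ := if n % (L + 1) = r then c n else 0

lemma sum_residuePart (L : ℕ) (c : ℕ → ℝ) (n : ℕ) :
    ∑ r ∈ Finset.range (L + 1), residuePart L c r n = c n := by
  simp only [residuePart]
  rw [Finset.sum_ite_eq, if_pos (Finset.mem_range.mpr (Nat.mod_lt _ (Nat.succ_pos L)))]

lemma residuePart_eq_zero {L : ℕ} {c : ℕ → ℝ} {r n : ℕ} (h : n % (L + 1) ≠ r) :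
    residuePart L c r n = 0 := if_neg h

lemma residuePart_sq_le (L : ℕ) (c : ℕ → ℝ) (r n : ℕ) : residuePart L c r n ^ 2 ≤ c n ^ 2 := by
  rw [residuePart]
  split_ifs
  · exact le_rfl
  · simpa using sq_nonneg (c n)

lemma sum_eq_sum_residuePart (L : ℕ) (c : ℕ → ℝ) (z : ℕ → ℝ) (N : ℕ) :
    ∑ i ∈ Finset.range N, c i * z i =
      ∑ r ∈ Finset.range (L + 1), ∑ i ∈ Finset.range N, residuePart L c r i * z i := by
  rw [Finset.sum_comm]
  refine Finset.sum_congr rfl fun i _ => ?_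
  rw [← Finset.sum_mul, sum_residuePart]

/-- Second moments of weighted sums are controlled by the squares of the weights: split the sum into
the `L + 1` residue classes, along each of which the terms are orthogonal. -/
lemma FiniteRange.integral_sq_sum_le (hZ : FiniteRange μ ℱ L K Z) (c : ℕ → ℝ) (N : ℕ) :
    ∫ ω, (∑ i ∈ Finset.range N, c i * Z i ω) ^ 2 ∂μ ≤
      (L + 1) ^ 2 * K ^ 2 * ∑ i ∈ Finset.range N, c i ^ 2 := by
  have hI : ∀ r, Integrable
      (fun ω => (∑ i ∈ Finset.range N, residuePart L c r i * Z i ω) ^ 2) μ := fun r =>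
    integrable_of_abs_le (C := ((∑ i ∈ Finset.range N, |residuePart L c r i|) * K) ^ 2)
      ((hZ.measurable_sum _ N).pow 2).aestronglyMeasurable fun ω => by
        rw [abs_pow]
        exact pow_le_pow_left₀ (abs_nonneg _) (abs_sum_mul_le hZ.bound N ω) 2
  have hI0 : Integrable (fun ω => (∑ i ∈ Finset.range N, c i * Z i ω) ^ 2) μ :=
    integrable_of_abs_le (C := ((∑ i ∈ Finset.range N, |c i|) * K) ^ 2)
      ((hZ.measurable_sum _ N).pow 2).aestronglyMeasurable fun ω => by
        rw [abs_pow]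
        exact pow_le_pow_left₀ (abs_nonneg _) (abs_sum_mul_le hZ.bound N ω) 2
  calc ∫ ω, (∑ i ∈ Finset.range N, c i * Z i ω) ^ 2 ∂μ
      ≤ ∫ ω, (L + 1) * ∑ r ∈ Finset.range (L + 1),
          (∑ i ∈ Finset.range N, residuePart L c r i * Z i ω) ^ 2 ∂μ := by
        refine integral_mono hI0 ((integrable_finsetSum _ fun r _ => hI r).const_mul _)
          fun ω => ?_
        dsimp only
        rw [sum_eq_sum_residuePart L]
        have := sq_sum_le_card_mul_sum_sq (s := Finset.range (L + 1))
          (f := fun r => ∑ i ∈ Finset.range N, residuePart L c r i * Z i ω)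
        simpa using this
    _ = (L + 1) * ∑ r ∈ Finset.range (L + 1),
          ∫ ω, (∑ i ∈ Finset.range N, residuePart L c r i * Z i ω) ^ 2 ∂μ := by
        rw [integral_const_mul, integral_finsetSum _ fun r _ => hI r]
    _ ≤ (L + 1) * ∑ r ∈ Finset.range (L + 1), K ^ 2 * ∑ i ∈ Finset.range N, c i ^ 2 := by
        refine mul_le_mul_of_nonneg_left (Finset.sum_le_sum fun r _ => ?_) (by positivity)
        refine (hZ.integral_sq_sum_le_of_residue (fun n hn => residuePart_eq_zero hn) N).trans ?_
        exact mul_le_mul_of_nonneg_left (Finset.sum_le_sum fun i _ => residuePart_sq_le L c r i)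
          (sq_nonneg _)
    _ = (L + 1) ^ 2 * K ^ 2 * ∑ i ∈ Finset.range N, c i ^ 2 := by
        rw [Finset.sum_const, Finset.card_range, nsmul_eq_mul]
        push_cast
        ring

/-- The filtration along a residue class: everything that enters the terms before time `N`. -/
def residueFiltration (ℱ : Filtration ℕ mΩ) (L r : ℕ) : Filtration ℕ mΩ where
  seq N := ⨆ n ∈ {n | n < N ∧ n % (L + 1) = r}, (ℱ (n + L + 1) : MeasurableSpace Ω)
  mono' := fun _ _ h => biSup_mono fun _ hn => ⟨hn.1.trans_le h, hn.2⟩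
  le' := fun _ => iSup₂_le fun _ _ => ℱ.le _

lemma FiniteRange.ae_tendsto_of_residue (hZ : FiniteRange μ ℱ L K Z) {r : ℕ} {c : ℕ → ℝ}
    (hc : ∀ n, n % (L + 1) ≠ r → c n = 0) (hs : Summable fun n => c n ^ 2) :
    ∃ Y : Ω → ℝ, MemLp Y 2 μ ∧
      ∀ᵐ ω ∂μ, Tendsto (fun N => ∑ i ∈ Finset.range N, c i * Z i ω) atTop (𝓝 (Y ω)) := by
  set 𝒢 := residueFiltration ℱ L r with h𝒢
  set S : ℕ → Ω → ℝ := fun N ω => ∑ i ∈ Finset.range N, c i * Z i ω with hSdef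
  have hadp : StronglyAdapted 𝒢 S := by
    intro N
    refine Finset.stronglyMeasurable_fun_sum _ fun i hi => ?_
    by_cases hi' : i % (L + 1) = r
    · refine ((hZ.adapted i).mono ?_).const_mul _
      exact le_biSup (fun n => (ℱ (n + L + 1) : MeasurableSpace Ω))
        (show i ∈ {n | n < N ∧ n % (L + 1) = r} from ⟨Finset.mem_range.mp hi, hi'⟩)
    · simp only [hc i hi', zero_mul]
      exact stronglyMeasurable_const
  have hmart : Martingale S 𝒢 μ := by
    refine martingale_of_condExp_sub_eq_zero_nat hadp (fun N => hZ.integrable_sum c N) fun N => ?_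
    have hdiff : S (N + 1) - S N = c N • Z N := by
      ext ω
      simp [hSdef, Finset.sum_range_succ]
    rw [hdiff]
    by_cases hN : N % (L + 1) = r
    · have hle : 𝒢 N ≤ ℱ N := iSup₂_le fun n hn => ℱ.mono (le_of_modEq hn.2 hN hn.1)
      refine (condExp_smul (c N) (Z N) (𝒢 N)).trans ?_
      have h1 : μ[Z N | 𝒢 N] =ᵐ[μ] 0 := by
        refine (condExp_condExp_of_le hle (ℱ.le N)).symm.trans ?_
        refine (condExp_congr_ae (hZ.condExp N)).trans ?_
        rw [condExp_zero]
      filter_upwards [h1] with ω hω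
      simp [hω]
    · rw [hc N hN, zero_smul, condExp_zero]
  have hbdd : ∀ N, eLpNorm (S N) 2 μ ≤
      (Real.toNNReal (Real.sqrt (K ^ 2 * ∑' n, c n ^ 2)) : ENNReal) := by
    intro N
    refine eLpNorm_two_le (hZ.measurable_sum c N).aestronglyMeasurable ?_ ?_
    · refine integrable_of_abs_le (C := ((∑ i ∈ Finset.range N, |c i|) * K) ^ 2)
        ((hZ.measurable_sum _ N).pow 2).aestronglyMeasurable fun ω => ?_
      rw [abs_pow]
      exact pow_le_pow_left₀ (abs_nonneg _) (abs_sum_mul_le hZ.bound N ω) 2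
    · refine (hZ.integral_sq_sum_le_of_residue hc N).trans ?_
      exact mul_le_mul_of_nonneg_left (hs.sum_le_tsum _ fun _ _ => sq_nonneg _) (sq_nonneg _)
  have hbdd1 : ∀ N, eLpNorm (S N) 1 μ ≤
      (Real.toNNReal (Real.sqrt (K ^ 2 * ∑' n, c n ^ 2)) : ENNReal) := fun N =>
    (eLpNorm_le_eLpNorm_of_exponent_le (by norm_num)
      (hZ.measurable_sum c N).aestronglyMeasurable).trans (hbdd N)
  exact ⟨_, hmart.submartingale.memLp_limitProcess hbdd,
    hmart.submartingale.ae_tendsto_limitProcess hbdd1⟩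

/-- Square summable combinations of a centred bounded sequence with finite range of dependence
converge almost surely. -/
lemma FiniteRange.ae_tendsto (hZ : FiniteRange μ ℱ L K Z) {c : ℕ → ℝ}
    (hs : Summable fun n => c n ^ 2) :
    ∃ Y : Ω → ℝ, MemLp Y 2 μ ∧
      ∀ᵐ ω ∂μ, Tendsto (fun N => ∑ i ∈ Finset.range N, c i * Z i ω) atTop (𝓝 (Y ω)) := by
  have h := fun r => hZ.ae_tendsto_of_residue (r := r) (c := residuePart L c r)
    (fun n hn => residuePart_eq_zero hn)
    (hs.of_nonneg_of_le (fun n => sq_nonneg _) fun n => residuePart_sq_le L c r n)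
  choose Y hY hlim using h
  refine ⟨fun ω => ∑ r ∈ Finset.range (L + 1), Y r ω, memLp_finsetSum _ fun r _ => hY r, ?_⟩
  filter_upwards [ae_all_iff.mpr hlim] with ω hω
  simp only [sum_eq_sum_residuePart L c (fun i => Z i ω)]
  exact tendsto_finsetSum _ fun r _ => hω r

end FiniteRange


/-! ### A martingale central limit theorem -/

/-- A product of factors of norm at most one depends on them with Lipschitz constant one. -/
lemma norm_prod_sub_prod_le {ι : Type*} (s : Finset ι) (a b : ι → ℂ) (ha : ∀ i ∈ s, ‖a i‖ ≤ 1)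
    (hb : ∀ i ∈ s, ‖b i‖ ≤ 1) :
    ‖∏ i ∈ s, a i - ∏ i ∈ s, b i‖ ≤ ∑ i ∈ s, ‖a i - b i‖ := by
  classical
  induction s using Finset.induction_on with
  | empty => simp
  | insert j s hj ih =>
    rw [Finset.prod_insert hj, Finset.prod_insert hj, Finset.sum_insert hj]
    have h1 : ‖∏ i ∈ s, b i‖ ≤ 1 := by
      rw [norm_prod]
      exact Finset.prod_le_one (fun _ _ => norm_nonneg _)
        fun i hi => hb i (Finset.mem_insert_of_mem hi)
    have h2 := ih (fun i hi => ha i (Finset.mem_insert_of_mem hi))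
      (fun i hi => hb i (Finset.mem_insert_of_mem hi))
    have h3 : a j * ∏ i ∈ s, a i - b j * ∏ i ∈ s, b i =
        a j * (∏ i ∈ s, a i - ∏ i ∈ s, b i) + (a j - b j) * ∏ i ∈ s, b i := by ring
    rw [h3]
    refine (norm_add_le _ _).trans ?_
    rw [norm_mul, norm_mul]
    have h4 := ha j (Finset.mem_insert_self _ _)
    nlinarith [norm_nonneg (∏ i ∈ s, a i - ∏ i ∈ s, b i), norm_nonneg (a j - b j), norm_nonneg (a j)]

lemma norm_one_add_mul_I_sq (x : ℝ) : ‖1 + (x : ℂ) * Complex.I‖ ^ 2 = 1 + x ^ 2 := by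
  rw [Complex.sq_norm, Complex.normSq_apply]
  simp
  ring

lemma norm_one_add_mul_I_le (x : ℝ) : ‖1 + (x : ℂ) * Complex.I‖ ≤ Real.exp (x ^ 2 / 2) := by
  have h1 := norm_one_add_mul_I_sq x
  have h2 : (1 : ℝ) + x ^ 2 ≤ Real.exp (x ^ 2 / 2) ^ 2 := by
    rw [← Real.exp_nat_mul]
    have := Real.add_one_le_exp (x ^ 2)
    rw [show ((2 : ℕ) : ℝ) * (x ^ 2 / 2) = x ^ 2 by push_cast; ring]
    linarith
  exact le_of_sq_le_sq (by rw [h1]; exact h2) (Real.exp_pos _).le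

/-- The factorization of the characteristic exponential behind McLeish's theorem. -/
lemma norm_exp_sub_le {x : ℝ} (hx : |x| ≤ 1) :
    ‖Complex.exp (x * Complex.I) - (1 + x * Complex.I) * Complex.exp (-(x : ℂ) ^ 2 / 2)‖ ≤
      2 * |x| ^ 3 := by
  have h1 : ‖(x : ℂ) * Complex.I‖ = |x| := by simp
  have h2 := Complex.exp_bound (x := (x : ℂ) * Complex.I) (by rw [h1]; exact hx) (n := 3)
    (by norm_num)
  rw [h1] at h2
  have h3' : ‖(-(x : ℂ) ^ 2 / 2)‖ = |x| ^ 2 / 2 := by simp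
  have h3 := Complex.exp_bound (x := (-(x : ℂ) ^ 2 / 2)) (by
    rw [h3']
    nlinarith [abs_nonneg x]) (n := 2) (by norm_num)
  rw [h3'] at h3
  simp only [Finset.sum_range_succ, Finset.sum_range_zero, Nat.factorial] at h2 h3
  push_cast at h2 h3
  have hI : (Complex.I) ^ 2 = -1 := Complex.I_sq
  set E := Complex.exp (x * Complex.I)
  set G := Complex.exp (-(x : ℂ) ^ 2 / 2)
  have key : E - (1 + x * Complex.I) * G =
      (E - (0 + (x * Complex.I) ^ 0 / 1 + (x * Complex.I) ^ 1 / (1 * 1)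
        + (x * Complex.I) ^ 2 / (2 * (1 * 1))))
      - (1 + x * Complex.I) * (G - (0 + (-(x : ℂ) ^ 2 / 2) ^ 0 / 1
        + (-(x : ℂ) ^ 2 / 2) ^ 1 / (1 * 1)))
      + (x : ℂ) ^ 3 * Complex.I / 2 := by
    rw [mul_pow _ _ 2, hI]
    ring
  rw [key]
  refine (norm_add_le _ _).trans ?_
  have h5 : ‖(x : ℂ) ^ 3 * Complex.I / 2‖ = |x| ^ 3 / 2 := by simp
  rw [h5]
  have h6 := norm_sub_le (E - (0 + (x * Complex.I) ^ 0 / 1 + (x * Complex.I) ^ 1 / (1 * 1)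
        + (x * Complex.I) ^ 2 / (2 * (1 * 1)))) ((1 + x * Complex.I) * (G - (0 + (-(x : ℂ) ^ 2 / 2) ^ 0 / 1
        + (-(x : ℂ) ^ 2 / 2) ^ 1 / (1 * 1))))
  rw [norm_mul] at h6
  have h7 : ‖1 + (x : ℂ) * Complex.I‖ ≤ 2 := by
    refine (norm_add_le _ _).trans ?_
    rw [h1, norm_one]
    linarith
  have h8 : |x| ^ 4 ≤ |x| ^ 3 := by
    have := pow_nonneg (abs_nonneg x) 3
    nlinarith
  have h9 := mul_le_mul h7 h3 (norm_nonneg _) zero_le_two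
  have h10 : |x| ^ 4 = x ^ 4 := Even.pow_abs (by decide) x
  norm_num at h2 h9 h6 ⊢
  rw [show (x ^ 2 / 2) ^ 2 = x ^ 4 / 4 by ring, ← h10] at h9
  linarith [pow_nonneg (abs_nonneg x) 3]

lemma norm_factor_le_one (x : ℝ) :
    ‖(1 + (x : ℂ) * Complex.I) * Complex.exp (-(x : ℂ) ^ 2 / 2)‖ ≤ 1 := by
  rw [norm_mul, Complex.norm_exp]
  have h1 : (-(x : ℂ) ^ 2 / 2).re = -(x ^ 2 / 2) := by
    have : (-(x : ℂ) ^ 2 / 2) = ((-(x ^ 2 / 2) : ℝ) : ℂ) := by push_cast; ring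
    rw [this, Complex.ofReal_re]
  rw [h1, Real.exp_neg]
  exact (mul_le_mul_of_nonneg_right (norm_one_add_mul_I_le x)
    (inv_nonneg.mpr (Real.exp_pos _).le)).trans (by rw [mul_inv_cancel₀ (Real.exp_pos _).ne'])

lemma abs_exp_neg_sub_exp_neg_le {a b : ℝ} (ha : 0 ≤ a) (hb : 0 ≤ b) :
    |Real.exp (-a) - Real.exp (-b)| ≤ |a - b| := by
  wlog h : a ≤ b generalizing a b
  · rw [abs_sub_comm, abs_sub_comm a]
    exact this hb ha (le_of_not_ge h)
  rw [abs_of_nonneg (sub_nonneg.mpr (Real.exp_le_exp.mpr (neg_le_neg h))), abs_sub_comm,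
    abs_of_nonneg (sub_nonneg.mpr h)]
  have h1 := Real.add_one_le_exp (a - b)
  have h2 : Real.exp (-b) = Real.exp (-a) * Real.exp (a - b) := by
    rw [← Real.exp_add]
    congr 1
    ring
  have h3 : Real.exp (-a) ≤ 1 := Real.exp_le_one_iff.mpr (neg_nonpos.mpr ha)
  rw [h2]
  nlinarith [Real.exp_pos (-a)]

section McLeish

variable {Ω : Type*} {mΩ : MeasurableSpace Ω} {μ : Measure Ω} [IsProbabilityMeasure μ]
  {ℱ : Filtration ℕ mΩ} {K : ℝ} {M : ℕ → Ω → ℝ}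

lemma FiniteRange.integral_complex_mul_eq_zero {L : ℕ} (hM : FiniteRange μ ℱ L K M) {i : ℕ}
    {f : Ω → ℂ} (hf : StronglyMeasurable[ℱ i] f) {C : ℝ} (hb : ∀ ω, ‖f ω‖ ≤ C) :
    ∫ ω, f ω * M i ω ∂μ = 0 := by
  have h1 := hM.integral_mul_eq_zero (Complex.continuous_re.comp_stronglyMeasurable hf)
    fun ω => (Complex.abs_re_le_norm _).trans (hb ω)
  have h2 := hM.integral_mul_eq_zero (Complex.continuous_im.comp_stronglyMeasurable hf)
    fun ω => (Complex.abs_im_le_norm _).trans (hb ω)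
  have hI : Integrable (fun ω => f ω * M i ω) μ :=
    Integrable.of_bound ((hf.mono (ℱ.le i)).mul
      (Complex.continuous_ofReal.comp_stronglyMeasurable (hM.measurable i))).aestronglyMeasurable
      (C * K) (ae_of_all _ fun ω => by
        rw [norm_mul, Complex.norm_real]
        exact mul_le_mul (hb ω) (hM.bound i ω) (abs_nonneg _) ((norm_nonneg _).trans (hb ω)))
  apply Complex.ext
  · refine (integral_re hI).symm.trans ?_
    simpa using h1
  · refine (integral_im hI).symm.trans ?_
    simpa using h2

/-- The complex exponential martingale has mean one. -/
lemma FiniteRange.integral_prod_eq_one (hM : FiniteRange μ ℱ 0 K M) (a : ℕ → ℝ) (N : ℕ) :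
    (∀ ω, ‖∏ i ∈ Finset.range N, (1 + ((a i * M i ω : ℝ) : ℂ) * Complex.I)‖ ≤
      ∏ i ∈ Finset.range N, (1 + |a i| * K)) ∧
    (StronglyMeasurable[ℱ N] fun ω =>
      ∏ i ∈ Finset.range N, (1 + ((a i * M i ω : ℝ) : ℂ) * Complex.I)) ∧
    ∫ ω, ∏ i ∈ Finset.range N, (1 + ((a i * M i ω : ℝ) : ℂ) * Complex.I) ∂μ = 1 := by
  have hb : ∀ N ω, ‖∏ i ∈ Finset.range N, (1 + ((a i * M i ω : ℝ) : ℂ) * Complex.I)‖ ≤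
      ∏ i ∈ Finset.range N, (1 + |a i| * K) := by
    intro N ω
    rw [norm_prod]
    refine Finset.prod_le_prod (fun _ _ => norm_nonneg _) fun i _ => ?_
    refine (norm_add_le _ _).trans ?_
    rw [norm_one, norm_mul, Complex.norm_I, mul_one, Complex.norm_real, Real.norm_eq_abs, abs_mul]
    gcongr
    exact hM.bound i ω
  have hm : ∀ N, StronglyMeasurable[ℱ N] fun ω =>
      ∏ i ∈ Finset.range N, (1 + ((a i * M i ω : ℝ) : ℂ) * Complex.I) := by
    intro N
    refine Finset.stronglyMeasurable_fun_prod _ fun i hi => ?_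
    have : StronglyMeasurable[ℱ N] (M i) :=
      (hM.adapted i).mono (ℱ.mono (Finset.mem_range.mp hi))
    exact stronglyMeasurable_const.add
      ((Complex.continuous_ofReal.comp_stronglyMeasurable (this.const_mul (a i))).mul_const _)
  refine ⟨hb N, hm N, ?_⟩
  induction N with
  | zero => simp
  | succ N ih =>
    have h0 := hM.integral_complex_mul_eq_zero (hm N) (hb N)
    have hI1 : Integrable (fun ω =>
        ∏ i ∈ Finset.range N, (1 + ((a i * M i ω : ℝ) : ℂ) * Complex.I)) μ :=
      Integrable.of_bound ((hm N).mono (ℱ.le _)).aestronglyMeasurable _ (ae_of_all _ (hb N))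
    have hI2 : Integrable (fun ω =>
        (∏ i ∈ Finset.range N, (1 + ((a i * M i ω : ℝ) : ℂ) * Complex.I)) * M N ω) μ :=
      Integrable.of_bound (((hm N).mono (ℱ.le _)).mul
        (Complex.continuous_ofReal.comp_stronglyMeasurable (hM.measurable N))).aestronglyMeasurable
        ((∏ i ∈ Finset.range N, (1 + |a i| * K)) * K) (ae_of_all _ fun ω => by
          rw [norm_mul, Complex.norm_real]
          exact mul_le_mul (hb N ω) (hM.bound N ω) (abs_nonneg _)
            ((norm_nonneg _).trans (hb N ω)))
    have hexp : ∀ ω, ∏ i ∈ Finset.range (N + 1), (1 + ((a i * M i ω : ℝ) : ℂ) * Complex.I) =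
        (∏ i ∈ Finset.range N, (1 + ((a i * M i ω : ℝ) : ℂ) * Complex.I)) + (a N * Complex.I) *
        ((∏ i ∈ Finset.range N, (1 + ((a i * M i ω : ℝ) : ℂ) * Complex.I)) * M N ω) := by
      intro ω
      rw [Finset.prod_range_succ]
      push_cast
      ring
    simp only [hexp]
    rw [integral_add hI1 (hI2.const_mul _), integral_const_mul, h0, ih]
    simp

lemma prod_factor_eq {ι : Type*} (s : Finset ι) (x : ι → ℝ) :
    ∏ i ∈ s, ((1 + (x i : ℂ) * Complex.I) * Complex.exp (-(x i : ℂ) ^ 2 / 2)) =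
      (∏ i ∈ s, (1 + (x i : ℂ) * Complex.I)) * ((Real.exp (-((∑ i ∈ s, x i ^ 2) / 2)) : ℝ) : ℂ) := by
  rw [Finset.prod_mul_distrib, ← Complex.exp_sum]
  congr 1
  push_cast
  rw [Finset.sum_div, ← Finset.sum_neg_distrib]
  congr 1
  refine Finset.sum_congr rfl fun i _ => ?_
  ring

/-- A quantitative form of McLeish's central limit theorem for bounded martingale differences:
the characteristic function of `∑ aᵢ Mᵢ` is close to that of a centred Gaussian if the increments
are small and the quadratic variation is nearly deterministic. -/
lemma FiniteRange.norm_integral_exp_sub_le (hM : FiniteRange μ ℱ 0 K M) (a : ℕ → ℝ) (N : ℕ)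
    {A ρ s : ℝ} (hs : 0 ≤ s) (hA : ∑ i ∈ Finset.range N, a i ^ 2 ≤ A)
    (hρ : ∀ i < N, |a i| * K ≤ ρ) (hρ0 : 0 ≤ ρ) (hρ1 : ρ ≤ 1) :
    ‖(∫ ω, Complex.exp (((∑ i ∈ Finset.range N, a i * M i ω : ℝ) : ℂ) * Complex.I) ∂μ)
        - (Real.exp (-(s / 2)) : ℝ)‖ ≤
      2 * ρ * K ^ 2 * A + Real.exp (K ^ 2 * A / 2) / 2 *
        ∫ ω, |∑ i ∈ Finset.range N, (a i * M i ω) ^ 2 - s| ∂μ := by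
  obtain ⟨-, hTm, hT1⟩ := hM.integral_prod_eq_one a N
  have hxK : ∀ i ω, |a i * M i ω| ≤ |a i| * K := fun i ω => by
    rw [abs_mul]
    exact mul_le_mul_of_nonneg_left (hM.bound i ω) (abs_nonneg _)
  have hQ : ∀ ω, ∑ i ∈ Finset.range N, (a i * M i ω) ^ 2 ≤ K ^ 2 * A := by
    intro ω
    refine le_trans ?_ (mul_le_mul_of_nonneg_left hA (sq_nonneg K))
    rw [Finset.mul_sum]
    refine Finset.sum_le_sum fun i _ => ?_
    have := pow_le_pow_left₀ (abs_nonneg _) (hxK i ω) 2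
    rw [mul_pow, sq_abs, sq_abs] at this
    linarith
  have hQ0 : ∀ ω, 0 ≤ ∑ i ∈ Finset.range N, (a i * M i ω) ^ 2 := fun ω =>
    Finset.sum_nonneg fun _ _ => sq_nonneg _
  have hTb : ∀ ω, ‖∏ i ∈ Finset.range N, (1 + ((a i * M i ω : ℝ) : ℂ) * Complex.I)‖ ≤
      Real.exp (K ^ 2 * A / 2) := by
    intro ω
    rw [norm_prod]
    refine (Finset.prod_le_prod (fun _ _ => norm_nonneg _)
      fun i _ => norm_one_add_mul_I_le (a i * M i ω)).trans ?_
    rw [← Real.exp_sum, ← Finset.sum_div]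
    exact Real.exp_le_exp.mpr (by linarith [hQ ω])
  set T : Ω → ℂ := fun ω => ∏ i ∈ Finset.range N, (1 + ((a i * M i ω : ℝ) : ℂ) * Complex.I)
  set E : Ω → ℂ := fun ω =>
    Complex.exp (((∑ i ∈ Finset.range N, a i * M i ω : ℝ) : ℂ) * Complex.I)
  have hSm : StronglyMeasurable fun ω => ∑ i ∈ Finset.range N, a i * M i ω :=
    hM.measurable_sum a N
  have hQm : StronglyMeasurable fun ω => ∑ i ∈ Finset.range N, (a i * M i ω) ^ 2 :=
    Finset.stronglyMeasurable_fun_sum _ fun i _ => ((hM.measurable i).const_mul _).pow 2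
  have hEI : Integrable E μ := by
    refine Integrable.of_bound ?_ 1 (ae_of_all _ fun ω => ?_)
    · exact (Complex.continuous_exp.comp_stronglyMeasurable
        ((Complex.continuous_ofReal.comp_stronglyMeasurable hSm).mul_const _)).aestronglyMeasurable
    · exact (Complex.norm_exp_ofReal_mul_I _).le
  have hTI : Integrable T μ := Integrable.of_bound (hTm.mono (ℱ.le _)).aestronglyMeasurable _
    (ae_of_all _ hTb)
  have hQI : Integrable (fun ω => |∑ i ∈ Finset.range N, (a i * M i ω) ^ 2 - s|) μ := by
    refine (Integrable.of_bound (C := K ^ 2 * A + s)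
      (hQm.sub stronglyMeasurable_const).aestronglyMeasurable (ae_of_all _ fun ω => ?_)).abs
    rw [Real.norm_eq_abs, abs_le]
    constructor <;> simp only [Pi.sub_apply] <;> linarith [hQ ω, hQ0 ω]
  have hpt : ∀ ω, ‖E ω - T ω * (Real.exp (-(s / 2)) : ℝ)‖ ≤
      2 * ρ * K ^ 2 * A + Real.exp (K ^ 2 * A / 2) / 2 *
        |∑ i ∈ Finset.range N, (a i * M i ω) ^ 2 - s| := by
    intro ω
    have h1 : ‖E ω - T ω * ((Real.exp (-((∑ i ∈ Finset.range N, (a i * M i ω) ^ 2) / 2)) : ℝ) : ℂ)‖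
        ≤ 2 * ρ * K ^ 2 * A := by
      rw [← prod_factor_eq]
      have hE : E ω = ∏ i ∈ Finset.range N, Complex.exp (((a i * M i ω : ℝ) : ℂ) * Complex.I) := by
        rw [← Complex.exp_sum, ← Finset.sum_mul]
        simp only [E, Complex.ofReal_sum]
      rw [hE]
      refine (norm_prod_sub_prod_le _ _ _ (fun i _ => (Complex.norm_exp_ofReal_mul_I _).le)
        (fun i _ => norm_factor_le_one _)).trans ?_
      calc ∑ i ∈ Finset.range N, _ ≤ ∑ i ∈ Finset.range N, 2 * ρ * K ^ 2 * a i ^ 2 := by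
            refine Finset.sum_le_sum fun i hi => ?_
            have hle : |a i * M i ω| ≤ ρ := (hxK i ω).trans (hρ i (Finset.mem_range.mp hi))
            refine (norm_exp_sub_le (hle.trans hρ1)).trans ?_
            have h2 := pow_le_pow_left₀ (abs_nonneg _) (hxK i ω) 2
            rw [mul_pow, sq_abs (a i)] at h2
            have h3 := mul_le_mul hle h2 (by positivity) ((abs_nonneg _).trans hle)
            calc 2 * |a i * M i ω| ^ 3 = 2 * (|a i * M i ω| * |a i * M i ω| ^ 2) := by ring
              _ ≤ 2 * (ρ * (a i ^ 2 * K ^ 2)) := by linarith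
              _ = 2 * ρ * K ^ 2 * a i ^ 2 := by ring
        _ = 2 * ρ * K ^ 2 * ∑ i ∈ Finset.range N, a i ^ 2 := by rw [Finset.mul_sum]
        _ ≤ 2 * ρ * K ^ 2 * A := by
            gcongr
    have h2 : ‖T ω * ((Real.exp (-((∑ i ∈ Finset.range N, (a i * M i ω) ^ 2) / 2)) : ℝ) : ℂ)
        - T ω * (Real.exp (-(s / 2)) : ℝ)‖ ≤ Real.exp (K ^ 2 * A / 2) / 2 *
        |∑ i ∈ Finset.range N, (a i * M i ω) ^ 2 - s| := by
      rw [← mul_sub, norm_mul, ← Complex.ofReal_sub, Complex.norm_real, Real.norm_eq_abs]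
      have h3 := abs_exp_neg_sub_exp_neg_le
        (div_nonneg (hQ0 ω) zero_le_two) (div_nonneg hs zero_le_two)
      rw [← sub_div, abs_div, abs_two] at h3
      calc _ ≤ Real.exp (K ^ 2 * A / 2) *
            (|∑ i ∈ Finset.range N, (a i * M i ω) ^ 2 - s| / 2) :=
              mul_le_mul (hTb ω) h3 (abs_nonneg _) (Real.exp_pos _).le
        _ = _ := by ring
    calc ‖E ω - T ω * (Real.exp (-(s / 2)) : ℝ)‖ = ‖(E ω - T ω *
          ((Real.exp (-((∑ i ∈ Finset.range N, (a i * M i ω) ^ 2) / 2)) : ℝ) : ℂ)) +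
          (T ω * ((Real.exp (-((∑ i ∈ Finset.range N, (a i * M i ω) ^ 2) / 2)) : ℝ) : ℂ)
          - T ω * (Real.exp (-(s / 2)) : ℝ))‖ := by
          congr 1
          ring
      _ ≤ _ := (norm_add_le _ _).trans (add_le_add h1 h2)
  have hTs : ∫ ω, T ω * (Real.exp (-(s / 2)) : ℝ) ∂μ = (Real.exp (-(s / 2)) : ℝ) := by
    rw [integral_mul_const, hT1, one_mul]
  rw [← hTs, ← integral_sub hEI (hTI.mul_const _)]
  refine (norm_integral_le_of_norm_le ?_ (ae_of_all _ hpt)).trans ?_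
  · exact (integrable_const _).add (hQI.const_mul _)
  · rw [integral_add (integrable_const _) (hQI.const_mul _), integral_const_mul _ (fun ω => |_|)]
    simp

end McLeish


section Limit

variable {Ω : Type*} {mΩ : MeasurableSpace Ω} {μ : Measure Ω} [IsProbabilityMeasure μ]
  {ℱ ℱ' : Filtration ℕ mΩ} {L : ℕ} {K K' : ℝ} {M : ℕ → Ω → ℝ}

lemma integral_abs_le_sqrt {f : Ω → ℝ} (hf : MemLp f 2 μ) :
    ∫ ω, |f ω| ∂μ ≤ Real.sqrt (∫ ω, f ω ^ 2 ∂μ) := by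
  have h := variance_nonneg |f| μ
  rw [variance_eq_sub hf.abs] at h
  have h2 : ∫ ω, (|f| ^ 2) ω ∂μ = ∫ ω, f ω ^ 2 ∂μ := by
    simp
  rw [h2] at h
  exact Real.le_sqrt_of_sq_le (sub_nonneg.mp h)

lemma memLp_two_of_abs_le {f : Ω → ℝ} (hf : AEStronglyMeasurable f μ) {C : ℝ}
    (hb : ∀ ω, |f ω| ≤ C) : MemLp f 2 μ :=
  MemLp.of_bound hf C (ae_of_all _ hb)

lemma FiniteRange.integral_abs_sum_le (hM : FiniteRange μ ℱ L K M) (c : ℕ → ℝ) (N : ℕ) :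
    ∫ ω, |∑ i ∈ Finset.range N, c i * M i ω| ∂μ ≤
      Real.sqrt ((L + 1) ^ 2 * K ^ 2 * ∑ i ∈ Finset.range N, c i ^ 2) :=
  (integral_abs_le_sqrt (memLp_two_of_abs_le (hM.measurable_sum c N).aestronglyMeasurable
    (abs_sum_mul_le hM.bound N))).trans (Real.sqrt_le_sqrt (hM.integral_sq_sum_le c N))

/-- Weighted sums of bounded martingale differences, normalised by the square root `g` of the sum of
the squared weights, are asymptotically Gaussian as soon as the squares have constant mean `v` and
finite range of dependence. -/
theorem FiniteRange.tendstoInDistribution (hM : FiniteRange μ ℱ 0 K M) {w g : ℕ → ℝ}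
    (hw0 : ∀ i, 0 ≤ w i) (hw1 : ∀ i, w i ≤ 1) (hg : Tendsto g atTop atTop)
    (hW : Tendsto (fun N => (∑ i ∈ Finset.range N, w i ^ 2) / g N ^ 2) atTop (𝓝 1))
    {v : ℝ} (hv : 0 ≤ v) (hQ : FiniteRange μ ℱ' L K' fun i ω => M i ω ^ 2 - v) :
    TendstoInDistribution (fun N ω => (∑ i ∈ Finset.range N, w i * M i ω) / g N) atTop
      (id : ℝ → ℝ) (fun _ => μ) (gaussianReal 0 v.toNNReal) := by
  have hK0 : 0 ≤ K := by
    obtain ⟨ω⟩ := nonempty_of_isProbabilityMeasure μ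
    exact (abs_nonneg _).trans (hM.bound 0 ω)
  have hmeas : ∀ N, Measurable fun ω => (∑ i ∈ Finset.range N, w i * M i ω) / g N := fun N =>
    (hM.measurable_sum w N).measurable.div_const _
  refine ⟨fun N => (hmeas N).aemeasurable, aemeasurable_id, ?_⟩
  refine ProbabilityMeasure.tendsto_iff_tendsto_charFun.2 fun t => ?_
  change Tendsto (fun N => charFun (μ.map fun ω => (∑ i ∈ Finset.range N, w i * M i ω) / g N) t)
    atTop (𝓝 (charFun ((gaussianReal 0 v.toNNReal).map id) t))
  rw [Measure.map_id, charFun_gaussianReal, tendsto_iff_norm_sub_tendsto_zero]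
  set W : ℕ → ℝ := fun N => (∑ i ∈ Finset.range N, w i ^ 2) / g N ^ 2 with hWdef
  have hginv : Tendsto (fun N => (g N)⁻¹) atTop (𝓝 0) := hg.inv_tendsto_atTop
  set ρ : ℕ → ℝ := fun N => |t| * (g N)⁻¹ * K with hρdef
  have hρ : Tendsto ρ atTop (𝓝 0) := by
    have := (hginv.const_mul |t|).mul_const K
    simpa using this
  set R : ℕ → ℝ := fun N => t ^ 2 * (Real.sqrt ((L + 1) ^ 2 * K' ^ 2 * (W N * (g N)⁻¹ ^ 2))
      + v * |W N - 1|) with hRdef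
  have hR : Tendsto R atTop (𝓝 0) := by
    have h1 : Tendsto (fun N => (L + 1 : ℝ) ^ 2 * K' ^ 2 * (W N * (g N)⁻¹ ^ 2)) atTop (𝓝 0) := by
      have := (hW.mul (hginv.pow 2)).const_mul ((L + 1 : ℝ) ^ 2 * K' ^ 2)
      simpa using this
    have h2 : Tendsto (fun N => |W N - 1|) atTop (𝓝 0) := by
      have := (hW.sub_const 1).abs
      simpa using this
    have := ((h1.sqrt).add (h2.const_mul v)).const_mul (t ^ 2)
    rwa [Real.sqrt_zero, mul_zero, add_zero, mul_zero] at this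
  have hbound : Tendsto (fun N => 2 * ρ N * K ^ 2 * (t ^ 2 * W N)
      + Real.exp (K ^ 2 * (t ^ 2 * W N) / 2) / 2 * R N) atTop (𝓝 0) := by
    have h1 := ((hρ.const_mul 2).mul_const (K ^ 2)).mul (hW.const_mul (t ^ 2))
    have h2 := ((Real.continuous_exp.tendsto _).comp
      (((hW.const_mul (t ^ 2)).const_mul (K ^ 2)).div_const 2)).div_const 2
    have := h1.add (h2.mul hR)
    simpa using this
  refine tendsto_of_tendsto_of_tendsto_of_le_of_le' tendsto_const_nhds hbound
    (Eventually.of_forall fun _ => norm_nonneg _) ?_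
  filter_upwards [hg.eventually_gt_atTop 0, hρ.eventually_le_const zero_lt_one] with N hgN hρN
  have hgi : 0 < (g N)⁻¹ := inv_pos.mpr hgN
  have hsum2 : ∑ i ∈ Finset.range N, (t * (g N)⁻¹ * w i) ^ 2 = t ^ 2 * W N := by
    simp only [hWdef, mul_pow, ← Finset.mul_sum]
    rw [inv_pow]
    ring
  have hmain := hM.norm_integral_exp_sub_le (fun i => t * (g N)⁻¹ * w i) N (A := t ^ 2 * W N)
    (ρ := ρ N) (s := t ^ 2 * v) (by positivity) hsum2.le (fun i _ => by
      rw [abs_mul, abs_mul, abs_of_pos hgi, abs_of_nonneg (hw0 i)]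
      refine mul_le_mul_of_nonneg_right ?_ hK0
      exact mul_le_of_le_one_right (by positivity) (hw1 i)) (by positivity) hρN
  have hchar : charFun (μ.map fun ω => (∑ i ∈ Finset.range N, w i * M i ω) / g N) t =
      ∫ ω, Complex.exp (((∑ i ∈ Finset.range N, (t * (g N)⁻¹ * w i) * M i ω : ℝ) : ℂ)
        * Complex.I) ∂μ := by
    rw [charFun_apply_real, integral_map (hmeas N).aemeasurable (by fun_prop)]
    refine integral_congr_ae (ae_of_all _ fun ω => ?_)
    dsimp only
    congr 2
    rw [← Complex.ofReal_mul]
    congr 1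
    simp only [mul_assoc]
    rw [← Finset.mul_sum, ← Finset.mul_sum]
    ring
  have hgauss : Complex.exp (↑t * ((0 : ℝ) : ℂ) * Complex.I - ((v.toNNReal : ℝ) : ℂ) * (t : ℂ) ^ 2 / 2)
      = ((Real.exp (-(t ^ 2 * v / 2)) : ℝ) : ℂ) := by
    rw [Real.coe_toNNReal v hv]
    push_cast
    congr 1
    ring
  rw [hchar, hgauss]
  refine hmain.trans (add_le_add le_rfl (mul_le_mul_of_nonneg_left ?_ (by positivity)))
  set c : ℕ → ℝ := fun i => (g N)⁻¹ ^ 2 * w i ^ 2 with hc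
  have hpt : ∀ ω, |∑ i ∈ Finset.range N, (t * (g N)⁻¹ * w i * M i ω) ^ 2 - t ^ 2 * v| ≤
      t ^ 2 * (|∑ i ∈ Finset.range N, c i * (M i ω ^ 2 - v)| + v * |W N - 1|) := by
    intro ω
    have h1 : ∑ i ∈ Finset.range N, (t * (g N)⁻¹ * w i * M i ω) ^ 2 - t ^ 2 * v =
        t ^ 2 * (∑ i ∈ Finset.range N, c i * (M i ω ^ 2 - v) + v * (W N - 1)) := by
      have h2 : W N = ∑ i ∈ Finset.range N, c i := by
        simp only [hWdef, hc, ← Finset.mul_sum]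
        rw [inv_pow]
        ring
      rw [h2, mul_sub v, Finset.mul_sum, mul_one, add_sub, ← Finset.sum_add_distrib, mul_sub,
        Finset.mul_sum]
      congr 1
      refine Finset.sum_congr rfl fun i _ => ?_
      simp only [hc]
      ring
    rw [h1, abs_mul, abs_of_nonneg (sq_nonneg t)]
    refine mul_le_mul_of_nonneg_left ((abs_add_le _ _).trans ?_) (sq_nonneg t)
    rw [abs_mul, abs_of_nonneg hv]
  have hI := (hQ.integrable_sum c N).abs
  have hI2 : Integrable (fun ω => t ^ 2 * (|∑ i ∈ Finset.range N, c i * (M i ω ^ 2 - v)|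
      + v * |W N - 1|)) μ := (hI.add (integrable_const _)).const_mul _
  refine (integral_mono_of_nonneg (ae_of_all _ fun ω => abs_nonneg _) hI2
    (ae_of_all _ hpt)).trans ?_
  rw [integral_const_mul, integral_add hI (integrable_const _)]
  refine mul_le_mul_of_nonneg_left (add_le_add ?_ (by simp)) (sq_nonneg t)
  refine (hQ.integral_abs_sum_le c N).trans (Real.sqrt_le_sqrt ?_)
  refine mul_le_mul_of_nonneg_left ?_ (by positivity)
  calc ∑ i ∈ Finset.range N, c i ^ 2 ≤ ∑ i ∈ Finset.range N, (g N)⁻¹ ^ 4 * w i ^ 2 := by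
        refine Finset.sum_le_sum fun i _ => ?_
        simp only [hc]
        have h3 : w i ^ 4 ≤ w i ^ 2 := pow_le_pow_of_le_one (hw0 i) (hw1 i) (by norm_num)
        calc ((g N)⁻¹ ^ 2 * w i ^ 2) ^ 2 = (g N)⁻¹ ^ 4 * w i ^ 4 := by ring
          _ ≤ _ := mul_le_mul_of_nonneg_left h3 (by positivity)
    _ = W N * (g N)⁻¹ ^ 2 := by
        rw [← Finset.mul_sum]
        simp only [hWdef]
        rw [inv_pow, inv_pow]
        field_simp

/-- Convergence in distribution is not affected by a perturbation that is negligible in mean. -/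
lemma tendstoInDistribution_of_integral_abs_sub {ν : Measure ℝ} [IsProbabilityMeasure ν]
    {U V : ℕ → Ω → ℝ} (hU : TendstoInDistribution U atTop (id : ℝ → ℝ) (fun _ => μ) ν)
    (hVm : ∀ N, AEMeasurable (V N) μ) (hint : ∀ N, Integrable (fun ω => V N ω - U N ω) μ)
    (h : Tendsto (fun N => ∫ ω, |V N ω - U N ω| ∂μ) atTop (𝓝 0)) :
    TendstoInDistribution V atTop (id : ℝ → ℝ) (fun _ => μ) ν := by
  refine tendstoInDistribution_of_tendstoInMeasure_sub V id hU ?_ hVm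
  refine tendstoInMeasure_of_tendsto_eLpNorm one_ne_zero
    (fun N => (hint N).aestronglyMeasurable) aestronglyMeasurable_zero ?_
  have h1 : ∀ N, eLpNorm ((V - U) N - 0) 1 μ = ENNReal.ofReal (∫ ω, |V N ω - U N ω| ∂μ) := by
    intro N
    rw [sub_zero, eLpNorm_one_eq_lintegral_enorm, ofReal_integral_eq_lintegral_ofReal (hint N).abs
      (ae_of_all _ fun ω => abs_nonneg _)]
    refine lintegral_congr fun ω => ?_
    rw [← Real.norm_eq_abs, ofReal_norm]
    rfl
  simp only [h1]
  have := ENNReal.tendsto_ofReal h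
  simpa using this

end Limit

/-! ### The normalisation -/

/-- The weight `(i + 1) ^ (-γ)`. -/
noncomputable def weight (γ : ℝ) (i : ℕ) : ℝ := ((i : ℝ) + 1) ^ (-γ)

lemma weight_nonneg (γ : ℝ) (i : ℕ) : 0 ≤ weight γ i := Real.rpow_nonneg (by positivity) _

lemma weight_le_one {γ : ℝ} (hγ : 0 ≤ γ) (i : ℕ) : weight γ i ≤ 1 :=
  Real.rpow_le_one_of_one_le_of_nonpos (by linarith [Nat.cast_nonneg (α := ℝ) i]) (by linarith)

lemma weight_antitone {γ : ℝ} (hγ : 0 ≤ γ) : Antitone (weight γ) := fun i j hij =>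
  Real.rpow_le_rpow_of_nonpos (by positivity) (by gcongr) (by linarith)

lemma weight_sq (γ : ℝ) (i : ℕ) : weight γ i ^ 2 = weight (2 * γ) i := by
  rw [weight, weight, ← Real.rpow_natCast, ← Real.rpow_mul (by positivity)]
  congr 1
  push_cast
  ring

lemma weight_pow (γ : ℝ) (j i : ℕ) : weight γ i ^ j = weight (j * γ) i := by
  rw [weight, weight, ← Real.rpow_natCast, ← Real.rpow_mul (by positivity)]
  congr 1
  ring

lemma summable_weight {t : ℝ} (ht : 1 < t) : Summable (weight t) := by
  have := (summable_nat_add_iff (f := fun n : ℕ => (n : ℝ) ^ (-t)) 1).mpr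
    (Real.summable_nat_rpow.mpr (by linarith))
  refine this.congr fun n => ?_
  rw [weight]
  push_cast
  rfl

lemma growth_sq {t : ℝ} (ht1 : t ≤ 1) {N : ℕ} (hN : 1 ≤ N) : growth t N ^ 2 =
    if t = 1 then Real.log N else (N : ℝ) ^ (1 - t) / (1 - t) := by
  rw [growth, Real.sq_sqrt]
  split_ifs with h
  · exact Real.log_nonneg (by exact_mod_cast hN)
  · exact div_nonneg (by positivity) (by linarith)

lemma tendsto_growth {t : ℝ} (ht1 : t ≤ 1) : Tendsto (growth t) atTop atTop := by
  refine Real.tendsto_sqrt_atTop.comp ?_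
  split_ifs with h
  · exact Real.tendsto_log_atTop.comp tendsto_natCast_atTop_atTop
  · have h' : 0 < 1 - t := by
      rcases ht1.lt_or_eq with h1 | h1
      · linarith
      · exact absurd h1 h
    exact ((tendsto_rpow_atTop h').comp tendsto_natCast_atTop_atTop).atTop_div_const h'

lemma abs_sum_weight_sub_growth_le {t : ℝ} (ht0 : 0 ≤ t) (ht1 : t ≤ 1) : ∃ C : ℝ, ∀ N : ℕ, 1 ≤ N →
    |∑ i ∈ Finset.range N, weight t i - growth t N ^ 2| ≤ C := by
  obtain ⟨C, hC⟩ : ∃ C : ℝ, ∀ N : ℕ, 1 ≤ N →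
      |(∫ x in (1 : ℝ)..N, x ^ (-t)) - growth t N ^ 2| ≤ C := by
    rcases ht1.lt_or_eq with h | h
    · refine ⟨1 / (1 - t), fun N hN => ?_⟩
      rw [growth_sq ht1 hN, if_neg h.ne, integral_rpow (Or.inl (by linarith)),
        show -t + 1 = 1 - t by ring, Real.one_rpow, ← sub_div, sub_sub_cancel_left, abs_div,
        abs_neg, abs_one, abs_of_pos (by linarith)]
    · refine ⟨0, fun N hN => ?_⟩
      have hN' : (0 : ℝ) < N := by exact_mod_cast hN
      have h0 : (0 : ℝ) ∉ Set.uIcc (1 : ℝ) N := by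
        rw [Set.uIcc_of_le (by exact_mod_cast hN)]
        simp
      rw [growth_sq ht1 hN, if_pos h, h]
      simp only [Real.rpow_neg_one]
      rw [integral_inv h0, div_one, sub_self, abs_zero]
  refine ⟨1 + C, fun N hN => ?_⟩
  obtain ⟨n, rfl⟩ : ∃ n, N = n + 1 := ⟨N - 1, by omega⟩
  have hanti : AntitoneOn (fun x : ℝ => x ^ (-t)) (Set.Icc (1 : ℝ) (1 + (n : ℕ))) := by
    intro x hx y _ hxy
    exact Real.rpow_le_rpow_of_nonpos (by linarith [hx.1]) hxy (by linarith)
  have h1 := hanti.integral_le_sum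
  have h2 := hanti.sum_le_integral
  have e1 : ∑ i ∈ Finset.range n, (1 + (i : ℝ)) ^ (-t) = ∑ i ∈ Finset.range n, weight t i :=
    Finset.sum_congr rfl fun i _ => by rw [weight, add_comm]
  have e2 : ∑ i ∈ Finset.range n, (1 + ((i + 1 : ℕ) : ℝ)) ^ (-t) =
      ∑ i ∈ Finset.range n, weight t (i + 1) :=
    Finset.sum_congr rfl fun i _ => by rw [weight, add_comm]
  rw [e1] at h1
  rw [e2] at h2
  have e3 := Finset.sum_range_succ' (weight t) n
  have e4 := Finset.sum_range_succ (weight t) n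
  have e5 := weight_le_one ht0 0
  have e6 := weight_nonneg t n
  have h3 := hC (n + 1) hN
  rw [show (((n + 1 : ℕ) : ℝ)) = 1 + (n : ℝ) by push_cast; ring] at h3
  rw [abs_le] at h3 ⊢
  have e7 := weight_le_one ht0 n
  constructor <;> linarith

lemma tendsto_sum_weight_div {t : ℝ} (ht0 : 0 ≤ t) (ht1 : t ≤ 1) :
    Tendsto (fun N => (∑ i ∈ Finset.range N, weight t i) / growth t N ^ 2) atTop (𝓝 1) := by
  obtain ⟨C, hC⟩ := abs_sum_weight_sub_growth_le ht0 ht1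
  have hg := tendsto_growth ht1
  have hg2 : Tendsto (fun N => growth t N ^ 2) atTop atTop :=
    (tendsto_pow_atTop two_ne_zero).comp hg
  have h0 : Tendsto (fun N => C * (growth t N ^ 2)⁻¹) atTop (𝓝 0) := by
    simpa using hg2.inv_tendsto_atTop.const_mul C
  rw [tendsto_iff_norm_sub_tendsto_zero]
  refine tendsto_of_tendsto_of_tendsto_of_le_of_le' tendsto_const_nhds h0
    (Eventually.of_forall fun _ => norm_nonneg _) ?_
  filter_upwards [hg2.eventually_gt_atTop 0, eventually_ge_atTop 1] with N hN hN1
  rw [Real.norm_eq_abs, div_sub_one hN.ne', abs_div, abs_of_pos hN, div_eq_mul_inv]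
  exact mul_le_mul_of_nonneg_right (hC N hN1) (inv_nonneg.mpr hN.le)

lemma tendsto_sum_weight_atTop {t : ℝ} (ht0 : 0 ≤ t) (ht1 : t ≤ 1) :
    Tendsto (fun N => ∑ i ∈ Finset.range N, weight t i) atTop atTop := by
  have hg2 : Tendsto (fun N => growth t N ^ 2) atTop atTop :=
    (tendsto_pow_atTop two_ne_zero).comp (tendsto_growth ht1)
  refine (((tendsto_sum_weight_div ht0 ht1).pos_mul_atTop zero_lt_one hg2)).congr' ?_
  filter_upwards [hg2.eventually_gt_atTop 0] with N hN
  rw [div_mul_cancel₀ _ hN.ne']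

lemma tendsto_sum_weight_div_zero {t u : ℝ} (ht0 : 0 ≤ t) (ht1 : t ≤ 1) (htu : t < u) :
    Tendsto (fun N => (∑ i ∈ Finset.range N, weight u i) / growth t N ^ 2) atTop (𝓝 0) := by
  have h1 : (weight u) =o[atTop] (weight t) := by
    refine (Asymptotics.isLittleO_iff_tendsto fun i hi => ?_).mpr ?_
    · exact absurd hi (Real.rpow_pos_of_pos (by positivity) _).ne'
    · have : ∀ i : ℕ, weight u i / weight t i = ((i : ℝ) + 1) ^ (-(u - t)) := fun i => by
        rw [weight, weight, ← Real.rpow_sub (by positivity)]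
        congr 1
        ring
      simp only [this]
      exact (tendsto_rpow_neg_atTop (sub_pos.mpr htu)).comp
        (tendsto_atTop_add_const_right _ _ tendsto_natCast_atTop_atTop)
  have h2 := (h1.sum_range (fun i => weight_nonneg t i)
    (tendsto_sum_weight_atTop ht0 ht1)).tendsto_div_nhds_zero
  have h3 := h2.mul (tendsto_sum_weight_div ht0 ht1)
  rw [zero_mul] at h3
  refine h3.congr' ?_
  filter_upwards [(tendsto_sum_weight_atTop ht0 ht1).eventually_gt_atTop 0] with N hN
  rw [div_mul_div_cancel₀ hN.ne']


/-! ### Functions of windows of an i.i.d. sequence -/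

section Window

variable {Ω : Type*} {mΩ : MeasurableSpace Ω} {μ : Measure Ω}
  {X : ℕ → Ω → ℝ} {B : ℝ}

/-- A uniformly bounded sequence of i.i.d. random variables with mean zero. -/
structure BoundedIID (μ : Measure Ω) (X : ℕ → Ω → ℝ) (B : ℝ) : Prop where
  meas : ∀ n, Measurable (X n)
  indep : iIndepFun X μ
  ident : ∀ n, IdentDistrib (X n) (X 0) μ μ
  mean : ∫ ω, X 0 ω ∂μ = 0
  bound : ∀ n ω, |X n ω| ≤ B

/-- The `σ`-algebras generated by the variables before time `n`. -/
def past (X : ℕ → Ω → ℝ) (hX : ∀ n, Measurable (X n)) : Filtration ℕ mΩ where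
  seq n := ⨆ i ∈ Set.Iio n, MeasurableSpace.comap (X i) inferInstance
  mono' := fun _ _ h => biSup_mono fun _ hi => lt_of_lt_of_le hi h
  le' := fun _ => iSup₂_le fun i _ => (hX i).comap_le

lemma measurable_past (hX : ∀ n, Measurable (X n)) {i n : ℕ} (h : i < n) :
    Measurable[past X hX n] (X i) :=
  (comap_measurable (X i)).mono
    (le_biSup (fun i => MeasurableSpace.comap (X i) inferInstance) (Set.mem_Iio.mpr h)) le_rfl

/-- The sequence as seen from site `i`. -/
def shift (X : ℕ → Ω → ℝ) (i : ℕ) (ω : Ω) : ℕ → ℝ := fun s => X (i + s) ω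

/-- A measurable function of a sequence that only looks at the entries `0, …, L`. -/
structure IsWindow (L : ℕ) (F : (ℕ → ℝ) → ℝ) : Prop where
  meas : Measurable F
  dep : ∀ x y : ℕ → ℝ, (∀ s ≤ L, x s = y s) → F x = F y

lemma measurable_shift (hX : ∀ n, Measurable (X n)) (i : ℕ) : Measurable (shift X i) :=
  measurable_pi_lambda _ fun s => hX (i + s)

lemma IsWindow.measurable_past {L : ℕ} {F : (ℕ → ℝ) → ℝ} (hF : IsWindow L F)
    (hX : ∀ n, Measurable (X n)) {i n : ℕ} (hn : i + L < n) :
    StronglyMeasurable[past X hX n] fun ω => F (shift X i ω) := by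
  have h1 : (fun ω => F (shift X i ω)) =
      F ∘ fun ω s => if s ≤ L then X (i + s) ω else 0 := by
    ext ω
    exact hF.dep _ _ fun s hs => by simp [shift, hs]
  rw [h1]
  refine (hF.meas.comp (@measurable_pi_lambda _ _ _ (past X hX n) _ _ fun s => ?_)).stronglyMeasurable
  by_cases hs : s ≤ L
  · simp only [hs, if_true]
    exact DecayingSchrodinger.measurable_past hX (by omega)
  · simp only [hs, if_false]
    exact measurable_const

lemma BoundedIID.indep_future (h : BoundedIID μ X B) (i : ℕ) :
    Indep (⨆ j ∈ Set.Ici i, MeasurableSpace.comap (X j) inferInstance) (past X h.meas i) μ := by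
  refine indep_iSup_of_disjoint (fun j => (h.meas j).comap_le) h.indep ?_
  rw [Set.disjoint_left]
  intro a ha hb
  exact absurd (Set.mem_Iio.mp hb) (not_lt.mpr (Set.mem_Ici.mp ha))

lemma measurable_future (i : ℕ) : Measurable[⨆ j ∈ Set.Ici i,
    MeasurableSpace.comap (X j) inferInstance] (shift X i) :=
  @measurable_pi_lambda _ _ _ (⨆ j ∈ Set.Ici i, MeasurableSpace.comap (X j) inferInstance) _ _
    fun s => (comap_measurable (X (i + s))).mono
      (le_biSup (fun i => MeasurableSpace.comap (X i) inferInstance)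
        (Set.mem_Ici.mpr (Nat.le_add_right i s))) le_rfl

lemma future_le (hX : ∀ n, Measurable (X n)) (i : ℕ) :
    (⨆ j ∈ Set.Ici i, MeasurableSpace.comap (X j) inferInstance) ≤ mΩ :=
  iSup₂_le fun j _ => (hX j).comap_le

lemma BoundedIID.identDistrib_shift (h : BoundedIID μ X B) (i : ℕ) :
    IdentDistrib (shift X i) (shift X 0) μ μ :=
  IdentDistrib.pi (X := fun s => X (i + s)) (Y := fun s => X (0 + s))
    (fun s => (h.ident (i + s)).trans (h.ident (0 + s)).symm)
    (h.indep.precomp (add_right_injective i)) (h.indep.precomp (add_right_injective 0))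

lemma BoundedIID.integral_shift [IsProbabilityMeasure μ]
    (h : BoundedIID μ X B) {F : (ℕ → ℝ) → ℝ} (hF : Measurable F)
    (i : ℕ) : ∫ ω, F (shift X i ω) ∂μ = ∫ ω, F (shift X 0 ω) ∂μ :=
  ((h.identDistrib_shift i).comp hF).integral_eq

lemma BoundedIID.condExp_shift [IsProbabilityMeasure μ]
    (h : BoundedIID μ X B) {F : (ℕ → ℝ) → ℝ} (hF : Measurable F)
    (i : ℕ) : μ[fun ω => F (shift X i ω) | past X h.meas i] =ᵐ[μ]
      fun _ => ∫ ω, F (shift X 0 ω) ∂μ := by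
  have := condExp_indep_eq (future_le h.meas i) ((past X h.meas).le i)
    (f := fun ω => F (shift X i ω)) ((hF.comp (measurable_future i)).stronglyMeasurable)
    (h.indep_future i)
  rwa [h.integral_shift hF] at this

lemma BoundedIID.finiteRange [IsProbabilityMeasure μ]
    (h : BoundedIID μ X B) {L : ℕ} {F : (ℕ → ℝ) → ℝ}
    (hF : IsWindow L F) {K : ℝ} (hK : ∀ i ω, |F (shift X i ω)| ≤ K) :
    FiniteRange μ (past X h.meas) L (2 * K)
      fun i ω => F (shift X i ω) - ∫ ω', F (shift X 0 ω') ∂μ where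
  adapted i := (hF.measurable_past h.meas (Nat.lt_succ_self _)).sub stronglyMeasurable_const
  bound i ω := by
    have h1 : |∫ ω', F (shift X 0 ω') ∂μ| ≤ K := by
      have := norm_integral_le_of_norm_le_const (μ := μ) (f := fun ω => F (shift X 0 ω))
        (ae_of_all _ fun ω => hK 0 ω)
      simpa using this
    have := abs_sub (F (shift X i ω)) (∫ ω', F (shift X 0 ω') ∂μ)
    linarith [hK i ω]
  condExp i := by
    have hI : Integrable (fun ω => F (shift X i ω)) μ :=
      integrable_of_abs_le (hF.meas.comp (measurable_shift h.meas i)).aestronglyMeasurable (hK i)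
    refine (condExp_sub hI (integrable_const _) _).trans ?_
    filter_upwards [h.condExp_shift hF.meas i] with ω hω
    rw [Pi.sub_apply, hω, condExp_const ((past X h.meas).le i)]
    simp

/-- A function of the past is uncorrelated with a function of the present. -/
lemma BoundedIID.integral_past_mul [IsProbabilityMeasure μ]
    (h : BoundedIID μ X B) {n : ℕ} {f : Ω → ℝ}
    (hf : StronglyMeasurable[past X h.meas n] f) {φ : ℝ → ℝ} (hφ : Measurable φ) :
    ∫ ω, f ω * φ (X n ω) ∂μ = (∫ ω, f ω ∂μ) * ∫ ω, φ (X 0 ω) ∂μ := by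
  have hind : IndepFun f (fun ω => φ (X n ω)) μ := by
    rw [IndepFun_iff_Indep]
    refine indep_of_indep_of_le_left (indep_of_indep_of_le_right (h.indep_future n).symm ?_)
      hf.measurable.comap_le
    have : Measurable[⨆ j ∈ Set.Ici n, MeasurableSpace.comap (X j) inferInstance] (X n) :=
      (measurable_pi_apply 0).comp (measurable_future (X := X) n)
    exact (hφ.comp this).comap_le
  have := hind.integral_fun_mul_eq_mul_integral (hf.mono ((past X h.meas).le n)).aestronglyMeasurable
    (hφ.comp (h.meas n)).aestronglyMeasurable
  rw [this]
  congr 1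
  exact ((h.ident n).comp hφ).integral_eq

lemma BoundedIID.condExp_past_mul [IsProbabilityMeasure μ]
    (h : BoundedIID μ X B) {n : ℕ} {f : Ω → ℝ}
    (hf : StronglyMeasurable[past X h.meas n] f) {C : ℝ} (hC : ∀ ω, |f ω| ≤ C) {φ : ℝ → ℝ}
    (hφ : Measurable φ) {D : ℝ} (hD : ∀ ω, |φ (X n ω)| ≤ D) (h0 : ∫ ω, φ (X 0 ω) ∂μ = 0) :
    μ[fun ω => f ω * φ (X n ω) | past X h.meas n] =ᵐ[μ] 0 := by
  have hI : Integrable (fun ω => φ (X n ω)) μ :=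
    integrable_of_abs_le (hφ.comp (h.meas n)).aestronglyMeasurable hD
  have hI2 : Integrable (f * fun ω => φ (X n ω)) μ :=
    integrable_of_abs_le (C := C * D) ((hf.mono ((past X h.meas).le n)).mul
      (hφ.comp (h.meas n)).stronglyMeasurable).aestronglyMeasurable fun ω => by
        rw [Pi.mul_apply, abs_mul]
        exact mul_le_mul (hC ω) (hD ω) (abs_nonneg _) ((abs_nonneg _).trans (hC ω))
  refine (condExp_mul_of_stronglyMeasurable_left hf hI2 hI).trans ?_
  have h1 := h.condExp_shift (F := fun x => φ (x 0)) (hφ.comp (measurable_pi_apply 0)) n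
  filter_upwards [h1] with ω hω
  rw [Pi.mul_apply]
  have h2 : (μ[fun ω => φ (X n ω) | past X h.meas n]) ω = 0 := by
    refine hω.trans ?_
    exact h0
  rw [h2, mul_zero]
  rfl

/-- A filtration observed from time `K` on. -/
def delayed (ℱ : Filtration ℕ mΩ) (K : ℕ) : Filtration ℕ mΩ where
  seq n := ℱ (n + K)
  mono' := fun _ _ h => ℱ.mono (Nat.add_le_add_right h K)
  le' := fun _ => ℱ.le _

/-- Central limit theorem for weighted sums of a window function that is centred given all entries
of the window but the last one. -/
theorem BoundedIID.tendstoInDistribution [IsProbabilityMeasure μ]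
    (h : BoundedIID μ X B) {L : ℕ} {F : (ℕ → ℝ) → ℝ}
    (hF : IsWindow L F) {K : ℝ} (hK : ∀ i ω, |F (shift X i ω)| ≤ K)
    (hc : ∀ i, μ[fun ω => F (shift X i ω) | past X h.meas (i + L)] =ᵐ[μ] 0) {γ : ℝ} (hγ : 0 ≤ γ)
    (hγ1 : 2 * γ ≤ 1) :
    TendstoInDistribution (fun N ω => (∑ i ∈ Finset.range N, weight γ i * F (shift X i ω))
      / growth (2 * γ) N) atTop (id : ℝ → ℝ) (fun _ => μ)
      (gaussianReal 0 (∫ ω, F (shift X 0 ω) ^ 2 ∂μ).toNNReal) := by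
  have hM : FiniteRange μ (delayed (past X h.meas) L) 0 K fun i ω => F (shift X i ω) :=
    { adapted := fun i => hF.measurable_past h.meas (by omega)
      bound := hK
      condExp := hc }
  have hF2 : IsWindow L fun x => F x ^ 2 :=
    ⟨hF.meas.pow_const 2, fun x y hxy => by rw [hF.dep x y hxy]⟩
  have hQ := h.finiteRange hF2 (K := K ^ 2) fun i ω => by
    rw [abs_pow]
    exact pow_le_pow_left₀ (abs_nonneg _) (hK i ω) 2
  refine hM.tendstoInDistribution (fun i => weight_nonneg γ i) (fun i => weight_le_one hγ i)
    (tendsto_growth hγ1) ?_ (integral_nonneg fun ω => sq_nonneg _) hQ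
  simp only [weight_sq]
  exact tendsto_sum_weight_div (by linarith) hγ1

end Window


/-! ### Expansion of the statistic over paths -/

/-- The monomial `∏_{s ∈ O} x_s`. -/
def monomialAt (O : Multiset ℕ) (x : ℕ → ℝ) : ℝ := (O.map x).prod

lemma monomialAt_mul (O : Multiset ℕ) (x y : ℕ → ℝ) :
    monomialAt O (fun s => x s * y s) = monomialAt O x * monomialAt O y :=
  Multiset.prod_map_mul

lemma monomialAt_zero (x : ℕ → ℝ) : monomialAt 0 x = 1 := by simp [monomialAt]

lemma monomialAt_cons (a : ℕ) (O : Multiset ℕ) (x : ℕ → ℝ) :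
    monomialAt (a ::ₘ O) x = x a * monomialAt O x := by simp [monomialAt]

lemma monomialAt_singleton (a : ℕ) (x : ℕ → ℝ) : monomialAt {a} x = x a := by simp [monomialAt]

lemma measurable_monomialAt (O : Multiset ℕ) : Measurable (monomialAt O) := by
  induction O using Multiset.induction_on with
  | empty => simpa only [funext monomialAt_zero] using measurable_const
  | cons a O ih =>
    simp only [funext (monomialAt_cons a O)]
    exact (measurable_pi_apply a).mul ih

lemma isWindow_monomialAt {O : Multiset ℕ} {L : ℕ} (hO : ∀ s ∈ O, s ≤ L) :
    IsWindow L (monomialAt O) :=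
  ⟨measurable_monomialAt O, fun x y hxy => by
    rw [monomialAt, monomialAt, Multiset.map_congr rfl fun s hs => hxy s (hO s hs)]⟩

lemma abs_monomialAt_le {O : Multiset ℕ} {x : ℕ → ℝ} {B : ℝ} (hB : ∀ s, |x s| ≤ B) :
    |monomialAt O x| ≤ B ^ O.card := by
  have hB0 : 0 ≤ B := (abs_nonneg _).trans (hB 0)
  induction O using Multiset.induction_on with
  | empty => simp [monomialAt]
  | cons a O ih =>
    rw [monomialAt_cons, abs_mul, Multiset.card_cons, pow_succ, mul_comm]
    exact mul_le_mul ih (hB a) (abs_nonneg _) (by positivity)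

lemma monomialAt_weight_nonneg (α : ℝ) (O : Multiset ℕ) (i : ℕ) :
    0 ≤ monomialAt O fun s => weight α (i + s) :=
  Multiset.prod_nonneg fun a ha => by
    obtain ⟨s, -, rfl⟩ := Multiset.mem_map.mp ha
    exact weight_nonneg _ _

lemma monomialAt_weight_le {α : ℝ} (hα : 0 ≤ α) (O : Multiset ℕ) (i : ℕ) :
    monomialAt O (fun s => weight α (i + s)) ≤ weight (O.card * α) i := by
  rw [← weight_pow]
  induction O using Multiset.induction_on with
  | empty => simp [monomialAt]
  | cons a O ih =>
    rw [monomialAt_cons, Multiset.card_cons, pow_succ, mul_comm]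
    exact mul_le_mul ih (weight_antitone hα (Nat.le_add_right i a)) (weight_nonneg _ _)
      (pow_nonneg (weight_nonneg _ _) _)

lemma le_monomialAt_weight {α : ℝ} (hα : 0 ≤ α) {O : Multiset ℕ} {L : ℕ} (hO : ∀ s ∈ O, s ≤ L)
    (i : ℕ) : weight (O.card * α) (i + L) ≤ monomialAt O (fun s => weight α (i + s)) := by
  rw [← weight_pow]
  induction O using Multiset.induction_on with
  | empty => simp [monomialAt]
  | cons a O ih =>
    rw [monomialAt_cons, Multiset.card_cons, pow_succ, mul_comm]
    refine mul_le_mul (weight_antitone hα (Nat.add_le_add_left (hO a (Multiset.mem_cons_self a O)) i))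
      (ih fun s hs => hO s (Multiset.mem_cons_of_mem hs)) (pow_nonneg (weight_nonneg _ _) _)
      (weight_nonneg _ _)

section Stat

variable {Ω : Type*} {mΩ : MeasurableSpace Ω} {μ : Measure Ω}
  {X : ℕ → Ω → ℝ} {B : ℝ}

/-- The centred monomial seen from site `i`. -/
noncomputable def centredMonomial (μ : Measure Ω) (X : ℕ → Ω → ℝ) (O : Multiset ℕ) (i : ℕ) (ω : Ω) : ℝ :=
  monomialAt O (shift X i ω) - ∫ ω', monomialAt O (shift X 0 ω') ∂μ

/-- The centred contribution of a path to the trace. -/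
noncomputable def pathTerm (μ : Measure Ω) (X : ℕ → Ω → ℝ) (α : ℝ) {k : ℕ} (y : Fin (k + 1) → ℤ)
    (N : ℕ) (ω : Ω) : ℝ :=
  ∑ i ∈ Finset.range (N - (depth y + height y)),
    monomialAt (offsets y) (fun s => weight α (i + s)) * centredMonomial μ X (offsets y) i ω

lemma card_offsets {k : ℕ} (y : Fin (k + 1) → ℤ) : (offsets y).card = (flats y).card := by
  rw [offsets, Multiset.card_map]

lemma offsets_le {k : ℕ} (y : Fin (k + 1) → ℤ) : ∀ s ∈ offsets y, s ≤ depth y + height y := by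
  intro s hs
  rw [offsets, Multiset.mem_map] at hs
  obtain ⟨a, ha, rfl⟩ := hs
  obtain ⟨t, rfl⟩ := mem_flats ha
  have := le_height y t
  omega

lemma linStat_eq (X : ℕ → Ω → ℝ) (α : ℝ) {P : ℝ[X]} {m : ℕ} (hP : P.natDegree ≤ m) (N : ℕ)
    (ω : Ω) : linStat X α P N ω = ∑ k ∈ Finset.range (m + 1), P.coeff k * ∑ y ∈ paths k,
      ∑ i ∈ Finset.range (N - (depth y + height y)),
        monomialAt (offsets y) (fun s => weight α (i + s)) * monomialAt (offsets y) (shift X i ω) := by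
  rw [linStat, Polynomial.aeval_eq_sum_range' (Nat.lt_succ_of_le hP), Matrix.trace_sum]
  refine Finset.sum_congr rfl fun k _ => ?_
  rw [Matrix.trace_smul, smul_eq_mul, trace_pow_eq _ (fun n => weight α n * X n ω)]
  · congr 1
    refine Finset.sum_congr rfl fun y _ => Finset.sum_congr rfl fun i _ => ?_
    rw [← monomialAt_mul]
    rfl
  · intro i j
    simp only [hamiltonian, Matrix.of_apply]
    congr 1
    rw [weight, Real.rpow_neg (by positivity), div_eq_mul_inv, mul_comm]

lemma BoundedIID.abs_monomialAt_shift_le (h : BoundedIID μ X B) (O : Multiset ℕ) (i : ℕ) (ω : Ω) :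
    |monomialAt O (shift X i ω)| ≤ B ^ O.card :=
  abs_monomialAt_le fun s => h.bound (i + s) ω

lemma BoundedIID.integrable_monomialAt [IsProbabilityMeasure μ]
    (h : BoundedIID μ X B) (O : Multiset ℕ) (i : ℕ) :
    Integrable (fun ω => monomialAt O (shift X i ω)) μ :=
  integrable_of_abs_le
    ((measurable_monomialAt O).comp (measurable_shift h.meas i)).aestronglyMeasurable
    (h.abs_monomialAt_shift_le O i)

/-- Exact expansion of the centred statistic over closed paths. -/
lemma BoundedIID.centredStat_eq [IsProbabilityMeasure μ]
    (h : BoundedIID μ X B) (α : ℝ) {P : ℝ[X]} {m : ℕ}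
    (hP : P.natDegree ≤ m) (N : ℕ) (ω : Ω) : centredStat μ X α P N ω =
      ∑ k ∈ Finset.range (m + 1), P.coeff k * ∑ y ∈ paths k, pathTerm μ X α y N ω := by
  have hI : ∀ (k : ℕ) (y : Fin (k + 1) → ℤ), Integrable (fun ω =>
      ∑ i ∈ Finset.range (N - (depth y + height y)), monomialAt (offsets y)
        (fun s => weight α (i + s)) * monomialAt (offsets y) (shift X i ω)) μ := fun k y =>
    integrable_finsetSum _ fun i _ => (h.integrable_monomialAt _ i).const_mul _
  rw [centredStat]
  simp only [linStat_eq X α hP]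
  rw [integral_finsetSum _ fun k _ =>
    (integrable_finsetSum _ fun y _ => hI k y).const_mul _, ← Finset.sum_sub_distrib]
  refine Finset.sum_congr rfl fun k _ => ?_
  rw [integral_const_mul, integral_finsetSum _ fun y _ => hI k y, ← mul_sub,
    ← Finset.sum_sub_distrib]
  congr 1
  refine Finset.sum_congr rfl fun y _ => ?_
  rw [integral_finsetSum _ fun i _ => (h.integrable_monomialAt _ i).const_mul _, pathTerm,
    ← Finset.sum_sub_distrib]
  refine Finset.sum_congr rfl fun i _ => ?_
  rw [integral_const_mul, h.integral_shift (measurable_monomialAt _), centredMonomial, mul_sub]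

lemma centredMonomial_zero [IsProbabilityMeasure μ]
    (i : ℕ) (ω : Ω) : centredMonomial μ X 0 i ω = 0 := by
  simp [centredMonomial, monomialAt]

lemma pathTerm_eq_zero [IsProbabilityMeasure μ]
    {α : ℝ} {k : ℕ} {y : Fin (k + 1) → ℤ} (hy : (flats y).card = 0) (N : ℕ)
    (ω : Ω) : pathTerm μ X α y N ω = 0 := by
  rw [← card_offsets, Multiset.card_eq_zero] at hy
  simp [pathTerm, hy, centredMonomial_zero]

lemma BoundedIID.finiteRange_centredMonomial [IsProbabilityMeasure μ]
    (h : BoundedIID μ X B) {O : Multiset ℕ} {L : ℕ}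
    (hO : ∀ s ∈ O, s ≤ L) :
    FiniteRange μ (past X h.meas) L (2 * B ^ O.card) (centredMonomial μ X O) :=
  h.finiteRange (isWindow_monomialAt hO) (h.abs_monomialAt_shift_le O)

/-! ### Almost sure convergence of path contributions -/

lemma sq_monomialAt_weight_le {α : ℝ} (hα : 0 ≤ α) (O : Multiset ℕ) (i : ℕ) :
    (monomialAt O fun s => weight α (i + s)) ^ 2 ≤ weight (2 * (O.card * α)) i := by
  rw [← weight_sq]
  exact pow_le_pow_left₀ (monomialAt_weight_nonneg α O i) (monomialAt_weight_le hα O i) 2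

/-- A sequence of random variables converges almost surely to a square integrable limit. -/
def ConvergesAE (μ : Measure Ω) (f : ℕ → Ω → ℝ) : Prop :=
  ∃ Y : Ω → ℝ, MemLp Y 2 μ ∧ ∀ᵐ ω ∂μ, Tendsto (fun N => f N ω) atTop (𝓝 (Y ω))

lemma ConvergesAE.sum {ι : Type*} {s : Finset ι} {f : ι → ℕ → Ω → ℝ}
    (hf : ∀ i ∈ s, ConvergesAE μ (f i)) : ConvergesAE μ fun N ω => ∑ i ∈ s, f i N ω := by
  classical
  induction s using Finset.induction_on with
  | empty => exact ⟨fun _ => 0, MemLp.zero', by simp⟩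
  | insert j s hj ih =>
    obtain ⟨Y, hY, hlim⟩ := ih fun i hi => hf i (Finset.mem_insert_of_mem hi)
    obtain ⟨Y', hY', hlim'⟩ := hf j (Finset.mem_insert_self _ _)
    refine ⟨fun ω => Y' ω + Y ω, hY'.add hY, ?_⟩
    filter_upwards [hlim, hlim'] with ω h1 h2
    simp only [Finset.sum_insert hj]
    exact h2.add h1

lemma ConvergesAE.const_mul {f : ℕ → Ω → ℝ} (hf : ConvergesAE μ f) (c : ℝ) :
    ConvergesAE μ fun N ω => c * f N ω := by
  obtain ⟨Y, hY, hlim⟩ := hf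
  refine ⟨fun ω => c * Y ω, hY.const_mul c, ?_⟩
  filter_upwards [hlim] with ω h1
  exact h1.const_mul c

lemma BoundedIID.convergesAE_pathTerm [IsProbabilityMeasure μ]
    (h : BoundedIID μ X B) {α : ℝ} (hα : 0 ≤ α) {k : ℕ}
    {y : Fin (k + 1) → ℤ} (hy : 1 < 2 * ((flats y).card * α)) :
    ConvergesAE μ (pathTerm μ X α y) := by
  have hZ := h.finiteRange_centredMonomial (offsets_le y)
  obtain ⟨Y, hY, hlim⟩ := hZ.ae_tendsto (c := fun i => monomialAt (offsets y) fun s =>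
    weight α (i + s)) <| by
      rw [← card_offsets] at hy
      exact (summable_weight hy).of_nonneg_of_le (fun _ => sq_nonneg _)
        fun i => sq_monomialAt_weight_le hα _ i
  refine ⟨Y, hY, ?_⟩
  filter_upwards [hlim] with ω hω
  exact hω.comp (tendsto_sub_atTop_nat _)

/-! ### Paths with a single flat step -/

lemma exists_offset_of_card_eq_one {k : ℕ} {y : Fin (k + 1) → ℤ} (hy : (flats y).card = 1) :
    ∃ s ≤ depth y + height y, offsets y = {s} := by
  rw [← card_offsets, Multiset.card_eq_one] at hy
  obtain ⟨s, hs⟩ := hy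
  exact ⟨s, offsets_le y s (by simp [hs]), hs⟩

lemma BoundedIID.integral_singleton (h : BoundedIID μ X B) (s : ℕ) :
    ∫ ω, monomialAt {s} (shift X 0 ω) ∂μ = 0 := by
  simp only [monomialAt_singleton]
  refine Eq.trans ?_ h.mean
  exact (h.ident (0 + s)).integral_eq

lemma sum_range_shift (f : ℕ → ℝ) (n s : ℕ) :
    ∑ i ∈ Finset.range n, f (i + s) = ∑ i ∈ Finset.range n, f i
      + (∑ i ∈ Finset.range s, f (n + i) - ∑ i ∈ Finset.range s, f i) := by
  have h1 := Finset.sum_range_add f n s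
  have h2 := Finset.sum_range_add f s n
  rw [add_comm s n] at h2
  simp only [add_comm s] at h2
  linarith

lemma sum_range_sub_const (f : ℕ → ℝ) {N L : ℕ} (h : L ≤ N) :
    ∑ i ∈ Finset.range (N - L), f i =
      ∑ i ∈ Finset.range N, f i - ∑ i ∈ Finset.range L, f (N - L + i) := by
  have := Finset.sum_range_add f (N - L) L
  rw [Nat.sub_add_cancel h] at this
  linarith

lemma BoundedIID.convergesAE_single [IsProbabilityMeasure μ]
    (h : BoundedIID μ X B) {α : ℝ} (hα : 0 < α) {k : ℕ}
    {y : Fin (k + 1) → ℤ} (hy : (flats y).card = 1) :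
    ConvergesAE μ fun N ω => pathTerm μ X α y N ω
      - ∑ i ∈ Finset.range N, weight α i * X i ω := by
  obtain ⟨s, -, hO⟩ := exists_offset_of_card_eq_one hy
  refine ⟨fun ω => -∑ i ∈ Finset.range s, weight α i * X i ω, ?_, ae_of_all _ fun ω => ?_⟩
  · exact (memLp_finsetSum _ fun i _ =>
      (memLp_two_of_abs_le (h.meas i).aestronglyMeasurable (h.bound i)).const_mul _).neg
  set f : ℕ → ℝ := fun i => weight α i * X i ω with hf
  have hf0 : Tendsto f atTop (𝓝 0) := by
    have hw : Tendsto (weight α) atTop (𝓝 0) :=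
      (tendsto_rpow_neg_atTop hα).comp
        (tendsto_atTop_add_const_right _ _ tendsto_natCast_atTop_atTop)
    have hB := (hw.mul_const B)
    rw [zero_mul] at hB
    refine squeeze_zero_norm (fun i => ?_) hB
    rw [hf, Real.norm_eq_abs, abs_mul, abs_of_nonneg (weight_nonneg _ _)]
    exact mul_le_mul_of_nonneg_left (h.bound i ω) (weight_nonneg _ _)
  set L := depth y + height y
  have hterm : ∀ N, L ≤ N → pathTerm μ X α y N ω - ∑ i ∈ Finset.range N, f i =
      ∑ i ∈ Finset.range s, f (N - L + i) - ∑ i ∈ Finset.range L, f (N - L + i)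
        - ∑ i ∈ Finset.range s, f i := by
    intro N hN
    have h1 : pathTerm μ X α y N ω = ∑ i ∈ Finset.range (N - L), f (i + s) := by
      simp only [pathTerm, hO, centredMonomial, h.integral_singleton, sub_zero]
      simp only [monomialAt_singleton]
      rfl
    rw [h1, sum_range_shift, sum_range_sub_const f hN]
    ring
  have hlim : ∀ i, Tendsto (fun N => f (N - L + i)) atTop (𝓝 0) := fun i =>
    hf0.comp ((tendsto_add_atTop_nat i).comp (tendsto_sub_atTop_nat L))
  have := ((tendsto_finsetSum (Finset.range s) fun i _ => hlim i).sub
    (tendsto_finsetSum (Finset.range L) fun i _ => hlim i)).sub_const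
      (∑ i ∈ Finset.range s, f i)
  simp only [Finset.sum_const_zero, sub_zero, zero_sub] at this
  refine this.congr' ?_
  filter_upwards [eventually_ge_atTop L] with N hN
  rw [hterm N hN]

/-! ### Bounded and negligible errors -/

lemma sum_weight_sub_le {γ : ℝ} (hγ : 0 ≤ γ) (c n : ℕ) :
    ∑ i ∈ Finset.range n, (weight γ i - weight γ (i + c)) ≤ c := by
  induction c with
  | zero => simp
  | succ c ih =>
    have h1 : ∑ i ∈ Finset.range n, (weight γ (i + c) - weight γ (i + (c + 1))) =
        weight γ c - weight γ (n + c) := by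
      have := Finset.sum_range_sub' (fun i => weight γ (i + c)) n
      simp only [zero_add] at this
      rw [← this]
      refine Finset.sum_congr rfl fun i _ => ?_
      rw [show i + (c + 1) = i + 1 + c by ring]
    have h2 : ∑ i ∈ Finset.range n, (weight γ i - weight γ (i + (c + 1))) =
        ∑ i ∈ Finset.range n, (weight γ i - weight γ (i + c))
          + ∑ i ∈ Finset.range n, (weight γ (i + c) - weight γ (i + (c + 1))) := by
      rw [← Finset.sum_add_distrib]
      refine Finset.sum_congr rfl fun i _ => ?_
      ring
    rw [h2, h1]
    have := weight_le_one hγ c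
    have := weight_nonneg γ (n + c)
    push_cast
    linarith

lemma abs_sum_le_card_mul {f : ℕ → ℝ} {K : ℝ} (hf : ∀ i, |f i| ≤ K) (n : ℕ) :
    |∑ i ∈ Finset.range n, f i| ≤ n * K := by
  refine (Finset.abs_sum_le_sum_abs _ _).trans ((Finset.sum_le_sum fun i _ => hf i).trans ?_)
  simp

/-- Weighted sums of a bounded sequence change by a bounded amount if the sequence is shifted. -/
lemma abs_sum_weight_shift_le {γ : ℝ} (hγ : 0 ≤ γ) {f : ℕ → ℝ} {K : ℝ} (hf : ∀ i, |f i| ≤ K)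
    (c N : ℕ) : |∑ i ∈ Finset.range N, weight γ i * f (i + c)
      - ∑ i ∈ Finset.range N, weight γ i * f i| ≤ 3 * c * K := by
  have hK : 0 ≤ K := (abs_nonneg _).trans (hf 0)
  set h : ℕ → ℝ := fun i => weight γ i * f i with hh
  have hhK : ∀ i, |h i| ≤ K := fun i => by
    rw [hh, abs_mul, abs_of_nonneg (weight_nonneg _ _)]
    exact (mul_le_mul (weight_le_one hγ i) (hf i) (abs_nonneg _) zero_le_one).trans (by simp)
  have h1 := sum_range_shift h N c
  have h2 : ∑ i ∈ Finset.range N, weight γ i * f (i + c) - ∑ i ∈ Finset.range N, h i =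
      ∑ i ∈ Finset.range N, (weight γ i - weight γ (i + c)) * f (i + c)
        + (∑ i ∈ Finset.range c, h (N + i) - ∑ i ∈ Finset.range c, h i) := by
    have : ∑ i ∈ Finset.range N, (weight γ i - weight γ (i + c)) * f (i + c) =
        ∑ i ∈ Finset.range N, weight γ i * f (i + c) - ∑ i ∈ Finset.range N, h (i + c) := by
      rw [← Finset.sum_sub_distrib]
      refine Finset.sum_congr rfl fun i _ => ?_
      simp only [hh]
      ring
    rw [this, h1]
    ring
  rw [h2]
  have h3 : |∑ i ∈ Finset.range N, (weight γ i - weight γ (i + c)) * f (i + c)| ≤ c * K := by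
    refine (Finset.abs_sum_le_sum_abs _ _).trans ?_
    refine le_trans (Finset.sum_le_sum (g := fun i => (weight γ i - weight γ (i + c)) * K)
      fun i _ => ?_) ?_
    · have h0 : 0 ≤ weight γ i - weight γ (i + c) :=
        sub_nonneg.mpr (weight_antitone hγ (Nat.le_add_right i c))
      rw [abs_mul, abs_of_nonneg h0]
      exact mul_le_mul_of_nonneg_left (hf _) h0
    · rw [← Finset.sum_mul]
      exact mul_le_mul_of_nonneg_right (sum_weight_sub_le hγ c N) hK
  have h4 := abs_sum_le_card_mul (f := fun i => h (N + i)) (fun i => hhK _) c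
  have h5 := abs_sum_le_card_mul hhK c
  rw [abs_le] at *
  constructor <;> linarith

/-- The effect of the precise weights and of the boundary is bounded. -/
lemma abs_sum_monomialAt_weight_sub_le {α : ℝ} (hα : 0 ≤ α) {O : Multiset ℕ} {L : ℕ}
    (hO : ∀ s ∈ O, s ≤ L) {f : ℕ → ℝ} {K : ℝ} (hf : ∀ i, |f i| ≤ K) (N : ℕ) :
    |∑ i ∈ Finset.range (N - L), monomialAt O (fun s => weight α (i + s)) * f i
      - ∑ i ∈ Finset.range N, weight (O.card * α) i * f i| ≤ 2 * L * K := by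
  have hK : 0 ≤ K := (abs_nonneg _).trans (hf 0)
  have hγ : 0 ≤ O.card * α := by positivity
  set γ := O.card * α
  have h1 : |∑ i ∈ Finset.range (N - L), monomialAt O (fun s => weight α (i + s)) * f i
      - ∑ i ∈ Finset.range (N - L), weight γ i * f i| ≤ L * K := by
    rw [← Finset.sum_sub_distrib]
    refine (Finset.abs_sum_le_sum_abs _ _).trans ?_
    refine le_trans (Finset.sum_le_sum (g := fun i => (weight γ i - weight γ (i + L)) * K)
      fun i _ => ?_) ?_
    · rw [← sub_mul, abs_mul, abs_sub_comm,
        abs_of_nonneg (sub_nonneg.mpr (monomialAt_weight_le hα O i))]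
      exact mul_le_mul (sub_le_sub_left (le_monomialAt_weight hα hO i) _) (hf i) (abs_nonneg _)
        (sub_nonneg.mpr (weight_antitone hγ (Nat.le_add_right i L)))
    · rw [← Finset.sum_mul]
      exact mul_le_mul_of_nonneg_right (sum_weight_sub_le hγ L _) hK
  have hwf : ∀ i, |weight γ i * f i| ≤ K := fun i => by
    rw [abs_mul, abs_of_nonneg (weight_nonneg _ _)]
    exact (mul_le_mul (weight_le_one hγ i) (hf i) (abs_nonneg _) zero_le_one).trans (by simp)
  have h2 : |∑ i ∈ Finset.range (N - L), weight γ i * f i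
      - ∑ i ∈ Finset.range N, weight γ i * f i| ≤ L * K := by
    rcases le_total L N with h | h
    · rw [sum_range_sub_const _ h, sub_sub_cancel_left, abs_neg]
      exact abs_sum_le_card_mul (fun i => hwf _) L
    · rw [Nat.sub_eq_zero_of_le h, Finset.range_zero, Finset.sum_empty, zero_sub, abs_neg]
      refine (abs_sum_le_card_mul hwf N).trans ?_
      exact mul_le_mul_of_nonneg_right (by exact_mod_cast h) hK
  rw [abs_le] at *
  constructor <;> linarith

/-- A sequence of random variables that is negligible in mean with respect to a normalisation. -/
structure Negligible (μ : Measure Ω) (g : ℕ → ℝ) (f : ℕ → Ω → ℝ) : Prop where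
  integrable : ∀ N, Integrable (f N) μ
  tendsto : Tendsto (fun N => (∫ ω, |f N ω| ∂μ) * |(g N)⁻¹|) atTop (𝓝 0)

lemma Negligible.add {g : ℕ → ℝ} {f f' : ℕ → Ω → ℝ} (hf : Negligible μ g f)
    (hf' : Negligible μ g f') : Negligible μ g fun N ω => f N ω + f' N ω := by
  refine ⟨fun N => (hf.integrable N).add (hf'.integrable N), ?_⟩
  have := hf.tendsto.add hf'.tendsto
  rw [add_zero] at this
  refine squeeze_zero (fun N => by positivity) (fun N => ?_) this
  rw [← add_mul, ← integral_add (hf.integrable N).abs (hf'.integrable N).abs]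
  refine mul_le_mul_of_nonneg_right ?_ (abs_nonneg _)
  exact integral_mono ((hf.integrable N).add (hf'.integrable N)).abs
    ((hf.integrable N).abs.add (hf'.integrable N).abs) fun ω => abs_add_le _ _

lemma Negligible.const_mul {g : ℕ → ℝ} {f : ℕ → Ω → ℝ} (hf : Negligible μ g f) (c : ℝ) :
    Negligible μ g fun N ω => c * f N ω := by
  refine ⟨fun N => (hf.integrable N).const_mul c, ?_⟩
  have := hf.tendsto.const_mul |c|
  rw [mul_zero] at this
  refine this.congr fun N => ?_
  simp only [abs_mul]
  rw [integral_const_mul, mul_assoc]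

lemma Negligible.congr {g : ℕ → ℝ} {f f' : ℕ → Ω → ℝ} (hf : Negligible μ g f)
    (h : ∀ N ω, f N ω = f' N ω) : Negligible μ g f' := by
  rwa [show f' = f from funext fun N => funext fun ω => (h N ω).symm]

lemma Negligible.zero (g : ℕ → ℝ) : Negligible μ g fun _ _ => 0 :=
  ⟨fun _ => integrable_zero _ _ _, by simp⟩

lemma Negligible.sum [IsProbabilityMeasure μ]
    {ι : Type*} {s : Finset ι} {g : ℕ → ℝ} {f : ι → ℕ → Ω → ℝ}
    (hf : ∀ i ∈ s, Negligible μ g (f i)) : Negligible μ g fun N ω => ∑ i ∈ s, f i N ω := by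
  classical
  induction s using Finset.induction_on with
  | empty => simpa using Negligible.zero g
  | insert j s hj ih =>
    simp only [Finset.sum_insert hj]
    exact (hf j (Finset.mem_insert_self _ _)).add (ih fun i hi => hf i (Finset.mem_insert_of_mem hi))

lemma Negligible.of_bounded [IsProbabilityMeasure μ]
    {g : ℕ → ℝ} (hg : Tendsto g atTop atTop) {f : ℕ → Ω → ℝ}
    (hm : ∀ N, AEStronglyMeasurable (f N) μ) {C : ℝ} (hC : ∀ N ω, |f N ω| ≤ C) :
    Negligible μ g f := by
  refine ⟨fun N => integrable_of_abs_le (hm N) (hC N), ?_⟩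
  have h1 : Tendsto (fun N => C * |(g N)⁻¹|) atTop (𝓝 0) := by
    have := (hg.inv_tendsto_atTop.abs).const_mul C
    simpa using this
  refine squeeze_zero (fun N => by positivity) (fun N => ?_) h1
  refine mul_le_mul_of_nonneg_right ?_ (abs_nonneg _)
  calc ∫ ω, |f N ω| ∂μ ≤ ∫ _, C ∂μ :=
        integral_mono (integrable_of_abs_le (hm N) (hC N)).abs (integrable_const _) (hC N)
    _ = C := by simp

lemma measurable_centredMonomial (hX : ∀ n, Measurable (X n)) (O : Multiset ℕ) (i : ℕ) :
    Measurable (centredMonomial μ X O i) :=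
  ((measurable_monomialAt O).comp (measurable_shift hX i)).sub_const _

lemma measurable_pathTerm [IsProbabilityMeasure μ]
    (hX : ∀ n, Measurable (X n)) (α : ℝ) {k : ℕ} (y : Fin (k + 1) → ℤ)
    (N : ℕ) : Measurable (pathTerm μ X α y N) :=
  Finset.measurable_fun_sum _ fun i _ => (measurable_centredMonomial hX _ i).const_mul _

/-- Paths with too many flat steps do not contribute to the fluctuations. -/
lemma BoundedIID.negligible_pathTerm [IsProbabilityMeasure μ]
    (h : BoundedIID μ X B) {α t : ℝ} (hα : 0 ≤ α) {k : ℕ}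
    {y : Fin (k + 1) → ℤ} (ht0 : 0 ≤ t) (ht1 : t ≤ 1) (hy : t < 2 * ((flats y).card * α)) :
    Negligible μ (growth t) (pathTerm μ X α y) := by
  have hZ := h.finiteRange_centredMonomial (offsets_le y)
  rw [← card_offsets] at hy
  set L := depth y + height y
  refine ⟨fun N => hZ.integrable_sum _ (N - L), ?_⟩
  set D : ℝ := ((L : ℕ) + 1) ^ 2 * (2 * B ^ (offsets y).card) ^ 2
  have h1 := (((tendsto_sum_weight_div_zero ht0 ht1 hy).const_mul D)).sqrt
  rw [mul_zero, Real.sqrt_zero] at h1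
  refine squeeze_zero (fun N => by positivity) (fun N => ?_) h1
  have h2 := hZ.integral_abs_sum_le (fun i => monomialAt (offsets y) fun s => weight α (i + s))
    (N - L)
  calc _ ≤ Real.sqrt (D * ∑ i ∈ Finset.range N, weight (2 * ((offsets y).card * α)) i)
        * |(growth t N)⁻¹| := by
        refine mul_le_mul_of_nonneg_right (h2.trans (Real.sqrt_le_sqrt ?_)) (abs_nonneg _)
        refine mul_le_mul_of_nonneg_left ?_ (by positivity)
        refine (Finset.sum_le_sum fun i _ => sq_monomialAt_weight_le hα _ i).trans ?_
        exact Finset.sum_le_sum_of_subset_of_nonneg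
          (Finset.range_mono (Nat.sub_le _ _)) fun i _ _ => weight_nonneg _ _
    _ = _ := by
        rw [← Real.sqrt_sq_eq_abs, ← Real.sqrt_mul (mul_nonneg (by positivity)
          (Finset.sum_nonneg fun i _ => weight_nonneg _ _)), inv_pow, mul_assoc, ← div_eq_mul_inv]

/-- Up to a bounded error, a path contributes the weighted sum of its monomial, which may be placed
anywhere in the window. -/
lemma BoundedIID.negligible_pathTerm_sub [IsProbabilityMeasure μ]
    (h : BoundedIID μ X B) {α : ℝ} (hα : 0 ≤ α) {k : ℕ}
    (y : Fin (k + 1) → ℤ) {g : ℕ → ℝ} (hg : Tendsto g atTop atTop) {c : ℕ} {O : Multiset ℕ}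
    (hO : (offsets y).map (· + c) = O) :
    Negligible μ g fun N ω => pathTerm μ X α y N ω
      - ∑ i ∈ Finset.range N, weight ((flats y).card * α) i * centredMonomial μ X O i ω := by
  have hZ := h.finiteRange_centredMonomial (offsets_le y)
  have hshift : ∀ i ω, centredMonomial μ X O i ω = centredMonomial μ X (offsets y) (i + c) ω := by
    have h1 : ∀ i ω, monomialAt O (shift X i ω) = monomialAt (offsets y) (shift X (i + c) ω) := by
      intro i ω
      rw [← hO, monomialAt, monomialAt, Multiset.map_map]
      congr 1
      refine Multiset.map_congr rfl fun s _ => ?_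
      simp only [Function.comp, shift]
      congr 1
      omega
    intro i ω
    simp only [centredMonomial, h1]
    rw [h.integral_shift (measurable_monomialAt _) (0 + c)]
  refine Negligible.of_bounded hg (C := 2 * (depth y + height y : ℕ) * (2 * B ^ (offsets y).card)
    + 3 * c * (2 * B ^ (offsets y).card)) (fun N => ?_) fun N ω => ?_
  · exact ((measurable_pathTerm h.meas α y N).sub (Finset.measurable_fun_sum _ fun i _ =>
      (measurable_centredMonomial h.meas O i).const_mul _)).aestronglyMeasurable
  · have h2 := abs_sum_monomialAt_weight_sub_le hα (offsets_le y) (fun i => hZ.bound i ω) N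
    have h3 := abs_sum_weight_shift_le (γ := (offsets y).card * α) (by positivity)
      (fun i => hZ.bound i ω) c N
    simp only [hshift, ← card_offsets, pathTerm]
    rw [abs_le] at *
    constructor <;> linarith

end Stat


/-! ### Sorting paths by shape -/

lemma triple_injective {i i' : ℤ} {s t s' t' : ℕ}
    (h : ({i, i + s, i + s + t} : Multiset ℤ) = {i', i' + s', i' + s' + t'}) :
    s = s' ∧ t = t' := by
  have h1 : ([i, i + s, i + s + t] : List ℤ).Perm [i', i' + s', i' + s' + t'] :=
    Multiset.coe_eq_coe.mp h
  have h2 := h1.eq_of_pairwise (le := (· ≤ ·)) (fun a b _ _ => le_antisymm) (by simp; omega)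
    (by simp; omega)
  simp only [List.cons.injEq] at h2
  omega

lemma pair_injective {i i' : ℤ} {s s' : ℕ} (h : ({i, i + s} : Multiset ℤ) = {i', i' + s'}) :
    s = s' := by
  have h1 : ([i, i + s] : List ℤ).Perm [i', i' + s'] := Multiset.coe_eq_coe.mp h
  have h2 := h1.eq_of_pairwise (le := (· ≤ ·)) (fun a b _ _ => le_antisymm) (by simp) (by simp)
  simp only [List.cons.injEq] at h2
  omega

lemma exists_triple {M : Multiset ℤ} (h : M.card = 3) :
    ∃ (i : ℤ) (s t : ℕ), M = {i, i + s, i + s + t} := by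
  have h1 := Multiset.sort_eq M (· ≤ ·)
  have h2 := Multiset.pairwise_sort M (· ≤ ·)
  have h3 : (M.sort (· ≤ ·)).length = 3 := by rw [Multiset.length_sort, h]
  obtain ⟨a, b, c, hl⟩ := List.length_eq_three.mp h3
  rw [hl] at h1 h2
  simp only [List.pairwise_cons, List.mem_cons, List.not_mem_nil, or_false] at h2
  have hab := h2.1 b (Or.inl rfl)
  have hbc := h2.2.1 c rfl
  refine ⟨a, (b - a).toNat, (c - b).toNat, ?_⟩
  rw [← h1, Int.toNat_of_nonneg (by omega), Int.toNat_of_nonneg (by omega),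
    show a + (b - a) = b by ring, show b + (c - b) = c by ring]
  rfl

lemma exists_pair {M : Multiset ℤ} (h : M.card = 2) : ∃ (i : ℤ) (s : ℕ), M = {i, i + s} := by
  have h1 := Multiset.sort_eq M (· ≤ ·)
  have h2 := Multiset.pairwise_sort M (· ≤ ·)
  have h3 : (M.sort (· ≤ ·)).length = 2 := by rw [Multiset.length_sort, h]
  obtain ⟨a, b, hl⟩ := List.length_eq_two.mp h3
  rw [hl] at h1 h2
  simp only [List.pairwise_cons, List.mem_cons, List.not_mem_nil, or_false] at h2
  have hab := h2.1 b rfl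
  refine ⟨a, (b - a).toNat, ?_⟩
  rw [← h1, Int.toNat_of_nonneg (by omega), show a + (b - a) = b by ring]
  rfl

/-- Splitting a sum according to a relation that selects exactly one label for each element. -/
lemma sum_eq_sum_sum_filter {ι κ : Type*} (S : Finset ι) (T : Finset κ)
    (p : ι → Prop) [DecidablePred p] (q : ι → κ → Prop) [∀ b, DecidablePred fun a => q a b]
    (hex : ∀ a ∈ S, p a → ∃ b ∈ T, q a b) (huniq : ∀ a b b', q a b → q a b' → b = b')
    (hpq : ∀ a b, q a b → p a) (f : ι → ℝ) :
    ∑ a ∈ S.filter p, f a = ∑ b ∈ T, ∑ a ∈ S.filter (fun a => q a b), f a := by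
  simp only [Finset.sum_filter]
  rw [Finset.sum_comm]
  refine Finset.sum_congr rfl fun a ha => ?_
  split_ifs with h
  · obtain ⟨b, hb, hab⟩ := hex a ha h
    rw [Finset.sum_eq_single b]
    · rw [if_pos hab]
    · intro b' _ hb'
      rw [if_neg fun h' => hb' (huniq a b' b h' hab)]
    · exact fun h' => absurd hb h'
  · symm
    exact Finset.sum_eq_zero fun b _ => if_neg fun h' => h (hpq a b h')

open Classical in
lemma sum_three_flats {k m : ℕ} (hk : k ≤ m) (f : (Fin (k + 1) → ℤ) → ℝ) :
    ∑ y ∈ (paths k).filter (fun y => (flats y).card = 3), f y =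
      ∑ s ∈ Finset.range (m + 1), ∑ t ∈ Finset.range (m + 1),
        ∑ y ∈ (paths k).filter (fun y => ∃ i : ℤ, flats y = {i, i + s, i + s + t}), f y := by
  rw [← Finset.sum_product']
  refine sum_eq_sum_sum_filter (paths k) (Finset.range (m + 1) ×ˢ Finset.range (m + 1)) _
    (fun y (p : ℕ × ℕ) => ∃ i : ℤ, flats y = {i, i + p.1, i + p.1 + p.2}) ?_ ?_ ?_ f
  · intro y hy h3
    obtain ⟨i, s, t, hM⟩ := exists_triple h3
    obtain ⟨a, ha⟩ := mem_flats (y := y) (h := i) (by simp [hM])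
    obtain ⟨b, hb⟩ := mem_flats (y := y) (h := i + s + t) (by simp [hM])
    have := two_mul_dist_le hy a b
    refine ⟨(s, t), ?_, i, hM⟩
    rw [Finset.mem_product, Finset.mem_range, Finset.mem_range]
    constructor <;> dsimp only <;> omega
  · rintro y ⟨s, t⟩ ⟨s', t'⟩ ⟨i, hi⟩ ⟨i', hi'⟩
    obtain ⟨h1, h2⟩ := triple_injective (hi.symm.trans hi')
    rw [Prod.mk.injEq]
    exact ⟨h1, h2⟩
  · rintro y ⟨s, t⟩ ⟨i, hi⟩
    simp [hi]

open Classical in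
lemma sum_two_flats {k m : ℕ} (hk : k ≤ m) (f : (Fin (k + 1) → ℤ) → ℝ) :
    ∑ y ∈ (paths k).filter (fun y => (flats y).card = 2), f y =
      ∑ s ∈ Finset.range (m + 1),
        ∑ y ∈ (paths k).filter (fun y => ∃ i : ℤ, flats y = {i, i + s}), f y := by
  refine sum_eq_sum_sum_filter (paths k) (Finset.range (m + 1)) _
    (fun y (s : ℕ) => ∃ i : ℤ, flats y = {i, i + s}) ?_ ?_ ?_ f
  · intro y hy h2
    obtain ⟨i, s, hM⟩ := exists_pair h2
    obtain ⟨a, ha⟩ := mem_flats (y := y) (h := i) (by simp [hM])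
    obtain ⟨b, hb⟩ := mem_flats (y := y) (h := i + s) (by simp [hM])
    have := two_mul_dist_le hy a b
    refine ⟨s, ?_, i, hM⟩
    rw [Finset.mem_range]
    omega
  · rintro y s s' ⟨i, hi⟩ ⟨i', hi'⟩
    exact pair_injective (hi.symm.trans hi')
  · rintro y s ⟨i, hi⟩
    simp [hi]

open Classical in
lemma pathCount_three (k s t : ℕ) : pathCount k (del 0 + del s + del (s + t)) =
    ((paths k).filter fun y => ∃ i : ℤ, flats y = {i, i + s, i + s + t}).card :=
  pathCount_eq fun _ hy => mem_pathSet_three hy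

open Classical in
lemma pathCount_two (k s : ℕ) : pathCount k (del 0 + del s) =
    ((paths k).filter fun y => ∃ i : ℤ, flats y = {i, i + s}).card :=
  pathCount_eq fun _ hy => mem_pathSet_two hy

lemma pathCount_one (k : ℕ) : pathCount k (del 0) =
    ((paths k).filter fun y => (flats y).card = 1).card :=
  pathCount_eq fun _ hy => by rw [mem_pathSet_one hy, Multiset.card_eq_one]

/-! ### Reduction of the statistic to a window function -/

section Reduction

variable {Ω : Type*} {mΩ : MeasurableSpace Ω} {μ : Measure Ω} [IsProbabilityMeasure μ]
  {X : ℕ → Ω → ℝ} {B : ℝ}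

/-- The weighted sum of a centred monomial over all sites. -/
noncomputable def monomialSum (μ : Measure Ω) (X : ℕ → Ω → ℝ) (γ : ℝ) (O : Multiset ℕ) (N : ℕ)
    (ω : Ω) : ℝ :=
  ∑ i ∈ Finset.range N, weight γ i * centredMonomial μ X O i ω

lemma BoundedIID.negligible_sub_of_offsets (h : BoundedIID μ X B) {α : ℝ} (hα : 0 ≤ α) {k : ℕ}
    {g : ℕ → ℝ} (hg : Tendsto g atTop atTop) {O : Multiset ℕ} {j : ℕ}
    (S : Finset (Fin (k + 1) → ℤ))
    (hS : ∀ y ∈ S, (flats y).card = j ∧ ∃ c, (offsets y).map (· + c) = O) :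
    Negligible μ g fun N ω => ∑ y ∈ S, pathTerm μ X α y N ω
      - S.card * monomialSum μ X (j * α) O N ω := by
  have h1 : ∀ N ω, ∑ y ∈ S, pathTerm μ X α y N ω - S.card * monomialSum μ X (j * α) O N ω =
      ∑ y ∈ S, (pathTerm μ X α y N ω - monomialSum μ X (j * α) O N ω) := by
    intro N ω
    rw [Finset.sum_sub_distrib, Finset.sum_const, nsmul_eq_mul]
  simp only [h1]
  refine Negligible.sum fun y hy => ?_
  obtain ⟨hj, c, hc⟩ := hS y hy
  rw [← hj]
  exact h.negligible_pathTerm_sub hα y hg hc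

lemma offset_le_length {k : ℕ} {y : Fin (k + 1) → ℤ} (hy : y ∈ paths k) {a : ℤ}
    (ha : a ∈ flats y) : 0 ≤ a + depth y ∧ a + depth y ≤ k := by
  obtain ⟨t, rfl⟩ := mem_flats ha
  have h1 := neg_depth_le y t
  obtain ⟨b, hb⟩ := exists_eq_neg_depth (mem_paths.mp hy).1
  have := two_mul_dist_le hy b t
  constructor <;> omega

lemma BoundedIID.negligible_one (h : BoundedIID μ X B) {α : ℝ} (hα : 0 ≤ α) {k m : ℕ}
    (hk : k ≤ m) {g : ℕ → ℝ} (hg : Tendsto g atTop atTop) :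
    Negligible μ g fun N ω =>
      ∑ y ∈ (paths k).filter (fun y => (flats y).card = 1), pathTerm μ X α y N ω
        - pathCount k (del 0) * monomialSum μ X α {2 * m + 1} N ω := by
  rw [pathCount_one]
  have := h.negligible_sub_of_offsets hα hg (O := {2 * m + 1}) (j := 1)
    ((paths k).filter fun y => (flats y).card = 1) ?_
  · simpa using this
  · intro y hy
    rw [Finset.mem_filter] at hy
    refine ⟨hy.2, ?_⟩
    obtain ⟨a, ha⟩ := Multiset.card_eq_one.mp hy.2
    have h1 := offset_le_length hy.1 (a := a) (by simp [ha])
    refine ⟨2 * m + 1 - (a + depth y).toNat, ?_⟩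
    simp only [offsets, ha, Multiset.map_singleton, Multiset.singleton_inj]
    omega

lemma BoundedIID.negligible_two (h : BoundedIID μ X B) {α : ℝ} (hα : 0 ≤ α) {k m : ℕ}
    (hk : k ≤ m) {g : ℕ → ℝ} (hg : Tendsto g atTop atTop) :
    Negligible μ g fun N ω =>
      ∑ y ∈ (paths k).filter (fun y => (flats y).card = 2), pathTerm μ X α y N ω
        - ∑ s ∈ Finset.range (m + 1), pathCount k (del 0 + del s)
          * monomialSum μ X (2 * α) {2 * m + 1 - s, 2 * m + 1} N ω := by
  classical
  simp only [sum_two_flats hk, ← Finset.sum_sub_distrib, pathCount_two]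
  refine Negligible.sum fun s hs => ?_
  have := h.negligible_sub_of_offsets hα hg (O := {2 * m + 1 - s, 2 * m + 1}) (j := 2)
    ((paths k).filter fun y => ∃ i : ℤ, flats y = {i, i + s}) ?_
  · simpa using this
  · intro y hy
    rw [Finset.mem_filter] at hy
    obtain ⟨hy, i, hi⟩ := hy
    refine ⟨by simp [hi], ?_⟩
    have h1 := offset_le_length hy (a := i) (by simp [hi])
    have h2 := offset_le_length hy (a := i + s) (by simp [hi])
    refine ⟨2 * m + 1 - (i + s + depth y).toNat, ?_⟩
    rw [offsets, hi]
    simp only [Multiset.insert_eq_cons, Multiset.map_cons, Multiset.map_singleton]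
    congr 1
    · omega
    · rw [Multiset.singleton_inj]
      omega

lemma BoundedIID.negligible_three (h : BoundedIID μ X B) {α : ℝ} (hα : 0 ≤ α) {k m : ℕ}
    (hk : k ≤ m) {g : ℕ → ℝ} (hg : Tendsto g atTop atTop) :
    Negligible μ g fun N ω =>
      ∑ y ∈ (paths k).filter (fun y => (flats y).card = 3), pathTerm μ X α y N ω
        - ∑ s ∈ Finset.range (m + 1), ∑ t ∈ Finset.range (m + 1),
          pathCount k (del 0 + del s + del (s + t)) * monomialSum μ X (3 * α)
            {2 * m + 1 - (s + t), 2 * m + 1 - t, 2 * m + 1} N ω := by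
  classical
  simp only [sum_three_flats hk, ← Finset.sum_sub_distrib, pathCount_three]
  refine Negligible.sum fun s hs => Negligible.sum fun t ht => ?_
  have := h.negligible_sub_of_offsets hα hg
    (O := {2 * m + 1 - (s + t), 2 * m + 1 - t, 2 * m + 1}) (j := 3)
    ((paths k).filter fun y => ∃ i : ℤ, flats y = {i, i + s, i + s + t}) ?_
  · simpa using this
  · intro y hy
    rw [Finset.mem_filter] at hy
    obtain ⟨hy, i, hi⟩ := hy
    refine ⟨by simp [hi], ?_⟩
    have h1 := offset_le_length hy (a := i) (by simp [hi])
    have h2 := offset_le_length hy (a := i + s) (by simp [hi])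
    have h3 := offset_le_length hy (a := i + s + t) (by simp [hi])
    refine ⟨2 * m + 1 - (i + s + t + depth y).toNat, ?_⟩
    rw [offsets, hi]
    simp only [Multiset.insert_eq_cons, Multiset.map_cons, Multiset.map_singleton]
    congr 1
    · omega
    · congr 1
      · omega
      · rw [Multiset.singleton_inj]
        omega

/-- The coefficient of a shape in a polynomial statistic. -/
noncomputable def shapeCoeff (m : ℕ) (P : ℝ[X]) (β : ℤ →₀ ℕ) : ℝ :=
  ∑ k ∈ Finset.range (m + 1), P.coeff k * pathCount k β

/-- The paths with a number of flat steps outside of a given set are negligible if they have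
sufficiently many flat steps. -/
lemma BoundedIID.negligible_rest (h : BoundedIID μ X B) {α t : ℝ} (hα : 0 ≤ α) (ht0 : 0 ≤ t)
    (ht1 : t ≤ 1) {P : ℝ[X]} (m : ℕ) (p : ℕ → Prop) [DecidablePred p]
    (hp : ∀ k, P.coeff k ≠ 0 → ∀ y ∈ paths k, ¬ p (flats y).card →
      (flats y).card = 0 ∨ t < 2 * ((flats y).card * α)) :
    Negligible μ (growth t) fun N ω => ∑ k ∈ Finset.range (m + 1), P.coeff k *
      ∑ y ∈ (paths k).filter (fun y => ¬ p (flats y).card), pathTerm μ X α y N ω := by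
  refine Negligible.sum fun k _ => ?_
  by_cases hk : P.coeff k = 0
  · simp [hk, Negligible.zero]
  · refine (Negligible.sum fun y hy => ?_).const_mul _
    rw [Finset.mem_filter] at hy
    rcases hp k hk y hy.1 hy.2 with h0 | h0
    · refine ⟨fun N => ?_, ?_⟩
      · simp [funext fun ω => pathTerm_eq_zero (μ := μ) (X := X) (α := α) h0 N ω]
      · simp [pathTerm_eq_zero h0]
    · exact h.negligible_pathTerm hα ht0 ht1 h0

lemma BoundedIID.measurable_centredStat (h : BoundedIID μ X B) (α : ℝ) (P : ℝ[X]) (N : ℕ) :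
    Measurable (centredStat μ X α P N) := by
  have : centredStat μ X α P N = fun ω => ∑ k ∈ Finset.range (P.natDegree + 1), P.coeff k *
      ∑ y ∈ paths k, pathTerm μ X α y N ω := funext fun ω => h.centredStat_eq α le_rfl N ω
  rw [this]
  exact Finset.measurable_fun_sum _ fun k _ => (Finset.measurable_fun_sum _ fun y _ =>
    measurable_pathTerm h.meas α y N).const_mul _

/-- The central limit theorem for a statistic that is, up to negligible errors, a weighted sum of a
window function centred given all but its last variable. -/
lemma BoundedIID.gaussianLimit (h : BoundedIID μ X B) {α γ : ℝ} {P : ℝ[X]} {L : ℕ}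
    {F : (ℕ → ℝ) → ℝ} (hF : IsWindow L F) {K : ℝ} (hK : ∀ i ω, |F (shift X i ω)| ≤ K)
    (hc : ∀ i, μ[fun ω => F (shift X i ω) | past X h.meas (i + L)] =ᵐ[μ] 0) (hγ : 0 ≤ γ)
    (hγ1 : 2 * γ ≤ 1)
    (hneg : Negligible μ (growth (2 * γ)) fun N ω => centredStat μ X α P N ω
      - ∑ i ∈ Finset.range N, weight γ i * F (shift X i ω)) :
    GaussianLimit μ X α P (2 * γ) (∫ ω, F (shift X 0 ω) ^ 2 ∂μ) := by
  refine ⟨integral_nonneg fun ω => sq_nonneg _, ?_⟩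
  have heq : ∀ N ω, centredStat μ X α P N ω / growth (2 * γ) N -
      (∑ i ∈ Finset.range N, weight γ i * F (shift X i ω)) / growth (2 * γ) N =
      (centredStat μ X α P N ω - ∑ i ∈ Finset.range N, weight γ i * F (shift X i ω))
        * (growth (2 * γ) N)⁻¹ := by
    intro N ω
    rw [← sub_div, div_eq_mul_inv]
  refine tendstoInDistribution_of_integral_abs_sub (h.tendstoInDistribution hF hK hc hγ hγ1)
    (fun N => ((h.measurable_centredStat α P N).div_const _).aemeasurable) (fun N => ?_) ?_
  · simp only [heq]
    exact (hneg.integrable N).mul_const _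
  · refine hneg.tendsto.congr fun N => ?_
    simp only [heq, abs_mul]
    rw [integral_mul_const]

end Reduction


/-! ### Second moments of window functions -/

/-- A window function that is bounded on sequences bounded by `B`. -/
structure IsBddWindow (B : ℝ) (L : ℕ) (F : (ℕ → ℝ) → ℝ) : Prop extends IsWindow L F where
  bdd : ∃ K, ∀ x : ℕ → ℝ, (∀ s, |x s| ≤ B) → |F x| ≤ K

namespace IsBddWindow

variable {B : ℝ} {L : ℕ} {F G : (ℕ → ℝ) → ℝ}

lemma const (c : ℝ) : IsBddWindow B L fun _ => c :=
  ⟨⟨measurable_const, fun _ _ _ => rfl⟩, |c|, fun _ _ => le_rfl⟩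

lemma coord {s : ℕ} (hs : s ≤ L) : IsBddWindow B L fun x => x s :=
  ⟨⟨measurable_pi_apply s, fun _ _ h => h s hs⟩, B, fun _ h => h s⟩

lemma add (hF : IsBddWindow B L F) (hG : IsBddWindow B L G) :
    IsBddWindow B L fun x => F x + G x := by
  obtain ⟨K, hK⟩ := hF.bdd
  obtain ⟨K', hK'⟩ := hG.bdd
  exact ⟨⟨hF.meas.add hG.meas, fun x y h => by rw [hF.dep x y h, hG.dep x y h]⟩, K + K',
    fun x hx => (abs_add_le _ _).trans (add_le_add (hK x hx) (hK' x hx))⟩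

lemma mul (hF : IsBddWindow B L F) (hG : IsBddWindow B L G) :
    IsBddWindow B L fun x => F x * G x := by
  obtain ⟨K, hK⟩ := hF.bdd
  obtain ⟨K', hK'⟩ := hG.bdd
  refine ⟨⟨hF.meas.mul hG.meas, fun x y h => by rw [hF.dep x y h, hG.dep x y h]⟩, K * K',
    fun x hx => ?_⟩
  rw [abs_mul]
  exact mul_le_mul (hK x hx) (hK' x hx) (abs_nonneg _) ((abs_nonneg _).trans (hK x hx))

lemma const_mul (hF : IsBddWindow B L F) (c : ℝ) : IsBddWindow B L fun x => c * F x :=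
  (const c).mul hF

lemma sub (hF : IsBddWindow B L F) (hG : IsBddWindow B L G) :
    IsBddWindow B L fun x => F x - G x := by
  simpa only [sub_eq_add_neg, neg_one_mul] using hF.add (hG.const_mul (-1))

lemma pow (hF : IsBddWindow B L F) (n : ℕ) : IsBddWindow B L fun x => F x ^ n := by
  induction n with
  | zero => simpa only [pow_zero] using const 1
  | succ n ih => simpa only [pow_succ] using ih.mul hF

lemma sum {ι : Type*} {s : Finset ι} {F : ι → (ℕ → ℝ) → ℝ}
    (hF : ∀ i ∈ s, IsBddWindow B L (F i)) : IsBddWindow B L fun x => ∑ i ∈ s, F i x := by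
  classical
  induction s using Finset.induction_on with
  | empty => simpa only [Finset.sum_empty] using const 0
  | insert j s hj ih =>
    simp only [Finset.sum_insert hj]
    exact (hF j (Finset.mem_insert_self _ _)).add (ih fun i hi => hF i (Finset.mem_insert_of_mem hi))

lemma mono {L' : ℕ} (hF : IsBddWindow B L F) (h : L ≤ L') : IsBddWindow B L' F :=
  ⟨⟨hF.meas, fun x y hxy => hF.dep x y fun s hs => hxy s (hs.trans h)⟩, hF.bdd⟩

end IsBddWindow

section Moments

variable {Ω : Type*} {mΩ : MeasurableSpace Ω} {μ : Measure Ω}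
  {X : ℕ → Ω → ℝ} {B : ℝ} {L : ℕ} {F G : (ℕ → ℝ) → ℝ}

/-- The expectation of a function of the whole sequence. -/
noncomputable def expect (μ : Measure Ω) (X : ℕ → Ω → ℝ) (F : (ℕ → ℝ) → ℝ) : ℝ :=
  ∫ ω, F (shift X 0 ω) ∂μ

lemma BoundedIID.integrable_window [IsProbabilityMeasure μ]
    (h : BoundedIID μ X B) (hF : IsBddWindow B L F) (i : ℕ) :
    Integrable (fun ω => F (shift X i ω)) μ := by
  obtain ⟨K, hK⟩ := hF.bdd
  exact integrable_of_abs_le (hF.meas.comp (measurable_shift h.meas i)).aestronglyMeasurable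
    fun ω => hK _ fun s => h.bound (i + s) ω

lemma BoundedIID.expect_add [IsProbabilityMeasure μ] (h : BoundedIID μ X B) (hF : IsBddWindow B L F)
    (hG : IsBddWindow B L G) :
    expect μ X (fun x => F x + G x) = expect μ X F + expect μ X G :=
  integral_add (h.integrable_window hF 0) (h.integrable_window hG 0)

lemma expect_const_mul (c : ℝ) (F : (ℕ → ℝ) → ℝ) :
    expect μ X (fun x => c * F x) = c * expect μ X F :=
  integral_const_mul _ _

lemma expect_const [IsProbabilityMeasure μ]
    (c : ℝ) : expect μ X (fun _ => c) = c := by simp [expect]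

lemma BoundedIID.expect_sum [IsProbabilityMeasure μ]
    (h : BoundedIID μ X B) {ι : Type*} {s : Finset ι}
    {F : ι → (ℕ → ℝ) → ℝ} (hF : ∀ i ∈ s, IsBddWindow B L (F i)) :
    expect μ X (fun x => ∑ i ∈ s, F i x) = ∑ i ∈ s, expect μ X (F i) :=
  integral_finsetSum _ fun i hi => h.integrable_window (hF i hi) 0

lemma BoundedIID.expect_mul [IsProbabilityMeasure μ]
    (h : BoundedIID μ X B) (hF : IsWindow L F) {n : ℕ} (hn : L < n)
    {φ : ℝ → ℝ} (hφ : Measurable φ) :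
    expect μ X (fun x => F x * φ (x n)) = expect μ X F * expect μ X (fun x => φ (x 0)) := by
  have h1 := h.integral_past_mul (n := 0 + n)
    (hF.measurable_past h.meas (i := 0) (n := 0 + n) (by omega)) hφ
  exact h1

lemma BoundedIID.expect_coord (h : BoundedIID μ X B) (n : ℕ) {φ : ℝ → ℝ} (hφ : Measurable φ) :
    expect μ X (fun x => φ (x n)) = expect μ X (fun x => φ (x 0)) := by
  have h1 := ((h.ident (0 + n)).trans (h.ident (0 + 0)).symm).comp hφ
  exact h1.integral_eq

lemma BoundedIID.expect_mul_coord [IsProbabilityMeasure μ]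
    (h : BoundedIID μ X B) {p q : ℕ} (hpq : p ≠ q)
    {φ ψ : ℝ → ℝ} (hφ : Measurable φ) (hψ : Measurable ψ) :
    expect μ X (fun x => φ (x p) * ψ (x q)) =
      expect μ X (fun x => φ (x 0)) * expect μ X (fun x => ψ (x 0)) := by
  have key : ∀ {p q : ℕ}, p < q → ∀ {φ ψ : ℝ → ℝ}, Measurable φ → Measurable ψ →
      expect μ X (fun x => φ (x p) * ψ (x q)) =
      expect μ X (fun x => φ (x 0)) * expect μ X (fun x => ψ (x 0)) := by
    intro p q hpq φ ψ hφ hψ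
    rw [h.expect_mul (L := p) (F := fun x => φ (x p)) ⟨hφ.comp (measurable_pi_apply p),
      fun x y hxy => by rw [hxy p le_rfl]⟩ hpq hψ, h.expect_coord p hφ]
  rcases hpq.lt_or_gt with h1 | h1
  · exact key h1 hφ hψ
  · rw [mul_comm (expect μ X fun x => φ (x 0)), ← key h1 hψ hφ]
    simp only [mul_comm]

lemma BoundedIID.expect_id (h : BoundedIID μ X B) : expect μ X (fun x => x 0) = 0 := h.mean

lemma BoundedIID.expect_pow [IsProbabilityMeasure μ] (h : BoundedIID μ X B) (n j : ℕ) :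
    expect μ X (fun x => x n ^ j) = mom μ (X 0) j :=
  h.expect_coord n (φ := fun u => u ^ j) (measurable_id.pow_const j)

/-- Products of two distinct variables are uncorrelated with a centred function of one variable. -/
lemma BoundedIID.expect_mul_pair [IsProbabilityMeasure μ]
    (h : BoundedIID μ X B) {a b q : ℕ} (hab : a < b) {φ : ℝ → ℝ}
    (hφ : Measurable φ) (h0 : expect μ X (fun x => φ (x 0)) = 0) :
    expect μ X (fun x => φ (x q) * (x a * x b)) = 0 := by
  rcases lt_trichotomy q b with hq | rfl | hq
  · have hF : IsWindow (max q a) fun x => φ (x q) * x a :=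
      ⟨(hφ.comp (measurable_pi_apply q)).mul (measurable_pi_apply a),
        fun x y hxy => by rw [hxy q (le_max_left _ _), hxy a (le_max_right _ _)]⟩
    have := h.expect_mul hF (n := b) (max_lt hq hab) measurable_id
    simp only [id, h.expect_id, mul_zero] at this
    simpa only [mul_assoc] using this
  · have := h.expect_mul_coord (φ := id) (ψ := fun u => φ u * u) hab.ne measurable_id
      (hφ.mul measurable_id)
    simp only [id, h.expect_id, zero_mul] at this
    rw [← this]
    congr 1
    ext x
    ring
  · have hF : IsWindow b fun x => x a * x b :=
      ⟨(measurable_pi_apply a).mul (measurable_pi_apply b),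
        fun x y hxy => by rw [hxy a hab.le, hxy b le_rfl]⟩
    have := h.expect_mul hF hq hφ
    rw [h0, mul_zero] at this
    simpa only [mul_comm] using this

lemma BoundedIID.expect_pair [IsProbabilityMeasure μ]
    (h : BoundedIID μ X B) {a b : ℕ} (hab : a < b) :
    expect μ X (fun x => x a * x b) = 0 := by
  have := h.expect_mul_coord (φ := id) (ψ := id) hab.ne measurable_id measurable_id
  simpa only [id, h.expect_id, zero_mul] using this

/-- Products of two distinct variables are orthogonal. -/
lemma BoundedIID.expect_pair_mul_pair [IsProbabilityMeasure μ]
    (h : BoundedIID μ X B) {a b c d : ℕ} (hab : a < b)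
    (hcd : c < d) (hne : ¬ (a = c ∧ b = d)) :
    expect μ X (fun x => (x a * x b) * (x c * x d)) = 0 := by
  have key : ∀ {a b c d : ℕ}, a < b → c < d → b < d →
      expect μ X (fun x => (x a * x b) * (x c * x d)) = 0 := by
    intro a b c d hab hcd hbd
    have hF : IsWindow (max b c) fun x => x a * x b * x c :=
      ⟨((measurable_pi_apply a).mul (measurable_pi_apply b)).mul (measurable_pi_apply c),
        fun x y hxy => by rw [hxy a (hab.le.trans (le_max_left _ _)), hxy b (le_max_left _ _),
          hxy c (le_max_right _ _)]⟩
    have := h.expect_mul hF (n := d) (max_lt hbd hcd) measurable_id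
    simp only [id, h.expect_id, mul_zero] at this
    simpa only [mul_assoc] using this
  rcases lt_trichotomy b d with hbd | rfl | hbd
  · exact key hab hcd hbd
  · have hac : a ≠ c := fun h' => hne ⟨h', rfl⟩
    have hF : IsWindow (max a c) fun x => x a * x c :=
      ⟨(measurable_pi_apply a).mul (measurable_pi_apply c),
        fun x y hxy => by rw [hxy a (le_max_left _ _), hxy c (le_max_right _ _)]⟩
    have h1 := h.expect_mul hF (n := b) (max_lt hab hcd) (measurable_id.pow_const 2)
    have h2 := h.expect_mul_coord (φ := id) (ψ := id) hac measurable_id measurable_id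
    simp only [id, h.expect_id, zero_mul] at h1 h2
    rw [h2, zero_mul] at h1
    rw [← h1]
    congr 1
    ext x
    ring
  · rw [← key hcd hab hbd]
    simp only [mul_comm]

lemma BoundedIID.expect_pair_sq [IsProbabilityMeasure μ]
    (h : BoundedIID μ X B) {a b : ℕ} (hab : a < b) :
    expect μ X (fun x => (x a * x b) * (x a * x b)) = mom μ (X 0) 2 ^ 2 := by
  have h1 := h.expect_mul_coord (φ := fun u => u ^ 2) (ψ := fun u => u ^ 2) hab.ne
    (measurable_id.pow_const 2) (measurable_id.pow_const 2)
  rw [h.expect_pow 0 2, ← sq] at h1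
  rw [← h1]
  congr 1
  ext x
  ring

/-- The expectation of a product of two combinations of biorthogonal functions. -/
lemma BoundedIID.expect_sum_mul_sum [IsProbabilityMeasure μ]
    (h : BoundedIID μ X B) {ι : Type*} (s : Finset ι) (c d : ι → ℝ)
    {e e' : ι → (ℕ → ℝ) → ℝ} (he : ∀ i ∈ s, IsBddWindow B L (e i))
    (he' : ∀ i ∈ s, IsBddWindow B L (e' i))
    (horth : ∀ i ∈ s, ∀ j ∈ s, i ≠ j → expect μ X (fun x => e i x * e' j x) = 0) :
    expect μ X (fun x => (∑ i ∈ s, c i * e i x) * ∑ j ∈ s, d j * e' j x) =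
      ∑ i ∈ s, c i * d i * expect μ X (fun x => e i x * e' i x) := by
  have h1 : ∀ i ∈ s, ∀ j ∈ s, IsBddWindow B L fun x => c i * d j * (e i x * e' j x) :=
    fun i hi j hj => ((he i hi).mul (he' j hj)).const_mul _
  have h2 : (fun x => (∑ i ∈ s, c i * e i x) * ∑ j ∈ s, d j * e' j x) =
      fun x => ∑ i ∈ s, ∑ j ∈ s, c i * d j * (e i x * e' j x) := by
    ext x
    rw [Finset.sum_mul_sum]
    refine Finset.sum_congr rfl fun i _ => Finset.sum_congr rfl fun j _ => ?_
    ring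
  rw [h2, h.expect_sum fun i hi => IsBddWindow.sum (h1 i hi)]
  refine Finset.sum_congr rfl fun i hi => ?_
  rw [h.expect_sum (h1 i hi), Finset.sum_eq_single i]
  · exact expect_const_mul _ _
  · intro j hj hji
    rw [expect_const_mul, horth i hi j hj hji.symm, mul_zero]
  · exact fun h' => absurd hi h'

/-- Window functions that are centred given all but the last variable: combinations of the centred
powers of the last variable `x_n` with coefficients that depend on the previous ones. -/
noncomputable def lastCentred (μ : Measure Ω) (X : ℕ → Ω → ℝ) (n : ℕ) (a : ℝ) (R T : (ℕ → ℝ) → ℝ)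
    (x : ℕ → ℝ) : ℝ :=
  a * (x n ^ 3 - mom μ (X 0) 3) + R x * x n + T x * (x n ^ 2 - mom μ (X 0) 2)

lemma isBddWindow_lastCentred (a : ℝ) {R T : (ℕ → ℝ) → ℝ} (hR : IsBddWindow B L R)
    (hT : IsBddWindow B L T) : IsBddWindow B (L + 1) (lastCentred μ X (L + 1) a R T) :=
  (((((IsBddWindow.coord le_rfl).pow 3).sub (IsBddWindow.const _)).const_mul a).add
    ((hR.mono (Nat.le_succ L)).mul (IsBddWindow.coord le_rfl))).add
    ((hT.mono (Nat.le_succ L)).mul (((IsBddWindow.coord le_rfl).pow 2).sub (IsBddWindow.const _)))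

lemma BoundedIID.expect_pow_sub [IsProbabilityMeasure μ] (h : BoundedIID μ X B) (n j : ℕ) :
    expect μ X (fun x => x n ^ j - mom μ (X 0) j) = 0 := by
  have hw : IsBddWindow B n fun x : ℕ → ℝ => x n ^ j := (IsBddWindow.coord le_rfl).pow j
  simp only [sub_eq_add_neg]
  rw [h.expect_add hw (IsBddWindow.const _), h.expect_pow, expect_const, add_neg_cancel]

lemma BoundedIID.condExp_lastCentred [IsProbabilityMeasure μ]
    (h : BoundedIID μ X B) (a : ℝ) {R T : (ℕ → ℝ) → ℝ}
    (hR : IsBddWindow B L R) (hT : IsBddWindow B L T) (i : ℕ) :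
    μ[fun ω => lastCentred μ X (L + 1) a R T (shift X i ω) | past X h.meas (i + (L + 1))]
      =ᵐ[μ] 0 := by
  have key : ∀ (G : (ℕ → ℝ) → ℝ) (φ : ℝ → ℝ), IsBddWindow B L G → Measurable φ →
      (∃ D, ∀ u, |u| ≤ B → |φ u| ≤ D) → ∫ ω, φ (X 0 ω) ∂μ = 0 →
      Integrable (fun ω => G (shift X i ω) * φ (X (i + (L + 1)) ω)) μ ∧
      μ[fun ω => G (shift X i ω) * φ (X (i + (L + 1)) ω) | past X h.meas (i + (L + 1))]
        =ᵐ[μ] 0 := by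
    intro G φ hG hφ ⟨D, hD⟩ h0
    obtain ⟨C, hC⟩ := hG.bdd
    have hGm := hG.measurable_past h.meas (i := i) (n := i + (L + 1)) (by omega)
    refine ⟨integrable_of_abs_le (C := C * D) ((hGm.mono ((past X h.meas).le _)).mul
      (hφ.comp (h.meas _)).stronglyMeasurable).aestronglyMeasurable fun ω => ?_,
      h.condExp_past_mul hGm (C := C) (fun ω => hC _ fun s => h.bound (i + s) ω) hφ (D := D)
        (fun ω => hD _ (h.bound _ ω)) h0⟩
    rw [abs_mul]
    exact mul_le_mul (hC _ fun s => h.bound (i + s) ω) (hD _ (h.bound _ ω)) (abs_nonneg _)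
      ((abs_nonneg _).trans (hC _ fun s => h.bound (i + s) ω))
  have hpow : ∀ (j : ℕ) (c : ℝ), ∃ D, ∀ u : ℝ, |u| ≤ B → |u ^ j - c| ≤ D := fun j c =>
    ⟨B ^ j + |c|, fun u hu => (abs_sub _ _).trans (add_le_add (by
      rw [abs_pow]
      exact pow_le_pow_left₀ (abs_nonneg _) hu j) le_rfl)⟩
  obtain ⟨i1, c1⟩ := key (fun _ => a) (fun u => u ^ 3 - mom μ (X 0) 3) (IsBddWindow.const a)
    ((measurable_id.pow_const 3).sub_const _) (hpow 3 _) (h.expect_pow_sub 0 3)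
  obtain ⟨i2, c2⟩ := key R id hR measurable_id ⟨B, fun u hu => hu⟩ h.mean
  obtain ⟨i3, c3⟩ := key T (fun u => u ^ 2 - mom μ (X 0) 2) hT
    ((measurable_id.pow_const 2).sub_const _) (hpow 2 _) (h.expect_pow_sub 0 2)
  have e1 := condExp_add (i1.add i2) i3 (past X h.meas (i + (L + 1)))
  have e2 := condExp_add i1 i2 (past X h.meas (i + (L + 1)))
  refine e1.trans ?_
  filter_upwards [e2, c1, c2, c3] with ω h1 h2 h3 h4
  rw [Pi.add_apply, h1, Pi.add_apply, h2, h3, h4]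
  simp

/-- The expectation of a polynomial in a single variable. -/
lemma BoundedIID.expect_poly [IsProbabilityMeasure μ]
    (h : BoundedIID μ X B) (c1 c2 c3 c4 c5 c6 c0 : ℝ) :
    expect μ X (fun x => c6 * x 0 ^ 6 + c5 * x 0 ^ 5
      + c4 * x 0 ^ 4 + c3 * x 0 ^ 3 + c2 * x 0 ^ 2 + c1 * x 0 ^ 1 + c0) =
      c6 * mom μ (X 0) 6 + c5 * mom μ (X 0) 5 + c4 * mom μ (X 0) 4 + c3 * mom μ (X 0) 3
        + c2 * mom μ (X 0) 2 + c0 := by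
  have hw : ∀ (c : ℝ) (j : ℕ), IsBddWindow B 0 fun x : ℕ → ℝ => c * x 0 ^ j := fun c j =>
    ((IsBddWindow.coord le_rfl).pow j).const_mul c
  have he : ∀ (c : ℝ) (j : ℕ), expect μ X (fun x : ℕ → ℝ => c * x 0 ^ j) =
      c * mom μ (X 0) j := fun c j => by rw [expect_const_mul, h.expect_pow]
  have h1 : mom μ (X 0) 1 = 0 := by simpa [mom] using h.mean
  rw [h.expect_add ((((((hw _ _).add (hw _ _)).add (hw _ _)).add (hw _ _)).add (hw _ _)).add
      (hw _ _)) (IsBddWindow.const c0),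
    h.expect_add (((((hw _ _).add (hw _ _)).add (hw _ _)).add (hw _ _)).add (hw _ _)) (hw _ _),
    h.expect_add ((((hw _ _).add (hw _ _)).add (hw _ _)).add (hw _ _)) (hw _ _),
    h.expect_add (((hw _ _).add (hw _ _)).add (hw _ _)) (hw _ _),
    h.expect_add ((hw _ _).add (hw _ _)) (hw _ _), h.expect_add (hw _ _) (hw _ _),
    expect_const]
  simp only [he, h1]
  ring

lemma BoundedIID.expect_lastCentred_sq [IsProbabilityMeasure μ]
    (h : BoundedIID μ X B) (a : ℝ) {R T : (ℕ → ℝ) → ℝ}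
    (hR : IsBddWindow B L R) (hT : IsBddWindow B L T) :
    expect μ X (fun x => lastCentred μ X (L + 1) a R T x ^ 2) =
      a ^ 2 * (mom μ (X 0) 6 - mom μ (X 0) 3 ^ 2) + expect μ X (fun x => R x * R x) * mom μ (X 0) 2
      + expect μ X (fun x => T x * T x) * (mom μ (X 0) 4 - mom μ (X 0) 2 ^ 2)
      + 2 * a * expect μ X R * mom μ (X 0) 4
      + 2 * a * expect μ X T * (mom μ (X 0) 5 - mom μ (X 0) 3 * mom μ (X 0) 2)
      + 2 * expect μ X (fun x => R x * T x) * mom μ (X 0) 3 := by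
  have key : ∀ (G : (ℕ → ℝ) → ℝ) (φ : ℝ → ℝ), IsBddWindow B L G → Measurable φ →
      expect μ X (fun x => G x * φ (x (L + 1))) = expect μ X G * expect μ X (fun x => φ (x 0)) :=
    fun G φ hG hφ => h.expect_mul hG.toIsWindow (Nat.lt_succ_self L) hφ
  have hlast : IsBddWindow B (L + 1) fun x : ℕ → ℝ => x (L + 1) := IsBddWindow.coord le_rfl
  have wc := fun (c : ℝ) (j : ℕ) => (hlast.pow j).sub (IsBddWindow.const c)
  have wR := hR.mono (Nat.le_succ L)
  have wT := hT.mono (Nat.le_succ L)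
  have hexp : (fun x => lastCentred μ X (L + 1) a R T x ^ 2) = fun x =>
      a ^ 2 * (x (L + 1) ^ 3 - mom μ (X 0) 3) ^ 2
      + (R x * R x) * (x (L + 1) ^ 2)
      + (T x * T x) * ((x (L + 1) ^ 2 - mom μ (X 0) 2) ^ 2)
      + (2 * a * R x) * ((x (L + 1) ^ 3 - mom μ (X 0) 3) * x (L + 1))
      + (2 * a * T x) * ((x (L + 1) ^ 3 - mom μ (X 0) 3) * (x (L + 1) ^ 2 - mom μ (X 0) 2))
      + (2 * (R x * T x)) * (x (L + 1) * (x (L + 1) ^ 2 - mom μ (X 0) 2)) := by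
    ext x
    rw [lastCentred]
    ring
  have w1 : IsBddWindow B (L + 1) fun x => a ^ 2 * (x (L + 1) ^ 3 - mom μ (X 0) 3) ^ 2 :=
    ((wc _ 3).pow 2).const_mul _
  have w2 : IsBddWindow B (L + 1) fun x => (R x * R x) * (x (L + 1) ^ 2) :=
    (wR.mul wR).mul (hlast.pow 2)
  have w3 : IsBddWindow B (L + 1) fun x =>
      (T x * T x) * ((x (L + 1) ^ 2 - mom μ (X 0) 2) ^ 2) := (wT.mul wT).mul ((wc _ 2).pow 2)
  have w4 : IsBddWindow B (L + 1) fun x =>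
      (2 * a * R x) * ((x (L + 1) ^ 3 - mom μ (X 0) 3) * x (L + 1)) :=
    (wR.const_mul _).mul ((wc _ 3).mul hlast)
  have w5 : IsBddWindow B (L + 1) fun x =>
      (2 * a * T x) * ((x (L + 1) ^ 3 - mom μ (X 0) 3) * (x (L + 1) ^ 2 - mom μ (X 0) 2)) :=
    (wT.const_mul _).mul ((wc _ 3).mul (wc _ 2))
  have w6 : IsBddWindow B (L + 1) fun x =>
      (2 * (R x * T x)) * (x (L + 1) * (x (L + 1) ^ 2 - mom μ (X 0) 2)) :=
    ((wR.mul wT).const_mul _).mul (hlast.mul (wc _ 2))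
  have m3 : Measurable fun u : ℝ => u ^ 3 - mom μ (X 0) 3 :=
    (measurable_id.pow_const 3).sub_const _
  have m2 : Measurable fun u : ℝ => u ^ 2 - mom μ (X 0) 2 :=
    (measurable_id.pow_const 2).sub_const _
  have p1 := key (fun _ => a ^ 2) (fun u => (u ^ 3 - mom μ (X 0) 3) ^ 2) (IsBddWindow.const _)
    (m3.pow_const 2)
  have p2 := key (fun x => R x * R x) (fun u => u ^ 2) (hR.mul hR) (measurable_id.pow_const 2)
  have p3 := key (fun x => T x * T x) (fun u => (u ^ 2 - mom μ (X 0) 2) ^ 2) (hT.mul hT)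
    (m2.pow_const 2)
  have p4 := key (fun x => 2 * a * R x) (fun u => (u ^ 3 - mom μ (X 0) 3) * u) (hR.const_mul _)
    (m3.mul measurable_id)
  have p5 := key (fun x => 2 * a * T x) (fun u => (u ^ 3 - mom μ (X 0) 3)
    * (u ^ 2 - mom μ (X 0) 2)) (hT.const_mul _) (m3.mul m2)
  have p6 := key (fun x => 2 * (R x * T x)) (fun u => u * (u ^ 2 - mom μ (X 0) 2))
    ((hR.mul hT).const_mul _) (measurable_id.mul m2)
  have q1 : expect μ X (fun x => (x 0 ^ 3 - mom μ (X 0) 3) ^ 2) =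
      mom μ (X 0) 6 - mom μ (X 0) 3 ^ 2 := by
    have := h.expect_poly 0 0 (-2 * mom μ (X 0) 3) 0 0 1 (mom μ (X 0) 3 ^ 2)
    convert this using 1
    · congr 1
      ext x
      ring
    · ring
  have q3 : expect μ X (fun x => (x 0 ^ 2 - mom μ (X 0) 2) ^ 2) =
      mom μ (X 0) 4 - mom μ (X 0) 2 ^ 2 := by
    have := h.expect_poly 0 (-2 * mom μ (X 0) 2) 0 1 0 0 (mom μ (X 0) 2 ^ 2)
    convert this using 1
    · congr 1
      ext x
      ring
    · ring
  have q4 : expect μ X (fun x => (x 0 ^ 3 - mom μ (X 0) 3) * x 0) = mom μ (X 0) 4 := by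
    have := h.expect_poly (-mom μ (X 0) 3) 0 0 1 0 0 0
    convert this using 1
    · congr 1
      ext x
      ring
    · ring
  have q5 : expect μ X (fun x => (x 0 ^ 3 - mom μ (X 0) 3) * (x 0 ^ 2 - mom μ (X 0) 2)) =
      mom μ (X 0) 5 - mom μ (X 0) 3 * mom μ (X 0) 2 := by
    have := h.expect_poly 0 (-mom μ (X 0) 3) (-mom μ (X 0) 2) 0 1 0 (mom μ (X 0) 3 * mom μ (X 0) 2)
    convert this using 1
    · congr 1
      ext x
      ring
    · ring
  have q6 : expect μ X (fun x => x 0 * (x 0 ^ 2 - mom μ (X 0) 2)) = mom μ (X 0) 3 := by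
    have := h.expect_poly (-mom μ (X 0) 2) 0 1 0 0 0 0
    convert this using 1
    · congr 1
      ext x
      ring
    · ring
  rw [hexp, h.expect_add ((((w1.add w2).add w3).add w4).add w5) w6,
    h.expect_add (((w1.add w2).add w3).add w4) w5, h.expect_add ((w1.add w2).add w3) w4,
    h.expect_add (w1.add w2) w3, h.expect_add w1 w2, p1, p2, p3, p4, p5, p6, q1, q3, q4, q5, q6,
    h.expect_pow 0 2, expect_const, expect_const_mul, expect_const_mul, expect_const_mul]

end Moments


section Limits

variable {Ω : Type*} {mΩ : MeasurableSpace Ω} {μ : Measure Ω}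
  {X : ℕ → Ω → ℝ} {B : ℝ}

/-! ### The three central limit theorems -/

/-- The decomposition of the statistic according to the number of flat steps of the paths. -/
lemma BoundedIID.negligible_centredStat_sub [IsProbabilityMeasure μ]
    (h : BoundedIID μ X B) {α t : ℝ} (hα : 0 ≤ α)
    (ht0 : 0 ≤ t) (ht1 : t ≤ 1) {P : ℝ[X]} {m : ℕ} (hP : P.natDegree ≤ m) (p : ℕ → Prop)
    [DecidablePred p] (hp : ∀ k, P.coeff k ≠ 0 → ∀ y ∈ paths k, ¬ p (flats y).card →
      (flats y).card = 0 ∨ t < 2 * ((flats y).card * α)) {V : ℕ → ℕ → Ω → ℝ}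
    (hV : ∀ k ≤ m, Negligible μ (growth t) fun N ω =>
      ∑ y ∈ (paths k).filter (fun y => p (flats y).card), pathTerm μ X α y N ω - V k N ω) :
    Negligible μ (growth t) fun N ω => centredStat μ X α P N ω
      - ∑ k ∈ Finset.range (m + 1), P.coeff k * V k N ω := by
  have h1 : ∀ N ω, centredStat μ X α P N ω - ∑ k ∈ Finset.range (m + 1), P.coeff k * V k N ω =
      ∑ k ∈ Finset.range (m + 1), P.coeff k *
        (∑ y ∈ (paths k).filter (fun y => p (flats y).card), pathTerm μ X α y N ω - V k N ω)
      + ∑ k ∈ Finset.range (m + 1), P.coeff k *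
        ∑ y ∈ (paths k).filter (fun y => ¬ p (flats y).card), pathTerm μ X α y N ω := by
    intro N ω
    rw [h.centredStat_eq α hP, ← Finset.sum_sub_distrib, ← Finset.sum_add_distrib]
    refine Finset.sum_congr rfl fun k _ => ?_
    rw [← Finset.sum_filter_add_sum_filter_not (paths k) (fun y => p (flats y).card)]
    ring
  simp only [h1]
  exact (Negligible.sum fun k hk => (hV k (Nat.lt_succ_iff.mp (Finset.mem_range.mp hk))).const_mul _).add
    (h.negligible_rest hα ht0 ht1 m p hp)

/-- A window function centred given all but its last variable yields martingale differences, so a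
statistic that is a weighted sum of its shifts up to a negligible error is asymptotically
Gaussian. -/
lemma BoundedIID.gaussianLimit_lastCentred [IsProbabilityMeasure μ]
    (h : BoundedIID μ X B) {α γ : ℝ} {P : ℝ[X]} {L : ℕ}
    {a : ℝ} {R T : (ℕ → ℝ) → ℝ} (hR : IsBddWindow B L R) (hT : IsBddWindow B L T) (hγ : 0 ≤ γ)
    (hγ1 : 2 * γ ≤ 1)
    (hneg : Negligible μ (growth (2 * γ)) fun N ω => centredStat μ X α P N ω
      - ∑ i ∈ Finset.range N, weight γ i * lastCentred μ X (L + 1) a R T (shift X i ω)) :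
    GaussianLimit μ X α P (2 * γ) (expect μ X fun x => lastCentred μ X (L + 1) a R T x ^ 2) := by
  have hw := isBddWindow_lastCentred (μ := μ) (X := X) a hR hT
  obtain ⟨K, hK⟩ := hw.bdd
  exact h.gaussianLimit hw.toIsWindow (fun i ω => hK _ fun s => h.bound (i + s) ω)
    (h.condExp_lastCentred a hR hT) hγ hγ1 hneg

lemma centredMonomial_eq (O : Multiset ℕ) (i : ℕ) (ω : Ω) :
    centredMonomial μ X O i ω = monomialAt O (shift X i ω) - expect μ X (monomialAt O) := rfl

lemma BoundedIID.centredMonomial_singleton [IsProbabilityMeasure μ]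
    (h : BoundedIID μ X B) (n i : ℕ) (ω : Ω) :
    centredMonomial μ X {n} i ω = shift X i ω n := by
  rw [centredMonomial, h.integral_singleton, sub_zero, monomialAt_singleton]

/-- The fluctuations of any polynomial are governed by the paths with a single flat step. -/
theorem BoundedIID.gaussianLimit_one [IsProbabilityMeasure μ]
    (h : BoundedIID μ X B) {α : ℝ} (hα : 0 < α)
    (hα1 : 2 * α ≤ 1) {P : ℝ[X]} {m : ℕ} (hP : P.natDegree ≤ m) :
    GaussianLimit μ X α P (2 * α) (shapeCoeff m P (del 0) ^ 2 * mom μ (X 0) 2) := by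
  have hR : IsBddWindow B (2 * m) fun _ => shapeCoeff m P (del 0) := IsBddWindow.const _
  have hT : IsBddWindow B (2 * m) fun _ => (0 : ℝ) := IsBddWindow.const _
  have hv := h.expect_lastCentred_sq 0 hR hT
  simp only [expect_const] at hv
  have hlim := h.gaussianLimit_lastCentred (α := α) (P := P) (a := 0) hR hT hα.le hα1 ?_
  · rw [hv] at hlim
    convert hlim using 1
    ring
  · have hneg := h.negligible_centredStat_sub hα.le (t := 2 * α) (by linarith) hα1 hP (· = 1)
      (fun k _ y _ hy => ?_)
      (fun k hk => h.negligible_one hα.le hk (tendsto_growth hα1))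
    · refine hneg.congr fun N ω => ?_
      congr 1
      simp only [monomialSum, h.centredMonomial_singleton, lastCentred, shapeCoeff, ← mul_assoc]
      rw [← Finset.sum_mul, Finset.mul_sum]
      refine Finset.sum_congr rfl fun i _ => ?_
      ring
    · rcases Nat.lt_or_ge (flats y).card 1 with h0 | h0
      · exact Or.inl (by omega)
      · have : (2 : ℝ) ≤ (flats y).card := by exact_mod_cast (by omega : 2 ≤ (flats y).card)
        exact Or.inr (by nlinarith)

lemma monomialAt_pair (a b : ℕ) (x : ℕ → ℝ) : monomialAt {a, b} x = x a * x b := by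
  simp [monomialAt]

lemma monomialAt_triple (a b c : ℕ) (x : ℕ → ℝ) :
    monomialAt {a, b, c} x = x a * x b * x c := by
  simp [monomialAt, mul_assoc]

/-- For even polynomials every closed path has an even number of flat steps, so that the paths with
two flat steps govern the fluctuations. -/
theorem BoundedIID.gaussianLimit_two [IsProbabilityMeasure μ]
    (h : BoundedIID μ X B) {α : ℝ} (hα : 0 < α)
    (hα1 : 4 * α ≤ 1) {P : ℝ[X]} {m : ℕ} (hP : P.natDegree ≤ m)
    (heven : ∀ k, Odd k → P.coeff k = 0) :
    GaussianLimit μ X α P (4 * α)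
      (shapeCoeff m P (del 0 + del 0) ^ 2 * (mom μ (X 0) 4 - mom μ (X 0) 2 ^ 2)
        + (∑ s ∈ Finset.range m, shapeCoeff m P (del 0 + del (s + 1)) ^ 2)
          * mom μ (X 0) 2 ^ 2) := by
  set E : ℕ → ℝ := fun s => shapeCoeff m P (del 0 + del s) with hE
  have hR : IsBddWindow B (2 * m) fun x => ∑ s ∈ Finset.range m, E (s + 1) * x (2 * m - s) :=
    IsBddWindow.sum fun s _ => (IsBddWindow.coord (Nat.sub_le _ _)).const_mul _
  have hT : IsBddWindow B (2 * m) fun _ => E 0 := IsBddWindow.const _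
  have hv := h.expect_lastCentred_sq 0 hR hT
  have hcoord : ∀ s ∈ Finset.range m, IsBddWindow B (2 * m) fun x => x (2 * m - s) :=
    fun s _ => IsBddWindow.coord (Nat.sub_le _ _)
  have hRR : expect μ X (fun x => (∑ s ∈ Finset.range m, E (s + 1) * x (2 * m - s))
      * ∑ s ∈ Finset.range m, E (s + 1) * x (2 * m - s)) =
      (∑ s ∈ Finset.range m, E (s + 1) ^ 2) * mom μ (X 0) 2 := by
    rw [h.expect_sum_mul_sum (Finset.range m) (fun s => E (s + 1)) (fun s => E (s + 1)) hcoord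
      hcoord, Finset.sum_mul]
    · refine Finset.sum_congr rfl fun s _ => ?_
      simp only [← sq]
      rw [h.expect_pow]
    · intro i hi j hj hij
      rw [Finset.mem_range] at hi hj
      have := h.expect_mul_coord (p := 2 * m - i) (q := 2 * m - j) (φ := id) (ψ := id) (by omega)
        measurable_id measurable_id
      simpa only [id, h.expect_id, zero_mul] using this
  have hRE : expect μ X (fun x => ∑ s ∈ Finset.range m, E (s + 1) * x (2 * m - s)) = 0 := by
    rw [h.expect_sum fun s hs => (hcoord s hs).const_mul _]
    refine Finset.sum_eq_zero fun s _ => ?_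
    have h0 := h.expect_coord (2 * m - s) (φ := id) measurable_id
    simp only [id, h.expect_id] at h0
    rw [expect_const_mul, h0, mul_zero]
  have hRT : expect μ X (fun x => (∑ s ∈ Finset.range m, E (s + 1) * x (2 * m - s)) * E 0) = 0 := by
    have := expect_const_mul (μ := μ) (X := X) (E 0)
      (fun x => ∑ s ∈ Finset.range m, E (s + 1) * x (2 * m - s))
    rw [hRE, mul_zero] at this
    simpa only [mul_comm] using this
  rw [hRR, hRE, hRT, expect_const] at hv
  have hγ1 : 2 * (2 * α) ≤ 1 := by linarith
  have hlim := h.gaussianLimit_lastCentred (α := α) (P := P) (a := 0) hR hT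
    (γ := 2 * α) (by linarith) hγ1 ?_
  · rw [hv] at hlim
    convert hlim using 1
    · ring
    · ring
  · have hneg := h.negligible_centredStat_sub hα.le (t := 2 * (2 * α)) (by linarith) hγ1 hP (· = 2)
      (fun k hk y hy hy2 => ?_)
      (fun k hk => h.negligible_two hα.le hk (tendsto_growth hγ1))
    · refine hneg.congr fun N ω => ?_
      congr 1
      have h1 : ∀ s i ω, s < m → centredMonomial μ X {2 * m + 1 - (s + 1), 2 * m + 1} i ω =
          shift X i ω (2 * m - s) * shift X i ω (2 * m + 1) := by
        intro s i ω hs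
        rw [centredMonomial_eq, monomialAt_pair, show 2 * m + 1 - (s + 1) = 2 * m - s by omega]
        simp only [funext (monomialAt_pair _ _)]
        rw [h.expect_pair (by omega), sub_zero]
      have h2 : ∀ i ω, centredMonomial μ X {2 * m + 1 - 0, 2 * m + 1} i ω =
          shift X i ω (2 * m + 1) ^ 2 - mom μ (X 0) 2 := by
        intro i ω
        rw [centredMonomial_eq, Nat.sub_zero]
        simp only [funext (monomialAt_pair _ _), ← sq]
        rw [h.expect_pow]
      have h3 : ∑ k ∈ Finset.range (m + 1), P.coeff k * ∑ s ∈ Finset.range (m + 1),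
          pathCount k (del 0 + del s) * monomialSum μ X (2 * α) {2 * m + 1 - s, 2 * m + 1} N ω =
          ∑ s ∈ Finset.range (m + 1), E s *
            monomialSum μ X (2 * α) {2 * m + 1 - s, 2 * m + 1} N ω := by
        simp only [Finset.mul_sum, hE, shapeCoeff, Finset.sum_mul]
        rw [Finset.sum_comm]
        simp only [mul_assoc]
      rw [h3]
      simp only [monomialSum, Finset.mul_sum]
      rw [Finset.sum_comm]
      refine Finset.sum_congr rfl fun i _ => ?_
      rw [Finset.sum_range_succ', h2]
      simp only [lastCentred]
      rw [Finset.sum_congr rfl fun s hs => by rw [h1 s i ω (Finset.mem_range.mp hs)],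
        Finset.sum_mul]
      rw [mul_add, mul_add, Finset.mul_sum]
      have h4 : ∀ s, E (s + 1) * (weight (2 * α) i * (shift X i ω (2 * m - s)
          * shift X i ω (2 * m + 1))) = weight (2 * α) i * (E (s + 1) * shift X i ω (2 * m - s)
          * shift X i ω (2 * m + 1)) := fun s => by ring
      simp only [h4]
      ring
    · have hk' : Even k := by
        rw [← Nat.not_odd_iff_even]
        exact fun ho => hk (heven k ho)
      have hpar := even_sub_card_flats hy
      rw [Int.even_sub, Int.even_coe_nat, Int.even_coe_nat] at hpar
      obtain ⟨c, hc⟩ := hpar.mp hk'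
      rcases Nat.eq_zero_or_pos c with h0 | h0
      · exact Or.inl (by omega)
      · have : (4 : ℝ) ≤ (flats y).card := by exact_mod_cast (by omega : 4 ≤ (flats y).card)
        exact Or.inr (by nlinarith)

end Limits


/-! ### The second moment for paths with three flat steps -/

section ThreeFlats

variable {Ω : Type*} {mΩ : MeasurableSpace Ω} {μ : Measure Ω} [IsProbabilityMeasure μ]
  {X : ℕ → Ω → ℝ} {B : ℝ} {L : ℕ}

lemma BoundedIID.expect_mul_sum (h : BoundedIID μ X B) {ι : Type*} (s : Finset ι) (d : ι → ℝ)
    {F : (ℕ → ℝ) → ℝ} {e : ι → (ℕ → ℝ) → ℝ} (hF : IsBddWindow B L F)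
    (he : ∀ i ∈ s, IsBddWindow B L (e i)) :
    expect μ X (fun x => F x * ∑ i ∈ s, d i * e i x) =
      ∑ i ∈ s, d i * expect μ X (fun x => F x * e i x) := by
  have h1 : (fun x => F x * ∑ i ∈ s, d i * e i x) =
      fun x => ∑ i ∈ s, d i * (F x * e i x) := by
    ext x
    rw [Finset.mul_sum]
    exact Finset.sum_congr rfl fun i _ => by ring
  rw [h1, h.expect_sum fun i hi => (hF.mul (he i hi)).const_mul _]
  simp only [expect_const_mul]

/-- The second moment of the window function that governs the fluctuations of odd polynomials
orthogonal to `Q_m`. -/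
lemma BoundedIID.expect_lastCentred_sq_of_three (h : BoundedIID μ X B) (m : ℕ) (a : ℝ)
    (b c : ℕ → ℝ) (d : ℕ → ℕ → ℝ) (ρ : ℝ) :
    expect μ X (fun x => lastCentred μ X (2 * m + 1) a
      (fun x => ρ + (∑ t ∈ Finset.range m, b t * (x (2 * m - t) ^ 2 - mom μ (X 0) 2)
        + ∑ p ∈ Finset.range m ×ˢ Finset.range m,
          d p.1 p.2 * (x (2 * m - (p.1 + p.2 + 1)) * x (2 * m - p.2))))
      (fun x => ∑ s ∈ Finset.range m, c s * x (2 * m - s)) x ^ 2) =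
      a ^ 2 * (mom μ (X 0) 6 - mom μ (X 0) 3 ^ 2)
      + (ρ ^ 2 + (∑ t ∈ Finset.range m, b t ^ 2) * (mom μ (X 0) 4 - mom μ (X 0) 2 ^ 2)
        + (∑ p ∈ Finset.range m ×ˢ Finset.range m, d p.1 p.2 ^ 2) * mom μ (X 0) 2 ^ 2)
          * mom μ (X 0) 2
      + (∑ s ∈ Finset.range m, c s ^ 2) * mom μ (X 0) 2 * (mom μ (X 0) 4 - mom μ (X 0) 2 ^ 2)
      + 2 * a * ρ * mom μ (X 0) 4
      + 2 * (∑ t ∈ Finset.range m, b t * c t) * mom μ (X 0) 3 ^ 2 := by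
  set M := mom μ (X 0) 2 with hM
  set M4 := mom μ (X 0) 4
  set I := Finset.range m ×ˢ Finset.range m
  set e : ℕ → (ℕ → ℝ) → ℝ := fun t x => x (2 * m - t) ^ 2 - M with he
  set f : ℕ × ℕ → (ℕ → ℝ) → ℝ := fun p x => x (2 * m - (p.1 + p.2 + 1)) * x (2 * m - p.2) with hf
  set g : ℕ → (ℕ → ℝ) → ℝ := fun s x => x (2 * m - s) with hg
  have hfab : ∀ p ∈ I, 2 * m - (p.1 + p.2 + 1) < 2 * m - p.2 := fun p hp => by
    simp only [I, Finset.mem_product, Finset.mem_range] at hp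
    omega
  have hew : ∀ t ∈ Finset.range m, IsBddWindow B (2 * m) (e t) := fun t _ =>
    ((IsBddWindow.coord (Nat.sub_le _ _)).pow 2).sub (IsBddWindow.const _)
  have hfw : ∀ p ∈ I, IsBddWindow B (2 * m) (f p) := fun p _ =>
    (IsBddWindow.coord (Nat.sub_le _ _)).mul (IsBddWindow.coord (Nat.sub_le _ _))
  have hgw : ∀ s ∈ Finset.range m, IsBddWindow B (2 * m) (g s) := fun s _ =>
    IsBddWindow.coord (Nat.sub_le _ _)
  set U : (ℕ → ℝ) → ℝ := fun x => ∑ t ∈ Finset.range m, b t * e t x with hU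
  set W : (ℕ → ℝ) → ℝ := fun x => ∑ p ∈ I, d p.1 p.2 * f p x with hW
  set T : (ℕ → ℝ) → ℝ := fun x => ∑ s ∈ Finset.range m, c s * g s x with hT
  have hUw : IsBddWindow B (2 * m) U := IsBddWindow.sum fun t ht => (hew t ht).const_mul _
  have hWw : IsBddWindow B (2 * m) W := IsBddWindow.sum fun p hp => (hfw p hp).const_mul _
  have hTw : IsBddWindow B (2 * m) T := IsBddWindow.sum fun s hs => (hgw s hs).const_mul _
  have hφ : Measurable fun u : ℝ => u ^ 2 - M := (measurable_id.pow_const 2).sub_const _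
  have hφ0 : expect μ X (fun x => x 0 ^ 2 - M) = 0 := h.expect_pow_sub 0 2
  have ne : ∀ i ∈ Finset.range m, ∀ j ∈ Finset.range m, i ≠ j → 2 * m - i ≠ 2 * m - j := by
    intro i hi j hj hij
    rw [Finset.mem_range] at hi hj
    omega
  have one_mul_sum : ∀ {ι : Type} (s : Finset ι) (v : ι → ℝ) (k : ι → (ℕ → ℝ) → ℝ),
      (∀ i ∈ s, IsBddWindow B (2 * m) (k i)) → (∀ i ∈ s, expect μ X (k i) = 0) →
      expect μ X (fun x => ∑ i ∈ s, v i * k i x) = 0 := by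
    intro ι s v k hk h0
    rw [h.expect_sum fun i hi => (hk i hi).const_mul _]
    exact Finset.sum_eq_zero fun i hi => by rw [expect_const_mul, h0 i hi, mul_zero]
  have EU : expect μ X U = 0 := one_mul_sum _ _ _ hew fun t _ => h.expect_pow_sub _ 2
  have EW : expect μ X W = 0 := one_mul_sum _ _ _ hfw fun p hp => h.expect_pair (hfab p hp)
  have Eg : ∀ s, expect μ X (g s) = 0 := fun s => by
    have h0 := h.expect_coord (2 * m - s) (φ := id) measurable_id
    simpa only [id, h.expect_id] using h0
  have ET : expect μ X T = 0 := one_mul_sum _ _ _ hgw fun s _ => Eg s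
  have EUU : expect μ X (fun x => U x * U x) = (∑ t ∈ Finset.range m, b t ^ 2) * (M4 - M ^ 2) := by
    rw [hU, h.expect_sum_mul_sum _ _ _ hew hew, Finset.sum_mul]
    · refine Finset.sum_congr rfl fun t _ => ?_
      have h1 : (fun x => e t x * e t x) =
          fun x : ℕ → ℝ => x (2 * m - t) ^ 4 + ((-2 * M) * x (2 * m - t) ^ 2 + M ^ 2) := by
        ext x
        simp only [he]
        ring
      have hp : ∀ j : ℕ, IsBddWindow B (2 * m) fun x => x (2 * m - t) ^ j := fun j =>
        (IsBddWindow.coord (Nat.sub_le _ _)).pow j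
      rw [h1, h.expect_add (hp 4) (((hp 2).const_mul _).add (IsBddWindow.const _)),
        h.expect_add ((hp 2).const_mul _) (IsBddWindow.const _), expect_const_mul, expect_const,
        h.expect_pow, h.expect_pow]
      ring
    · intro i hi j hj hij
      have := h.expect_mul_coord (ne i hi j hj hij) hφ hφ
      rwa [hφ0, mul_zero] at this
  have EWW : expect μ X (fun x => W x * W x) = (∑ p ∈ I, d p.1 p.2 ^ 2) * M ^ 2 := by
    rw [hW, h.expect_sum_mul_sum I (fun p => d p.1 p.2) (fun p => d p.1 p.2) hfw hfw,
      Finset.sum_mul]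
    · refine Finset.sum_congr rfl fun p hp => ?_
      rw [h.expect_pair_sq (hfab p hp), sq (d p.1 p.2)]
    · intro i hi j hj hij
      refine h.expect_pair_mul_pair (hfab i hi) (hfab j hj) fun hh => hij ?_
      simp only [I, Finset.mem_product, Finset.mem_range] at hi hj
      ext <;> omega
  have ETT : expect μ X (fun x => T x * T x) = (∑ s ∈ Finset.range m, c s ^ 2) * M := by
    rw [hT, h.expect_sum_mul_sum _ _ _ hgw hgw, Finset.sum_mul]
    · refine Finset.sum_congr rfl fun s _ => ?_
      simp only [hg, ← sq]
      rw [h.expect_pow]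
    · intro i hi j hj hij
      have := h.expect_mul_coord (ne i hi j hj hij) measurable_id measurable_id
      simpa only [id, h.expect_id, zero_mul] using this
  have EUT : expect μ X (fun x => U x * T x) =
      (∑ t ∈ Finset.range m, b t * c t) * mom μ (X 0) 3 := by
    rw [hU, hT, h.expect_sum_mul_sum _ _ _ hew hgw, Finset.sum_mul]
    · refine Finset.sum_congr rfl fun t _ => ?_
      have h1 : (fun x => e t x * g t x) =
          fun x : ℕ → ℝ => x (2 * m - t) ^ 3 + (-M) * x (2 * m - t) := by
        ext x
        simp only [he, hg]
        ring
      have hp : IsBddWindow B (2 * m) fun x => x (2 * m - t) := IsBddWindow.coord (Nat.sub_le _ _)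
      rw [h1, h.expect_add (hp.pow 3) (hp.const_mul _), expect_const_mul, h.expect_pow,
        show expect μ X (fun x => x (2 * m - t)) = 0 from Eg t, mul_zero, add_zero]
    · intro i hi j hj hij
      have := h.expect_mul_coord (ne i hi j hj hij) hφ measurable_id
      rwa [hφ0, zero_mul] at this
  have EUW : expect μ X (fun x => U x * W x) = 0 := by
    rw [hW, h.expect_mul_sum I (fun p => d p.1 p.2) hUw hfw]
    refine Finset.sum_eq_zero fun p hp => ?_
    simp only [mul_comm (U _)]
    rw [hU, h.expect_mul_sum _ _ (hfw p hp) hew, Finset.sum_eq_zero, mul_zero]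
    intro t ht
    simp only [mul_comm (f p _)]
    rw [h.expect_mul_pair (hfab p hp) hφ hφ0, mul_zero]
  have EWT : expect μ X (fun x => W x * T x) = 0 := by
    simp only [mul_comm (W _)]
    rw [hW, h.expect_mul_sum I (fun p => d p.1 p.2) hTw hfw]
    refine Finset.sum_eq_zero fun p hp => ?_
    simp only [mul_comm (T _)]
    rw [hT, h.expect_mul_sum _ _ (hfw p hp) hgw, Finset.sum_eq_zero, mul_zero]
    intro t ht
    simp only [mul_comm (f p _)]
    have h0 : expect μ X (fun x => g t x * f p x) = 0 :=
      h.expect_mul_pair (φ := id) (hfab p hp) measurable_id h.mean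
    rw [h0, mul_zero]
  have hUW := hUw.add hWw
  have hR : IsBddWindow B (2 * m) fun x => ρ + (U x + W x) := (IsBddWindow.const ρ).add hUW
  have ER : expect μ X (fun x => ρ + (U x + W x)) = ρ := by
    rw [h.expect_add (IsBddWindow.const ρ) hUW, h.expect_add hUw hWw, EU, EW, expect_const]
    ring
  have ERR : expect μ X (fun x => (ρ + (U x + W x)) * (ρ + (U x + W x))) = ρ ^ 2
      + (∑ t ∈ Finset.range m, b t ^ 2) * (M4 - M ^ 2) + (∑ p ∈ I, d p.1 p.2 ^ 2) * M ^ 2 := by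
    have h1 : (fun x => (ρ + (U x + W x)) * (ρ + (U x + W x))) = fun x => ρ ^ 2
        + ((2 * ρ) * (U x + W x) + (U x * U x + (2 * (U x * W x) + W x * W x))) := by
      ext x
      ring
    rw [h1, h.expect_add (IsBddWindow.const _) ((hUW.const_mul _).add ((hUw.mul hUw).add
      (((hUw.mul hWw).const_mul _).add (hWw.mul hWw)))), h.expect_add (hUW.const_mul _)
      ((hUw.mul hUw).add (((hUw.mul hWw).const_mul _).add (hWw.mul hWw))),
      h.expect_add (hUw.mul hUw) (((hUw.mul hWw).const_mul _).add (hWw.mul hWw)),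
      h.expect_add ((hUw.mul hWw).const_mul _) (hWw.mul hWw), expect_const_mul, expect_const_mul,
      expect_const, h.expect_add hUw hWw, EU, EW, EUU, EUW, EWW]
    ring
  have ERT : expect μ X (fun x => (ρ + (U x + W x)) * T x) =
      (∑ t ∈ Finset.range m, b t * c t) * mom μ (X 0) 3 := by
    have h1 : (fun x => (ρ + (U x + W x)) * T x) =
        fun x => ρ * T x + (U x * T x + W x * T x) := by
      ext x
      ring
    rw [h1, h.expect_add (hTw.const_mul _) ((hUw.mul hTw).add (hWw.mul hTw)),
      h.expect_add (hUw.mul hTw) (hWw.mul hTw), expect_const_mul, ET, EUT, EWT]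
    ring
  have := h.expect_lastCentred_sq a hR hTw
  rw [ER, ERR, ERT, ETT, ET] at this
  refine this.trans ?_
  ring

end ThreeFlats


/-! ### The central limit theorem for paths with three flat steps -/

section ThreeFlatsLimit

variable {Ω : Type*} {mΩ : MeasurableSpace Ω} {μ : Measure Ω} [IsProbabilityMeasure μ]
  {X : ℕ → Ω → ℝ} {B : ℝ}

/-- Sums over shapes split according to which of the gaps vanish. -/
lemma sum_range_succ_sq (m : ℕ) (D : ℕ → ℕ → ℝ) :
    ∑ s ∈ Finset.range (m + 1), ∑ t ∈ Finset.range (m + 1), D s t =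
      D 0 0 + ∑ t ∈ Finset.range m, D 0 (t + 1) + ∑ s ∈ Finset.range m, D (s + 1) 0
        + ∑ p ∈ Finset.range m ×ˢ Finset.range m, D (p.1 + 1) (p.2 + 1) := by
  rw [Finset.sum_product' (Finset.range m) (Finset.range m) fun s t => D (s + 1) (t + 1),
    Finset.sum_range_succ']
  simp only [Finset.sum_range_succ' _ m]
  rw [Finset.sum_add_distrib]
  ring

lemma BoundedIID.centredMonomial_triple (h : BoundedIID μ X B) {m s t : ℕ} (hs : s ≤ m)
    (ht : t ≤ m) (i : ℕ) (ω : Ω) (x : ℕ → ℝ) (hx : x = shift X i ω) :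
    centredMonomial μ X {2 * m + 1 - (s + t), 2 * m + 1 - t, 2 * m + 1} i ω =
      x (2 * m + 1 - (s + t)) * x (2 * m + 1 - t) * x (2 * m + 1)
        - if s = 0 ∧ t = 0 then mom μ (X 0) 3 else 0 := by
  rw [centredMonomial_eq, monomialAt_triple, hx]
  simp only [funext (monomialAt_triple _ _ _)]
  congr 1
  rcases Nat.eq_zero_or_pos t with rfl | ht0
  · rcases Nat.eq_zero_or_pos s with rfl | hs0
    · rw [if_pos ⟨rfl, rfl⟩, ← h.expect_pow (2 * m + 1) 3]
      simp only [Nat.sub_zero, add_zero]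
      congr 1
      ext x
      ring
    · rw [if_neg (by omega)]
      have := h.expect_mul_coord (p := 2 * m + 1 - s) (q := 2 * m + 1) (φ := id)
        (ψ := fun u => u ^ 2) (by omega) measurable_id (measurable_id.pow_const 2)
      simp only [id, h.expect_id, zero_mul] at this
      rw [← this]
      simp only [Nat.sub_zero, add_zero]
      congr 1
      ext x
      ring
  · rw [if_neg (by omega)]
    have hF : IsWindow (2 * m) fun x => x (2 * m + 1 - (s + t)) * x (2 * m + 1 - t) :=
      ⟨(measurable_pi_apply _).mul (measurable_pi_apply _), fun x y hxy => by
        rw [hxy (2 * m + 1 - (s + t)) (by omega), hxy (2 * m + 1 - t) (by omega)]⟩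
    have := h.expect_mul hF (n := 2 * m + 1) (by omega) measurable_id
    simpa only [id, h.expect_id, mul_zero] using this

/-- For odd polynomials orthogonal to `Q_m` the leading contributions of the paths with a single flat
step cancel, so that the paths with three flat steps govern the fluctuations. The terms with one
simple and one later double site are not centred given all but their last variable; their
conditional mean, a multiple of a single variable, is moved to the last site of the window. -/
theorem BoundedIID.gaussianLimit_three (h : BoundedIID μ X B) {α : ℝ} (hα : 0 < α)
    (hα1 : 6 * α ≤ 1) {P : ℝ[X]} {m : ℕ} (hP : P.natDegree ≤ m)
    (hodd : ∀ k, Even k → P.coeff k = 0) (h0 : shapeCoeff m P (del 0) = 0)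
    {D : ℕ → ℕ → ℝ} (hD : D = fun s t => shapeCoeff m P (del 0 + del s + del (s + t))) :
    GaussianLimit μ X α P (6 * α)
      (D 0 0 ^ 2 * (mom μ (X 0) 6 - mom μ (X 0) 3 ^ 2)
      + (((∑ t ∈ Finset.range m, D 0 (t + 1) + ∑ s ∈ Finset.range m, D (s + 1) 0)
          * mom μ (X 0) 2) ^ 2
        + (∑ t ∈ Finset.range m, D 0 (t + 1) ^ 2) * (mom μ (X 0) 4 - mom μ (X 0) 2 ^ 2)
        + (∑ p ∈ Finset.range m ×ˢ Finset.range m, D (p.1 + 1) (p.2 + 1) ^ 2)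
          * mom μ (X 0) 2 ^ 2) * mom μ (X 0) 2
      + (∑ s ∈ Finset.range m, D (s + 1) 0 ^ 2) * mom μ (X 0) 2
        * (mom μ (X 0) 4 - mom μ (X 0) 2 ^ 2)
      + 2 * D 0 0 * ((∑ t ∈ Finset.range m, D 0 (t + 1) + ∑ s ∈ Finset.range m, D (s + 1) 0)
          * mom μ (X 0) 2) * mom μ (X 0) 4
      + 2 * (∑ t ∈ Finset.range m, D 0 (t + 1) * D (t + 1) 0) * mom μ (X 0) 3 ^ 2) := by
  set M := mom μ (X 0) 2 with hM
  set ρ := (∑ t ∈ Finset.range m, D 0 (t + 1) + ∑ s ∈ Finset.range m, D (s + 1) 0) * M with hρ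
  rw [← h.expect_lastCentred_sq_of_three m (D 0 0) (fun t => D 0 (t + 1)) (fun s => D (s + 1) 0)
    (fun s t => D (s + 1) (t + 1)) ρ]
  have hγ1 : 2 * (3 * α) ≤ 1 := by linarith
  have h6 : 6 * α = 2 * (3 * α) := by ring
  have hc : ∀ s, IsBddWindow B (2 * m) fun x : ℕ → ℝ => x (2 * m - s) := fun s =>
    IsBddWindow.coord (Nat.sub_le _ _)
  rw [h6]
  refine h.gaussianLimit_lastCentred
    ((IsBddWindow.const _).add ((IsBddWindow.sum fun t _ => (((hc t).pow 2).sub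
      (IsBddWindow.const _)).const_mul _).add (IsBddWindow.sum fun p _ =>
        ((hc (p.1 + p.2 + 1)).mul (hc p.2)).const_mul _)))
    (IsBddWindow.sum fun s _ => (hc s).const_mul _) (by linarith) hγ1 ?_
  have hg := tendsto_growth hγ1
  have hneg := h.negligible_centredStat_sub hα.le (t := 2 * (3 * α)) (by linarith) hγ1 hP
    (fun j => j = 3 ∨ j = 1)
    (V := fun k N ω => ∑ s ∈ Finset.range (m + 1), ∑ t ∈ Finset.range (m + 1),
        pathCount k (del 0 + del s + del (s + t)) * monomialSum μ X (3 * α)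
          {2 * m + 1 - (s + t), 2 * m + 1 - t, 2 * m + 1} N ω
      + pathCount k (del 0) * monomialSum μ X α {2 * m + 1} N ω)
    (fun k hk y hy hy2 => ?_) (fun k hk => ?_)
  rotate_left
  · have hk' : Odd k := by
      rw [← Nat.not_even_iff_odd]
      exact fun ho => hk (hodd k ho)
    have hpar := even_sub_card_flats hy
    rw [Int.even_sub, Int.even_coe_nat, Int.even_coe_nat, ← not_iff_not, Nat.not_even_iff_odd,
      Nat.not_even_iff_odd] at hpar
    obtain ⟨c, hc⟩ := hpar.mp hk'
    have : (5 : ℝ) ≤ (flats y).card := by exact_mod_cast (by omega : 5 ≤ (flats y).card)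
    exact Or.inr (by nlinarith)
  · refine ((h.negligible_three hα.le hk hg).add (h.negligible_one hα.le hk hg)).congr
      fun N ω => ?_
    rw [Finset.filter_or, Finset.sum_union]
    · ring
    · rw [Finset.disjoint_filter]
      intro y _ h3
      omega
  have hshift : Negligible μ (growth (2 * (3 * α))) fun N ω =>
      ∑ s ∈ Finset.range m, (D (s + 1) 0 * M) *
        (∑ i ∈ Finset.range N, weight (3 * α) i * X (i + (2 * m - s)) ω
          - ∑ i ∈ Finset.range N, weight (3 * α) i * X (i + (2 * m + 1)) ω) := by
    refine Negligible.sum fun s hs => Negligible.const_mul ?_ _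
    rw [Finset.mem_range] at hs
    refine Negligible.of_bounded hg (fun N => ?_) (C := 3 * ((s + 1 : ℕ) : ℝ) * B) fun N ω => ?_
    · exact ((Finset.measurable_fun_sum _ fun i _ => (h.meas _).const_mul _).sub
        (Finset.measurable_fun_sum _ fun i _ => (h.meas _).const_mul _)).aestronglyMeasurable
    · have := abs_sum_weight_shift_le (γ := 3 * α) (by linarith)
        (f := fun i => X (i + (2 * m - s)) ω) (fun i => h.bound _ ω) (s + 1) N
      rw [abs_sub_comm]
      simpa only [show ∀ i, i + (s + 1) + (2 * m - s) = i + (2 * m + 1) by omega] using this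
  refine (hneg.add hshift).congr fun N ω => ?_
  have h3 : ∑ k ∈ Finset.range (m + 1), P.coeff k *
      (∑ s ∈ Finset.range (m + 1), ∑ t ∈ Finset.range (m + 1),
        pathCount k (del 0 + del s + del (s + t)) * monomialSum μ X (3 * α)
          {2 * m + 1 - (s + t), 2 * m + 1 - t, 2 * m + 1} N ω
        + pathCount k (del 0) * monomialSum μ X α {2 * m + 1} N ω) =
      ∑ s ∈ Finset.range (m + 1), ∑ t ∈ Finset.range (m + 1), D s t * monomialSum μ X (3 * α)
        {2 * m + 1 - (s + t), 2 * m + 1 - t, 2 * m + 1} N ω := by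
    have h4 : ∑ k ∈ Finset.range (m + 1), P.coeff k * (pathCount k (del 0)
        * monomialSum μ X α {2 * m + 1} N ω) = 0 := by
      simp only [← mul_assoc]
      rw [← Finset.sum_mul]
      exact mul_eq_zero_of_left h0 _
    simp only [mul_add, Finset.sum_add_distrib, h4, add_zero, hD, shapeCoeff, Finset.sum_mul,
      Finset.mul_sum]
    rw [Finset.sum_comm]
    refine Finset.sum_congr rfl fun s _ => ?_
    rw [Finset.sum_comm]
    simp only [mul_assoc]
  have h5 : ∀ i, ∑ s ∈ Finset.range (m + 1), ∑ t ∈ Finset.range (m + 1), D s t *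
      centredMonomial μ X {2 * m + 1 - (s + t), 2 * m + 1 - t, 2 * m + 1} i ω =
      lastCentred μ X (2 * m + 1) (D 0 0)
        (fun x => ρ + (∑ t ∈ Finset.range m, D 0 (t + 1) * (x (2 * m - t) ^ 2 - M)
          + ∑ p ∈ Finset.range m ×ˢ Finset.range m,
            D (p.1 + 1) (p.2 + 1) * (x (2 * m - (p.1 + p.2 + 1)) * x (2 * m - p.2))))
        (fun x => ∑ s ∈ Finset.range m, D (s + 1) 0 * x (2 * m - s)) (shift X i ω)
      + ∑ s ∈ Finset.range m, (D (s + 1) 0 * M) *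
        (X (i + (2 * m - s)) ω - X (i + (2 * m + 1)) ω) := by
    intro i
    obtain ⟨x, hx⟩ : ∃ x, x = shift X i ω := ⟨_, rfl⟩
    have hX : ∀ s, X (i + s) ω = x s := fun s => by rw [hx]; rfl
    rw [Finset.sum_congr rfl fun s hs => Finset.sum_congr rfl fun t ht => by
      rw [h.centredMonomial_triple (Nat.lt_succ_iff.mp (Finset.mem_range.mp hs))
        (Nat.lt_succ_iff.mp (Finset.mem_range.mp ht)) i ω x hx], sum_range_succ_sq, ← hx]
    simp only [hX, lastCentred, Nat.succ_ne_zero, and_false, false_and, if_false, and_self, if_true,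
      sub_zero, add_zero, zero_add, hρ, add_mul, Finset.sum_mul, ← Finset.sum_add_distrib]
    have e1 : ∀ t, 2 * m + 1 - (t + 1) = 2 * m - t := fun t => by omega
    have e2 : ∀ s t, 2 * m + 1 - (s + 1 + (t + 1)) = 2 * m - (s + t + 1) := fun s t => by omega
    simp only [e1, e2]
    have e3 : ∑ p ∈ Finset.range m ×ˢ Finset.range m, D (p.1 + 1) (p.2 + 1) *
        (x (2 * m - (p.1 + p.2 + 1)) * x (2 * m - p.2) * x (2 * m + 1)) =
        ∑ p ∈ Finset.range m ×ˢ Finset.range m, D (p.1 + 1) (p.2 + 1) *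
        (x (2 * m - (p.1 + p.2 + 1)) * x (2 * m - p.2)) * x (2 * m + 1) :=
      Finset.sum_congr rfl fun p _ => by ring
    have e4 : ∑ t ∈ Finset.range m, D 0 (t + 1) *
          (x (2 * m - t) * x (2 * m - t) * x (2 * m + 1))
        + ∑ s ∈ Finset.range m, D (s + 1) 0 *
          (x (2 * m - s) * x (2 * m + 1) * x (2 * m + 1)) =
        ∑ t ∈ Finset.range m, (D 0 (t + 1) * M * x (2 * m + 1) + D (t + 1) 0 * M * x (2 * m + 1))
        + ∑ t ∈ Finset.range m, D 0 (t + 1) * (x (2 * m - t) ^ 2 - M) * x (2 * m + 1)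
        + ∑ s ∈ Finset.range m, D (s + 1) 0 * x (2 * m - s) * (x (2 * m + 1) ^ 2 - M)
        + ∑ s ∈ Finset.range m, D (s + 1) 0 * M * (x (2 * m - s) - x (2 * m + 1)) := by
      simp only [← Finset.sum_add_distrib]
      exact Finset.sum_congr rfl fun s _ => by ring
    simp only [Nat.sub_zero, ← hM] at e4 ⊢
    rw [e3]
    linear_combination e4
  have h6 : ∑ s ∈ Finset.range (m + 1), ∑ t ∈ Finset.range (m + 1), D s t * monomialSum μ X (3 * α)
        {2 * m + 1 - (s + t), 2 * m + 1 - t, 2 * m + 1} N ω =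
      ∑ i ∈ Finset.range N, weight (3 * α) i * ∑ s ∈ Finset.range (m + 1),
        ∑ t ∈ Finset.range (m + 1), D s t *
          centredMonomial μ X {2 * m + 1 - (s + t), 2 * m + 1 - t, 2 * m + 1} i ω := by
    simp only [monomialSum, Finset.mul_sum]
    conv_rhs => rw [Finset.sum_comm]
    refine Finset.sum_congr rfl fun s _ => ?_
    conv_rhs => rw [Finset.sum_comm]
    exact Finset.sum_congr rfl fun t _ => Finset.sum_congr rfl fun i _ => by ring
  have h7 : ∑ s ∈ Finset.range m, (D (s + 1) 0 * M) *
        (∑ i ∈ Finset.range N, weight (3 * α) i * X (i + (2 * m - s)) ω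
          - ∑ i ∈ Finset.range N, weight (3 * α) i * X (i + (2 * m + 1)) ω) =
      ∑ i ∈ Finset.range N, weight (3 * α) i * ∑ s ∈ Finset.range m, (D (s + 1) 0 * M) *
        (X (i + (2 * m - s)) ω - X (i + (2 * m + 1)) ω) := by
    simp only [← Finset.sum_sub_distrib, Finset.mul_sum]
    rw [Finset.sum_comm]
    exact Finset.sum_congr rfl fun i _ => Finset.sum_congr rfl fun s _ => by ring
  rw [h3, h6, h7]
  simp only [h5, mul_add, Finset.sum_add_distrib]
  ring

end ThreeFlatsLimit


section AlmostSure

variable {Ω : Type*} {mΩ : MeasurableSpace Ω} {μ : Measure Ω}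
  {X : ℕ → Ω → ℝ} {B : ℝ}

/-! ### The almost sure limits -/

lemma ConvergesAE.add {f g : ℕ → Ω → ℝ} (hf : ConvergesAE μ f) (hg : ConvergesAE μ g) :
    ConvergesAE μ fun N ω => f N ω + g N ω := by
  obtain ⟨Y, hY, hlim⟩ := hf
  obtain ⟨Z, hZ, hlim'⟩ := hg
  refine ⟨fun ω => Y ω + Z ω, hY.add hZ, ?_⟩
  filter_upwards [hlim, hlim'] with ω h1 h2
  exact h1.add h2

lemma ConvergesAE.zero : ConvergesAE μ fun _ _ => 0 :=
  ⟨fun _ => 0, MemLp.zero', by simp⟩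

/-- If every path with a flat step has sufficiently many of them, then the statistic converges. -/
lemma BoundedIID.almostSureLimit_of_card [IsProbabilityMeasure μ]
    (h : BoundedIID μ X B) {α : ℝ} (hα : 0 ≤ α) {P : ℝ[X]}
    (hP : ∀ k, P.coeff k ≠ 0 → ∀ y ∈ paths k,
      (flats y).card = 0 ∨ 1 < 2 * ((flats y).card * α)) : AlmostSureLimit μ X α P := by
  have key : ConvergesAE μ fun N ω => ∑ k ∈ Finset.range (P.natDegree + 1), P.coeff k *
      ∑ y ∈ paths k, pathTerm μ X α y N ω := by
    refine ConvergesAE.sum fun k _ => ?_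
    by_cases hk : P.coeff k = 0
    · simpa only [hk, zero_mul] using ConvergesAE.zero
    refine (ConvergesAE.sum fun y hy => ?_).const_mul _
    rcases hP k hk y hy with h0 | h0
    · have h1 : pathTerm μ X α y = fun _ _ => 0 := funext₂ (pathTerm_eq_zero h0)
      rw [h1]
      exact ConvergesAE.zero
    · exact h.convergesAE_pathTerm hα h0
  simpa only [ConvergesAE, AlmostSureLimit, ← h.centredStat_eq α le_rfl] using key

lemma BoundedIID.almostSureLimit_one [IsProbabilityMeasure μ]
    (h : BoundedIID μ X B) {α : ℝ} (hα : 1 / 2 < α)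
    (P : ℝ[X]) : AlmostSureLimit μ X α P := by
  refine h.almostSureLimit_of_card (by linarith) fun k _ y _ => ?_
  rcases Nat.eq_zero_or_pos (flats y).card with h0 | h0
  · exact Or.inl h0
  · have : (1 : ℝ) ≤ (flats y).card := by exact_mod_cast h0
    exact Or.inr (by nlinarith)

lemma BoundedIID.almostSureLimit_two [IsProbabilityMeasure μ]
    (h : BoundedIID μ X B) {α : ℝ} (hα : 1 / 4 < α)
    {P : ℝ[X]} (heven : ∀ k, Odd k → P.coeff k = 0) : AlmostSureLimit μ X α P := by
  refine h.almostSureLimit_of_card (by linarith) fun k hk y hy => ?_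
  have hk' : Even k := by
    rw [← Nat.not_odd_iff_even]
    exact fun ho => hk (heven k ho)
  have hpar := even_sub_card_flats hy
  rw [Int.even_sub, Int.even_coe_nat, Int.even_coe_nat] at hpar
  obtain ⟨c, hc⟩ := hpar.mp hk'
  rcases Nat.eq_zero_or_pos c with h0 | h0
  · exact Or.inl (by omega)
  · have : (2 : ℝ) ≤ (flats y).card := by exact_mod_cast (by omega : 2 ≤ (flats y).card)
    exact Or.inr (by nlinarith)

/-- For odd polynomials orthogonal to `Q_m`, the divergent contributions of the paths with a single
flat step cancel. -/
lemma BoundedIID.almostSureLimit_three [IsProbabilityMeasure μ]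
    (h : BoundedIID μ X B) {α : ℝ} (hα : 1 / 6 < α)
    {P : ℝ[X]} {m : ℕ} (hP : P.natDegree ≤ m) (hodd : ∀ k, Even k → P.coeff k = 0)
    (h0 : shapeCoeff m P (del 0) = 0) : AlmostSureLimit μ X α P := by
  have hone : ConvergesAE μ fun N ω => ∑ k ∈ Finset.range (m + 1), P.coeff k *
      ∑ y ∈ (paths k).filter (fun y => (flats y).card = 1), (pathTerm μ X α y N ω
        - ∑ i ∈ Finset.range N, weight α i * X i ω) :=
    ConvergesAE.sum fun k _ => (ConvergesAE.sum fun y hy =>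
      h.convergesAE_single (by linarith) (Finset.mem_filter.mp hy).2).const_mul _
  have hrest : ConvergesAE μ fun N ω => ∑ k ∈ Finset.range (m + 1), P.coeff k *
      ∑ y ∈ (paths k).filter (fun y => ¬ (flats y).card = 1), pathTerm μ X α y N ω := by
    refine ConvergesAE.sum fun k _ => ?_
    by_cases hk : P.coeff k = 0
    · simpa only [hk, zero_mul] using ConvergesAE.zero
    refine (ConvergesAE.sum fun y hy => ?_).const_mul _
    rw [Finset.mem_filter] at hy
    have hk' : Odd k := by
      rw [← Nat.not_even_iff_odd]
      exact fun ho => hk (hodd k ho)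
    have hpar := even_sub_card_flats hy.1
    rw [Int.even_sub, Int.even_coe_nat, Int.even_coe_nat, ← not_iff_not, Nat.not_even_iff_odd,
      Nat.not_even_iff_odd] at hpar
    obtain ⟨c, hc⟩ := hpar.mp hk'
    have : (3 : ℝ) ≤ (flats y).card := by exact_mod_cast (by omega : 3 ≤ (flats y).card)
    exact h.convergesAE_pathTerm (by linarith) (by nlinarith)
  have key := hone.add hrest
  have heq : ∀ N ω, centredStat μ X α P N ω = ∑ k ∈ Finset.range (m + 1), P.coeff k *
      ∑ y ∈ (paths k).filter (fun y => (flats y).card = 1), (pathTerm μ X α y N ω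
        - ∑ i ∈ Finset.range N, weight α i * X i ω)
      + ∑ k ∈ Finset.range (m + 1), P.coeff k *
        ∑ y ∈ (paths k).filter (fun y => ¬ (flats y).card = 1), pathTerm μ X α y N ω := by
    intro N ω
    set S := ∑ i ∈ Finset.range N, weight α i * X i ω
    have h1 : ∑ k ∈ Finset.range (m + 1), P.coeff k * (pathCount k (del 0) * S) = 0 := by
      simp only [← mul_assoc]
      rw [← Finset.sum_mul]
      exact mul_eq_zero_of_left h0 _
    rw [h.centredStat_eq α hP, ← add_zero (∑ k ∈ Finset.range (m + 1), P.coeff k *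
      ∑ y ∈ paths k, pathTerm μ X α y N ω), ← neg_zero, ← h1, ← Finset.sum_neg_distrib,
      ← Finset.sum_add_distrib, ← Finset.sum_add_distrib]
    refine Finset.sum_congr rfl fun k _ => ?_
    rw [← Finset.sum_filter_add_sum_filter_not (paths k) (fun y => (flats y).card = 1),
      Finset.sum_sub_distrib, Finset.sum_const, nsmul_eq_mul, pathCount_one]
    ring
  simpa only [ConvergesAE, AlmostSureLimit, ← heq] using key

end AlmostSure


/-! ### Identification of the limiting variances -/

lemma pathCount_two_eq_zero {k s : ℕ} (h : k < 2 * s + 2) : pathCount k (del 0 + del s) = 0 := by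
  classical
  rw [pathCount_two, Nat.cast_eq_zero, Finset.card_eq_zero, Finset.filter_eq_empty_iff]
  rintro y hy ⟨i, hi⟩
  obtain ⟨a, ha⟩ := mem_flats (y := y) (h := i) (by simp [hi])
  obtain ⟨b, hb⟩ := mem_flats (y := y) (h := i + s) (by simp [hi])
  have := two_mul_dist_le hy a b
  have h2 : (flats y).card = 2 := by simp [hi]
  omega

lemma pathCount_three_eq_zero {k s t : ℕ} (h : k < 2 * (s + t) + 3) :
    pathCount k (del 0 + del s + del (s + t)) = 0 := by
  classical
  rw [pathCount_three, Nat.cast_eq_zero, Finset.card_eq_zero, Finset.filter_eq_empty_iff]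
  rintro y hy ⟨i, hi⟩
  obtain ⟨a, ha⟩ := mem_flats (y := y) (h := i) (by simp [hi])
  obtain ⟨b, hb⟩ := mem_flats (y := y) (h := i + s + t) (by simp [hi])
  have := two_mul_dist_le hy a b
  have h2 : (flats y).card = 3 := by simp [hi]
  omega

lemma pThree_eq (k : ℕ) : pThree k = pathCount k (del 0 + del 0 + del (0 + 0)) := by
  rw [pThree, succ_nsmul, two_nsmul, add_zero]

lemma pTwoOne_eq (k t : ℕ) : pTwoOne k t = pathCount k (del 0 + del 0 + del (0 + t)) := by
  rw [pTwoOne, two_nsmul, zero_add]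

lemma pOneTwo_eq (k s : ℕ) : pOneTwo k s = pathCount k (del 0 + del s + del (s + 0)) := by
  rw [pOneTwo, two_nsmul, add_zero, add_assoc]

section QuadForm

variable {m : ℕ} {P : ℝ[X]}

lemma quadForm_congr {K K' : ℕ → ℕ → ℝ} (h : ∀ k ≤ m, ∀ l ≤ m, P.coeff k ≠ 0 → P.coeff l ≠ 0 →
    K k l = K' k l) : quadForm m K P = quadForm m K' P := by
  refine Finset.sum_congr rfl fun k hk => Finset.sum_congr rfl fun l hl => ?_
  rw [Finset.mem_range, Nat.lt_succ_iff] at hk hl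
  by_cases h1 : P.coeff k = 0
  · simp [h1]
  by_cases h2 : P.coeff l = 0
  · simp [h2]
  rw [h k hk l hl h1 h2]

lemma quadForm_add (K K' : ℕ → ℕ → ℝ) :
    quadForm m (fun k l => K k l + K' k l) P = quadForm m K P + quadForm m K' P := by
  simp only [quadForm, mul_add, add_mul, Finset.sum_add_distrib]

lemma quadForm_mul_const (K : ℕ → ℕ → ℝ) (c : ℝ) :
    quadForm m (fun k l => K k l * c) P = quadForm m K P * c := by
  simp only [quadForm, Finset.sum_mul]
  exact Finset.sum_congr rfl fun k _ => Finset.sum_congr rfl fun l _ => by ring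

lemma quadForm_sum {ι : Type*} (s : Finset ι) (K : ι → ℕ → ℕ → ℝ) :
    quadForm m (fun k l => ∑ i ∈ s, K i k l) P = ∑ i ∈ s, quadForm m (K i) P := by
  simp only [quadForm, Finset.mul_sum, Finset.sum_mul]
  conv_rhs => rw [Finset.sum_comm]
  refine Finset.sum_congr rfl fun k _ => ?_
  rw [Finset.sum_comm]

lemma quadForm_mul (u v : ℕ → ℝ) : quadForm m (fun k l => u k * v l) P =
    (∑ k ∈ Finset.range (m + 1), P.coeff k * u k) * ∑ l ∈ Finset.range (m + 1), P.coeff l * v l := by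
  rw [quadForm, Finset.sum_mul_sum]
  exact Finset.sum_congr rfl fun k _ => Finset.sum_congr rfl fun l _ => by ring

lemma quadForm_mul_swap (u v : ℕ → ℝ) : quadForm m (fun k l => u l * v k) P =
    (∑ k ∈ Finset.range (m + 1), P.coeff k * u k) * ∑ l ∈ Finset.range (m + 1), P.coeff l * v l := by
  rw [mul_comm, ← quadForm_mul]
  simp only [mul_comm]

end QuadForm

lemma sum_pathCount (m : ℕ) (P : ℝ[X]) (β : ℤ →₀ ℕ) :
    ∑ k ∈ Finset.range (m + 1), P.coeff k * pathCount k β = shapeCoeff m P β := rfl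

lemma tsum_tsum_eq_sum {m : ℕ} {f : ℕ → ℕ → ℝ} (h : ∀ s t, m ≤ s ∨ m ≤ t → f s t = 0) :
    ∑' (s : ℕ) (t : ℕ), f s t = ∑ s ∈ Finset.range m, ∑ t ∈ Finset.range m, f s t := by
  have h1 : ∀ s, ∑' t, f s t = ∑ t ∈ Finset.range m, f s t := fun s =>
    tsum_eq_sum fun t ht => h s t (Or.inr (by simpa using ht))
  simp only [h1]
  refine tsum_eq_sum fun s hs => Finset.sum_eq_zero fun t _ => h s t (Or.inl (by simpa using hs))

/-- The square of a finite sum in terms of the products of pairs of entries at a given distance. -/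
lemma sq_sum_eq {m : ℕ} {B : ℕ → ℝ} (hB : ∀ t, m ≤ t → B t = 0) :
    (∑ t ∈ Finset.range m, B t) ^ 2 = ∑ t ∈ Finset.range m, B t ^ 2
      + 2 * ∑ s ∈ Finset.range m, ∑ t ∈ Finset.range m, B (s + t + 1) * B t := by
  set S : ℕ → ℝ := fun n => ∑ t ∈ Finset.range n, B t with hS
  have h1 : ∀ n, S (m + n) = S m := by
    intro n
    simp only [hS, Finset.sum_range_add]
    rw [Finset.sum_eq_zero fun x _ => hB _ (Nat.le_add_right _ _), add_zero]
  have h2 : ∀ t, ∑ s ∈ Finset.range m, B (s + t + 1) = S m - S (t + 1) := by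
    intro t
    rw [← h1 (t + 1), add_comm m]
    simp only [hS]
    rw [Finset.sum_range_add B (t + 1) m]
    simp only [add_sub_cancel_left]
    exact Finset.sum_congr rfl fun s _ => by congr 1; ring
  have h3 : ∀ t, S (t + 1) = S t + B t := fun t => Finset.sum_range_succ _ _
  have h4 : ∑ t ∈ Finset.range m, (S (t + 1) ^ 2 - S t ^ 2) = S m ^ 2 := by
    rw [Finset.sum_range_sub (fun t => S t ^ 2)]
    simp [hS]
  rw [Finset.sum_comm]
  simp only [← Finset.sum_mul, h2]
  have h5 : ∀ t, S (t + 1) ^ 2 - S t ^ 2 = 2 * (S (t + 1) * B t) - B t ^ 2 := fun t => by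
    rw [h3]
    ring
  simp only [h5, Finset.sum_sub_distrib, ← Finset.mul_sum] at h4
  simp only [sub_mul, Finset.sum_sub_distrib, ← Finset.mul_sum]
  have h6 : ∑ t ∈ Finset.range m, B t = S m := rfl
  rw [h6]
  linarith

section Variances

variable {Ω : Type*} {mΩ : MeasurableSpace Ω} {μ : Measure Ω}
  {Y : Ω → ℝ}

lemma variance_eq_mom (hY : AEMeasurable Y μ) (h0 : ∫ ω, Y ω ∂μ = 0) :
    variance Y μ = mom μ Y 2 := by
  rw [variance_of_integral_eq_zero hY h0]
  rfl

lemma varE_eq (hV : variance Y μ = mom μ Y 2) {m : ℕ} {P : ℝ[X]}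
    (heven : ∀ k, Odd k → P.coeff k = 0) :
    varE μ Y m P = shapeCoeff m P (del 0 + del 0) ^ 2 * (mom μ Y 4 - mom μ Y 2 ^ 2)
      + (∑ s ∈ Finset.range m, shapeCoeff m P (del 0 + del (s + 1)) ^ 2) * mom μ Y 2 ^ 2 := by
  rw [varE, quadForm_congr (K' := fun k l =>
    pathCount k (del 0 + del 0) * pathCount l (del 0 + del 0) * (mom μ Y 4 - mom μ Y 2 ^ 2)
      + (∑ s ∈ Finset.range m, pathCount k (del 0 + del (s + 1)) * pathCount l (del 0 + del (s + 1)))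
        * mom μ Y 2 ^ 2)]
  · simp only [quadForm_add, quadForm_mul_const, quadForm_sum, quadForm_mul, sum_pathCount, sq]
  · intro k hk l hl hk0 hl0
    have e1 : Even k := by
      rw [← Nat.not_odd_iff_even]
      exact fun ho => hk0 (heven k ho)
    have e2 : Even l := by
      rw [← Nat.not_odd_iff_even]
      exact fun ho => hl0 (heven l ho)
    rw [covE, if_pos ⟨e1, e2⟩, two_nsmul, hV, tsum_eq_sum (s := Finset.range m)]
    intro s hs
    rw [Finset.mem_range, not_lt] at hs
    rw [pathCount_two_eq_zero (k := k) (by omega), zero_mul]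

lemma varPerp_eq {m : ℕ} {P : ℝ[X]} (hodd : ∀ k, Even k → P.coeff k = 0)
    {D : ℕ → ℕ → ℝ} (hD : D = fun s t => shapeCoeff m P (del 0 + del s + del (s + t))) :
    varPerp μ Y m P = D 0 0 ^ 2 * (mom μ Y 6 - mom μ Y 3 ^ 2)
      + (((∑ t ∈ Finset.range m, D 0 (t + 1) + ∑ s ∈ Finset.range m, D (s + 1) 0)
          * mom μ Y 2) ^ 2
        + (∑ t ∈ Finset.range m, D 0 (t + 1) ^ 2) * (mom μ Y 4 - mom μ Y 2 ^ 2)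
        + (∑ p ∈ Finset.range m ×ˢ Finset.range m, D (p.1 + 1) (p.2 + 1) ^ 2)
          * mom μ Y 2 ^ 2) * mom μ Y 2
      + (∑ s ∈ Finset.range m, D (s + 1) 0 ^ 2) * mom μ Y 2
        * (mom μ Y 4 - mom μ Y 2 ^ 2)
      + 2 * D 0 0 * ((∑ t ∈ Finset.range m, D 0 (t + 1) + ∑ s ∈ Finset.range m, D (s + 1) 0)
          * mom μ Y 2) * mom μ Y 4
      + 2 * (∑ t ∈ Finset.range m, D 0 (t + 1) * D (t + 1) 0) * mom μ Y 3 ^ 2 := by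
  set p : ℕ → ℕ → ℕ → ℝ := fun k s t => pathCount k (del 0 + del s + del (s + t)) with hp
  have hpD : ∀ s t, ∑ k ∈ Finset.range (m + 1), P.coeff k * p k s t = D s t := fun s t => by
    rw [hD]
    rfl
  have hp0 : ∀ k ≤ m, ∀ s t, m < 2 * (s + t) + 3 → p k s t = 0 := fun k hk s t h =>
    pathCount_three_eq_zero (by omega)
  have hD0 : ∀ s t, m < 2 * (s + t) + 3 → D s t = 0 := fun s t h => by
    rw [← hpD]
    exact Finset.sum_eq_zero fun k hk => by
      rw [hp0 k (Nat.lt_succ_iff.mp (Finset.mem_range.mp hk)) s t h, mul_zero]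
  rw [varPerp, quadForm_congr (K' := fun k l =>
    p k 0 0 * p l 0 0 * (mom μ Y 6 - mom μ Y 3 ^ 2)
    + (∑ t ∈ Finset.range m, (p k 0 (t + 1) * p l (t + 1) 0 + p l 0 (t + 1) * p k (t + 1) 0))
      * mom μ Y 3 ^ 2
    + (∑ t ∈ Finset.range m, (p k 0 0 * p l 0 (t + 1) + p l 0 0 * p k 0 (t + 1))
      + ∑ s ∈ Finset.range m, (p k 0 0 * p l (s + 1) 0 + p l 0 0 * p k (s + 1) 0)
      + ∑ t ∈ Finset.range m, p k 0 (t + 1) * p l 0 (t + 1)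
      + ∑ s ∈ Finset.range m, p k (s + 1) 0 * p l (s + 1) 0) * (mom μ Y 4 * mom μ Y 2)
    + (∑ s ∈ Finset.range m, ∑ t ∈ Finset.range m, (p k 0 (s + 1 + (t + 1)) * p l 0 (t + 1)
        + p l 0 (s + 1 + (t + 1)) * p k 0 (t + 1))
      + ∑ s ∈ Finset.range m, ∑ t ∈ Finset.range m, (p k 0 (t + 1) * p l (s + 1) 0
        + p l 0 (t + 1) * p k (s + 1) 0)
      + ∑ s ∈ Finset.range m, ∑ t ∈ Finset.range m, (p k (s + 1) 0 * p l (s + 1 + (t + 1)) 0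
        + p l (s + 1) 0 * p k (s + 1 + (t + 1)) 0)
      + ∑ s ∈ Finset.range m, ∑ t ∈ Finset.range m, p k (s + 1) (t + 1) * p l (s + 1) (t + 1))
      * mom μ Y 2 ^ 3)]
  · simp only [quadForm_add, quadForm_mul_const, quadForm_sum, quadForm_mul, quadForm_mul_swap, hpD]
    have hB := sq_sum_eq (m := m) (B := fun t => D 0 (t + 1)) fun t ht => hD0 _ _ (by omega)
    have hC := sq_sum_eq (m := m) (B := fun s => D (s + 1) 0) fun t ht => hD0 _ _ (by omega)
    have e1 : ∀ s t : ℕ, s + 1 + (t + 1) = s + t + 1 + 1 := fun s t => by ring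
    have hC' : ∑ s ∈ Finset.range m, ∑ t ∈ Finset.range m, D (s + 1) 0 * D (s + t + 1 + 1) 0 =
        ∑ s ∈ Finset.range m, ∑ t ∈ Finset.range m, D (s + t + 1 + 1) 0 * D (t + 1) 0 := by
      rw [Finset.sum_comm]
      refine Finset.sum_congr rfl fun s _ => Finset.sum_congr rfl fun t _ => ?_
      rw [mul_comm, add_comm t s]
    have hBC : ∑ s ∈ Finset.range m, ∑ t ∈ Finset.range m, D 0 (t + 1) * D (s + 1) 0 =
        (∑ t ∈ Finset.range m, D 0 (t + 1)) * ∑ s ∈ Finset.range m, D (s + 1) 0 := by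
      rw [mul_comm, Finset.sum_mul_sum]
      simp only [mul_comm]
    have hDD : ∑ q ∈ Finset.range m ×ˢ Finset.range m, D (q.1 + 1) (q.2 + 1) ^ 2 =
        ∑ s ∈ Finset.range m, ∑ t ∈ Finset.range m, D (s + 1) (t + 1) ^ 2 :=
      Finset.sum_product' (Finset.range m) (Finset.range m) fun s t => D (s + 1) (t + 1) ^ 2
    simp only [← Finset.mul_sum] at hC'
    simp only [Finset.sum_add_distrib, e1, hBC, hDD, ← sq, ← Finset.mul_sum]
    linear_combination (mom μ Y 2 ^ 3) * (-hB - hC + 2 * hC')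
  · intro k hk l hl hk0 hl0
    have e1 : Odd k := by
      rw [← Nat.not_even_iff_odd]
      exact fun ho => hk0 (hodd k ho)
    have e2 : Odd l := by
      rw [← Nat.not_even_iff_odd]
      exact fun ho => hl0 (hodd l ho)
    have ht1 : ∀ f : ℕ → ℝ, (∀ t, m ≤ t → f t = 0) → ∑' t, f t = ∑ t ∈ Finset.range m, f t :=
      fun f hf => tsum_eq_sum fun t ht => hf t (by simpa using ht)
    have hz : ∀ s t, m ≤ s + t → p k s t = 0 ∧ p l s t = 0 := fun s t h =>
      ⟨hp0 k hk s t (by omega), hp0 l hl s t (by omega)⟩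
    have f3 : ∀ k, pThree k = p k 0 0 := pThree_eq
    have f21 : ∀ k t, pTwoOne k t = p k 0 t := pTwoOne_eq
    have f12 : ∀ k s, pOneTwo k s = p k s 0 := pOneTwo_eq
    have f111 : ∀ k s t, pOneOneOne k s t = p k s t := fun _ _ _ => rfl
    by_cases h3 : 3 ≤ k ∧ 3 ≤ l
    · rw [covPerp, if_pos ⟨e1, e2, h3.1, h3.2⟩]
      simp only [q6, q33, q42, q222, f3, f21, f12, f111]
      rw [ht1 _ fun t ht => ?_, ht1 _ fun t ht => ?_, ht1 _ fun t ht => ?_, ht1 _ fun t ht => ?_,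
        ht1 _ fun t ht => ?_, tsum_tsum_eq_sum (m := m) fun s t h => ?_,
        tsum_tsum_eq_sum (m := m) fun s t h => ?_, tsum_tsum_eq_sum (m := m) fun s t h => ?_,
        tsum_tsum_eq_sum (m := m) fun s t h => ?_]
      · simp [hz (s + 1) (t + 1) (by omega)]
      · simp [hz (s + 1 + (t + 1)) 0 (by omega)]
      · rcases h with h | h
        · simp [hz (s + 1) 0 (by omega)]
        · simp [hz 0 (t + 1) (by omega)]
      · simp [hz 0 (s + 1 + (t + 1)) (by omega)]
      · simp [hz (t + 1) 0 (by omega)]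
      · simp [hz 0 (t + 1) (by omega)]
      · simp [hz (t + 1) 0 (by omega)]
      · simp [hz 0 (t + 1) (by omega)]
      · simp [hz (t + 1) 0 (by omega)]
    · rw [covPerp, if_neg fun h => h3 h.2.2]
      have hlt : ∀ k < 3, ∀ s t, p k s t = 0 := fun k hk s t => pathCount_three_eq_zero (by omega)
      rcases not_and_or.mp h3 with h | h
      · simp [hlt k (not_le.mp h)]
      · simp [hlt l (not_le.mp h)]

end Variances


/-! ### Paths with a single flat step -/

/-- The path with given steps. -/
def walk {k : ℕ} (d : Fin k → ℤ) (t : Fin (k + 1)) : ℤ :=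
  ∑ s ∈ Finset.univ.filter (fun s : Fin k => s.castSucc < t), d s

lemma walk_zero {k : ℕ} (d : Fin k → ℤ) : walk d 0 = 0 := by
  simp [walk]

lemma walk_last {k : ℕ} (d : Fin k → ℤ) : walk d (Fin.last k) = ∑ s, d s := by
  rw [walk, Finset.filter_true_of_mem fun s _ => Fin.castSucc_lt_last s]

lemma walk_succ {k : ℕ} (d : Fin k → ℤ) (t : Fin k) :
    walk d t.succ = walk d t.castSucc + d t := by
  have : Finset.univ.filter (fun s : Fin k => s.castSucc < t.succ) =
      insert t (Finset.univ.filter fun s : Fin k => s.castSucc < t.castSucc) := by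
    ext s
    simp only [Finset.mem_filter, Finset.mem_univ, true_and, Finset.mem_insert, Fin.lt_def,
      Fin.ext_iff, Fin.val_succ, Fin.val_castSucc]
    omega
  rw [walk, this, Finset.sum_insert (by simp), add_comm]
  rfl

lemma eq_walk {k : ℕ} {y : Fin (k + 1) → ℤ} (h0 : y 0 = 0) :
    y = walk fun t : Fin k => y t.succ - y t.castSucc := by
  ext t
  induction t using Fin.induction with
  | zero => rw [h0, walk_zero]
  | succ t ih => rw [walk_succ, ← ih]; ring

/-- The steps of a path with a single flat step at the time `i` and with upward steps at the
times in `U`. -/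
def oneFlatSteps {k : ℕ} (i : Fin k) (U : Finset (Fin k)) (s : Fin k) : ℤ :=
  if s = i then 0 else if s ∈ U then 1 else -1

lemma sum_oneFlatSteps {k : ℕ} {i : Fin k} {U : Finset (Fin k)} (hi : i ∉ U) :
    ∑ s, oneFlatSteps i U s = 2 * U.card + 1 - k := by
  have h1 : ∀ s, oneFlatSteps i U s =
      2 * (if s ∈ U then 1 else 0) + (if s = i then 1 else 0) - 1 := by
    intro s
    by_cases hs : s = i
    · subst hs
      simp [oneFlatSteps, hi]
    · by_cases hU : s ∈ U <;> simp [oneFlatSteps, hs, hU]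
  simp only [h1, Finset.sum_sub_distrib, Finset.sum_add_distrib, ← Finset.mul_sum]
  simp

lemma card_flats {k : ℕ} (y : Fin (k + 1) → ℤ) :
    (flats y).card = (Finset.univ.filter fun t : Fin k => y t.succ - y t.castSucc = 0).card := by
  rw [flats, Multiset.card_map, Finset.card_val]
  congr 1
  ext t
  simp only [Finset.mem_filter, Finset.mem_univ, true_and]
  omega

lemma pathCount_del_zero_odd (j : ℕ) : pathCount (2 * j + 1) (del 0) =
    ((2 * j + 1).factorial : ℝ) / (j.factorial : ℝ) ^ 2 := by
  have key : ((paths (2 * j + 1)).filter fun y => (flats y).card = 1).card =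
      ((Finset.univ : Finset (Fin (2 * j + 1))).sigma fun i =>
        Finset.powersetCard j (Finset.univ.erase i)).card := by
    symm
    refine Finset.card_bij (fun p _ => walk (oneFlatSteps p.1 p.2)) ?_ ?_ ?_
    · rintro ⟨i, U⟩ hp
      simp only [Finset.mem_sigma, Finset.mem_univ, true_and, Finset.mem_powersetCard] at hp
      have hi : i ∉ U := fun h => Finset.notMem_erase i _ (hp.1 h)
      rw [Finset.mem_filter, mem_paths, walk_zero, walk_last, sum_oneFlatSteps hi, hp.2,
        card_flats]
      simp only [walk_succ, add_sub_cancel_left]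
      refine ⟨⟨trivial, by push_cast; ring, fun t => ?_⟩, ?_⟩
      · rw [oneFlatSteps]
        split_ifs <;> simp
      · rw [Finset.card_eq_one]
        refine ⟨i, ?_⟩
        ext s
        rw [Finset.mem_filter, Finset.mem_singleton, oneFlatSteps]
        split_ifs with h1 h2 <;> simp [h1]
    · rintro ⟨i, U⟩ hp ⟨i', U'⟩ hp' h
      simp only [Finset.mem_sigma, Finset.mem_univ, true_and, Finset.mem_powersetCard] at hp hp'
      have hi : i ∉ U := fun h => Finset.notMem_erase i _ (hp.1 h)
      have hi' : i' ∉ U' := fun h => Finset.notMem_erase i' _ (hp'.1 h)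
      have hstep : ∀ t, oneFlatSteps i U t = oneFlatSteps i' U' t := fun t => by
        have h1 := walk_succ (oneFlatSteps i U) t
        have h2 := walk_succ (oneFlatSteps i' U') t
        dsimp only at h
        rw [h] at h1
        linarith
      have hii : i = i' := by
        have := hstep i
        simp only [oneFlatSteps, if_true] at this
        by_contra hne
        rw [if_neg hne] at this
        split_ifs at this
        all_goals omega
      subst hii
      have : U = U' := by
        ext s
        have h1 := hstep s
        simp only [oneFlatSteps] at h1
        by_cases hs : s = i
        · subst hs
          exact iff_of_false hi hi'
        · rw [if_neg hs, if_neg hs] at h1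
          split_ifs at h1 <;> simp_all
      rw [this]
    · intro y hy
      rw [Finset.mem_filter, mem_paths, card_flats, Finset.card_eq_one] at hy
      obtain ⟨⟨h0, hl, hs⟩, i, hi⟩ := hy
      have hi' : ∀ t : Fin (2 * j + 1), y t.succ - y t.castSucc = 0 ↔ t = i := fun t => by
        have := Finset.ext_iff.mp hi t
        simpa using this
      set U := Finset.univ.filter fun t : Fin (2 * j + 1) => y t.succ - y t.castSucc = 1 with hU
      have hiU : i ∉ U := by
        rw [hU, Finset.mem_filter, (hi' i).mpr rfl]
        simp
      have hstep : (fun t : Fin (2 * j + 1) => y t.succ - y t.castSucc) = oneFlatSteps i U := by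
        ext t
        rw [oneFlatSteps]
        split_ifs with h1 h2
        · exact (hi' t).mpr h1
        · exact (Finset.mem_filter.mp h2).2
        · have h3 := mt (hi' t).mp h1
          have h4 : ¬ y t.succ - y t.castSucc = 1 := fun h => h2 (by simp [hU, h])
          have h5 := abs_le.mp (hs t)
          omega
      have hy : y = walk (oneFlatSteps i U) := by rw [← hstep]; exact eq_walk h0
      refine ⟨⟨i, U⟩, ?_, hy.symm⟩
      simp only [Finset.mem_sigma, Finset.mem_univ, true_and, Finset.mem_powersetCard]
      refine ⟨fun s hsU => Finset.mem_erase.mpr ⟨fun h => hiU (h ▸ hsU), Finset.mem_univ _⟩, ?_⟩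
      have h1 := sum_oneFlatSteps hiU
      rw [← walk_last, ← hy, hl] at h1
      push_cast at h1
      omega
  rw [pathCount_one, key, Finset.card_sigma]
  simp only [Finset.card_powersetCard, Finset.card_erase_of_mem (Finset.mem_univ _),
    Finset.card_univ, Fintype.card_fin, Finset.sum_const, smul_eq_mul, Nat.add_sub_cancel]
  have h1 : ((2 * j).choose j : ℝ) * (j.factorial : ℝ) ^ 2 = ((2 * j).factorial : ℝ) := by
    have := Nat.choose_mul_factorial_mul_factorial (n := 2 * j) (k := j) (by omega)
    rw [show 2 * j - j = j by omega] at this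
    rw [← this]
    push_cast
    ring
  rw [eq_div_iff (by positivity), Nat.factorial_succ]
  push_cast
  rw [mul_assoc, h1]

lemma pathCount_del_zero_even {k : ℕ} (hk : Even k) : pathCount k (del 0) = 0 := by
  rw [pathCount_one, Nat.cast_eq_zero, Finset.card_eq_zero, Finset.filter_eq_empty_iff]
  intro y hy h1
  have hpar := even_sub_card_flats hy
  rw [h1, Int.even_sub, Int.even_coe_nat] at hpar
  have := hpar.mp hk
  norm_num at this

lemma coeff_Qpoly {m k : ℕ} (hk : k ≤ m) : (Qpoly m).coeff k = pathCount k (del 0) := by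
  simp only [Qpoly, finsetSum_coeff, coeff_C_mul, coeff_X_pow, mul_ite, mul_one, mul_zero]
  rcases Nat.even_or_odd' k with ⟨j, rfl | rfl⟩
  · rw [pathCount_del_zero_even ⟨j, by ring⟩]
    exact Finset.sum_eq_zero fun i _ => if_neg (by omega)
  · rw [pathCount_del_zero_odd, Finset.sum_eq_single j]
    · rw [if_pos rfl]
    · intro i _ hij
      rw [if_neg (by omega)]
    · intro hj
      rw [Finset.mem_range] at hj
      omega

lemma coeffInner_Qpoly (m : ℕ) (P : ℝ[X]) : coeffInner m P (Qpoly m) = shapeCoeff m P (del 0) :=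
  Finset.sum_congr rfl fun k hk => by
    rw [coeff_Qpoly (Nat.lt_succ_iff.mp (Finset.mem_range.mp hk))]


/-! ### Path counts of low and of extremal order -/

/-- Paths are encoded by their steps, shifted to take the values `0`, `1` and `2`. -/
lemma pathCount_eq_card_steps {k : ℕ} {β : ℤ →₀ ℕ} {p : (Fin (k + 1) → ℤ) → Prop}
    [DecidablePred p] (h : ∀ y ∈ paths k, y ∈ pathSet k β ↔ p y) :
    pathCount k β = (Finset.univ.filter fun d : Fin k → Fin 3 =>
      walk (fun t => ((d t : ℕ) : ℤ) - 1) (Fin.last k) = 0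
        ∧ p (walk fun t => ((d t : ℕ) : ℤ) - 1)).card := by
  rw [pathCount_eq h]
  congr 1
  symm
  refine Finset.card_bij (fun d _ => walk fun t => ((d t : ℕ) : ℤ) - 1) ?_ ?_ ?_
  · intro d hd
    rw [Finset.mem_filter] at hd
    rw [Finset.mem_filter, mem_paths]
    refine ⟨⟨walk_zero _, hd.2.1, fun t => ?_⟩, hd.2.2⟩
    rw [walk_succ, add_sub_cancel_left, abs_le]
    have := (d t).isLt
    omega
  · intro d _ d' _ hdd
    ext t
    have h1 := walk_succ (fun t => ((d t : ℕ) : ℤ) - 1) t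
    have h2 := walk_succ (fun t => ((d' t : ℕ) : ℤ) - 1) t
    rw [hdd] at h1
    omega
  · intro y hy
    rw [Finset.mem_filter, mem_paths] at hy
    obtain ⟨⟨h0, hl, hs⟩, hp⟩ := hy
    have hb : ∀ t : Fin k, 0 ≤ y t.succ - y t.castSucc + 1 ∧ y t.succ - y t.castSucc + 1 < 3 :=
      fun t => by
        have := abs_le.mp (hs t)
        omega
    have hd : ∀ d : Fin k → Fin 3, (∀ t, ((d t : ℕ) : ℤ) = y t.succ - y t.castSucc + 1) →
        (walk fun t => ((d t : ℕ) : ℤ) - 1) = y := fun d hd => by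
      simp only [hd, add_sub_cancel_right]
      exact (eq_walk h0).symm
    have hy := hd (fun t => ⟨(y t.succ - y t.castSucc + 1).toNat, by have := hb t; omega⟩)
      fun t => Int.toNat_of_nonneg (hb t).1
    refine ⟨fun t => ⟨(y t.succ - y t.castSucc + 1).toNat, by have := hb t; omega⟩, ?_, hy⟩
    rw [Finset.mem_filter, hy]
    exact ⟨Finset.mem_univ _, hl, hp⟩

/-- A version of the membership criterion in which the lowest level is one that is visited. -/
lemma mem_pathSet_three' {k s t : ℕ} {y : Fin (k + 1) → ℤ} (hy : y ∈ paths k) :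
    y ∈ pathSet k (del 0 + del s + del (s + t)) ↔
      ∃ n : Fin (k + 1), flats y = {y n, y n + s, y n + s + t} := by
  rw [mem_pathSet_three hy]
  constructor
  · rintro ⟨i, hi⟩
    obtain ⟨n, hn⟩ := mem_flats (y := y) (h := i) (by simp [hi])
    exact ⟨n, by rw [hn, hi]⟩
  · rintro ⟨n, hn⟩
    exact ⟨_, hn⟩

lemma pathCount_three_deltas : pathCount 3 (del 0 + del 0 + del (0 + 0)) = 1 := by
  rw [pathCount_eq_card_steps fun y hy => mem_pathSet_three' hy, Nat.cast_eq_one]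
  decide +kernel

lemma pathCount_five_deltas : pathCount 5 (del 0 + del 0 + del (0 + 0)) = 10 := by
  refine (pathCount_eq_card_steps fun y hy => mem_pathSet_three' hy).trans
    ((congrArg Nat.cast ?_).trans Nat.cast_ofNat)
  decide +kernel

lemma pathCount_five_two_one : pathCount 5 (del 0 + del 0 + del (0 + 1)) = 5 := by
  refine (pathCount_eq_card_steps fun y hy => mem_pathSet_three' hy).trans
    ((congrArg Nat.cast ?_).trans Nat.cast_ofNat)
  decide +kernel

lemma pathCount_five_one_two : pathCount 5 (del 0 + del 1 + del (1 + 0)) = 5 := by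
  refine (pathCount_eq_card_steps fun y hy => mem_pathSet_three' hy).trans
    ((congrArg Nat.cast ?_).trans Nat.cast_ofNat)
  decide +kernel

lemma flats_eq_map {k : ℕ} {y : Fin (k + 1) → ℤ} {S : Finset (Fin k)}
    (h : ∀ t, y t.castSucc = y t.succ ↔ t ∈ S) : flats y = S.val.map fun t => y t.castSucc := by
  have : Finset.univ.filter (fun t : Fin k => y t.castSucc = y t.succ) = S := by
    ext t
    simp [h]
  rw [flats, this]

/-- There is a path with flat steps at the levels `0` and `s` that has no more steps than
necessary. -/
lemma pathCount_two_pos (s : ℕ) : 0 < pathCount (2 * s + 2) (del 0 + del s) := by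
  classical
  rw [pathCount_two, Nat.cast_pos, Finset.card_pos]
  set y : Fin (2 * s + 2 + 1) → ℤ := fun t => ((min (t - 1 : ℕ) (2 * s + 2 - t) : ℕ) : ℤ) with hy
  refine ⟨y, Finset.mem_filter.mpr ⟨mem_paths.mpr ⟨?_, ?_, fun t => ?_⟩, 0, ?_⟩⟩
  · simp only [hy, Fin.val_zero]
    omega
  · simp only [hy, Fin.val_last]
    omega
  · have := t.isLt
    simp only [hy, Fin.val_succ, Fin.val_castSucc]
    rw [abs_le]
    omega
  · rw [flats_eq_map (S := {⟨0, by omega⟩, ⟨s + 1, by omega⟩})]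
    · rw [Finset.insert_val_of_notMem (by simp [Fin.ext_iff])]
      simp only [Finset.singleton_val, Multiset.map_cons, Multiset.map_singleton, hy,
        Fin.val_castSucc, Multiset.insert_eq_cons]
      congr 1
      rw [Multiset.singleton_inj]
      omega
    · intro t
      have := t.isLt
      simp only [hy, Fin.val_succ, Fin.val_castSucc, Finset.mem_insert, Finset.mem_singleton,
        Fin.ext_iff]
      omega

/-- There is a path with flat steps at the levels `0`, `1` and `n + 2` that has no more steps than
necessary. -/
lemma pathCount_three_pos (n : ℕ) :
    0 < pathCount (2 * n + 7) (del 0 + del 1 + del (1 + (n + 1))) := by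
  classical
  rw [pathCount_three, Nat.cast_pos, Finset.card_pos]
  set y : Fin (2 * n + 7 + 1) → ℤ := fun t =>
    ((min (max (min (t - 1 : ℕ) 1) (t - 2)) (2 * n + 7 - t) : ℕ) : ℤ) with hy
  refine ⟨y, Finset.mem_filter.mpr ⟨mem_paths.mpr ⟨?_, ?_, fun t => ?_⟩, 0, ?_⟩⟩
  · simp only [hy, Fin.val_zero]
    omega
  · simp only [hy, Fin.val_last]
    omega
  · have := t.isLt
    simp only [hy, Fin.val_succ, Fin.val_castSucc]
    rw [abs_le]
    omega
  · rw [flats_eq_map (S := {⟨0, by omega⟩, ⟨2, by omega⟩, ⟨n + 4, by omega⟩})]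
    · rw [Finset.insert_val_of_notMem (by simp [Fin.ext_iff]),
        Finset.insert_val_of_notMem (by simp [Fin.ext_iff])]
      simp only [Finset.singleton_val, Multiset.map_cons, Multiset.map_singleton, hy,
        Fin.val_castSucc, Multiset.insert_eq_cons]
      congr 1
      congr 1
      rw [Multiset.singleton_inj]
      omega
    · intro t
      have := t.isLt
      simp only [hy, Fin.val_succ, Fin.val_castSucc, Finset.mem_insert, Finset.mem_singleton,
        Fin.ext_iff]
      omega

lemma shapeCoeff_of_natDegree_le {m n : ℕ} {P : ℝ[X]} (hm : P.natDegree ≤ m)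
    (hn : P.natDegree ≤ n) (β : ℤ →₀ ℕ) : shapeCoeff m P β = shapeCoeff n P β := by
  have key : ∀ {m}, P.natDegree ≤ m →
      shapeCoeff m P β = ∑ k ∈ Finset.range (P.natDegree + 1), P.coeff k * pathCount k β := by
    intro m hm
    refine (Finset.sum_subset (Finset.range_mono (by omega)) fun k _ hk => ?_).symm
    rw [Finset.mem_range, not_lt] at hk
    rw [coeff_eq_zero_of_natDegree_lt (by omega), zero_mul]
  rw [key hm, key hn]

/-- The coefficient of a shape that only occurs in degree `P.natDegree` and above. -/
lemma shapeCoeff_eq_leadingCoeff_mul {m : ℕ} {P : ℝ[X]} (hm : P.natDegree ≤ m) {β : ℤ →₀ ℕ}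
    (h : ∀ k < P.natDegree, pathCount k β = 0) :
    shapeCoeff m P β = P.leadingCoeff * pathCount P.natDegree β := by
  rw [shapeCoeff_of_natDegree_le hm le_rfl, shapeCoeff, Finset.sum_range_succ,
    Finset.sum_eq_zero fun k hk => by rw [h k (Finset.mem_range.mp hk), mul_zero], zero_add]
  rfl


lemma BoundedIID.variance_eq {Ω : Type*} {mΩ : MeasurableSpace Ω} {μ : Measure Ω} {X : ℕ → Ω → ℝ}
    {B : ℝ} (h : BoundedIID μ X B) : variance (X 0) μ = mom μ (X 0) 2 :=
  variance_eq_mom (h.meas 0).aemeasurable h.mean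

section Nondegenerate

variable {Ω : Type*} {mΩ : MeasurableSpace Ω} {μ : Measure Ω} [IsProbabilityMeasure μ]
  {X : ℕ → Ω → ℝ} {B : ℝ}

/-! ### Moment inequalities -/

lemma BoundedIID.expect_cubic_sq (h : BoundedIID μ X B) (c0 c1 c2 c3 : ℝ) :
    expect μ X (fun x => (c0 + c1 * x 0 + c2 * x 0 ^ 2 + c3 * x 0 ^ 3) ^ 2) =
      c0 ^ 2 + (c1 ^ 2 + 2 * c0 * c2) * mom μ (X 0) 2 + (2 * c0 * c3 + 2 * c1 * c2) * mom μ (X 0) 3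
        + (c2 ^ 2 + 2 * c1 * c3) * mom μ (X 0) 4 + 2 * c2 * c3 * mom μ (X 0) 5
        + c3 ^ 2 * mom μ (X 0) 6 := by
  have := h.expect_poly (2 * c0 * c1) (c1 ^ 2 + 2 * c0 * c2) (2 * c0 * c3 + 2 * c1 * c2)
    (c2 ^ 2 + 2 * c1 * c3) (2 * c2 * c3) (c3 ^ 2) (c0 ^ 2)
  convert this using 1
  · congr 1
    ext x
    ring
  · ring

lemma BoundedIID.cubic_sq_nonneg (h : BoundedIID μ X B) (c0 c1 c2 c3 : ℝ) :
    0 ≤ c0 ^ 2 + (c1 ^ 2 + 2 * c0 * c2) * mom μ (X 0) 2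
        + (2 * c0 * c3 + 2 * c1 * c2) * mom μ (X 0) 3
        + (c2 ^ 2 + 2 * c1 * c3) * mom μ (X 0) 4 + 2 * c2 * c3 * mom μ (X 0) 5
        + c3 ^ 2 * mom μ (X 0) 6 := by
  rw [← h.expect_cubic_sq]
  exact integral_nonneg fun ω => sq_nonneg _

lemma BoundedIID.variance_sq_eq (h : BoundedIID μ X B) :
    variance (fun ω => X 0 ω ^ 2) μ = mom μ (X 0) 4 - mom μ (X 0) 2 ^ 2 := by
  have hb : ∀ ω, |X 0 ω ^ 2| ≤ B ^ 2 := fun ω => by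
    rw [abs_pow]
    exact pow_le_pow_left₀ (abs_nonneg _) (h.bound 0 ω) 2
  rw [variance_eq_sub (memLp_two_of_abs_le ((h.meas 0).pow_const 2).aestronglyMeasurable hb)]
  simp only [mom, Pi.pow_apply, ← pow_mul]

/-- The squared covariance of `X` and `X²` is at most the product of their variances. -/
lemma BoundedIID.mom_three_sq_le (h : BoundedIID μ X B) (hM : 0 < mom μ (X 0) 2) :
    mom μ (X 0) 3 ^ 2 ≤ mom μ (X 0) 2 * (mom μ (X 0) 4 - mom μ (X 0) 2 ^ 2) := by
  have := h.cubic_sq_nonneg (-mom μ (X 0) 2 ^ 2) (-mom μ (X 0) 3) (mom μ (X 0) 2) 0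
  refine le_of_mul_le_mul_left ?_ hM
  linarith

/-- The squared covariance of `X` and `X³` is at most the product of their variances. -/
lemma BoundedIID.mom_four_sq_le (h : BoundedIID μ X B) (hM : 0 < mom μ (X 0) 2) :
    mom μ (X 0) 4 ^ 2 ≤ mom μ (X 0) 2 * (mom μ (X 0) 6 - mom μ (X 0) 3 ^ 2) := by
  have := h.cubic_sq_nonneg (mom μ (X 0) 2 * mom μ (X 0) 3) (mom μ (X 0) 4) 0 (-mom μ (X 0) 2)
  refine le_of_mul_le_mul_left ?_ hM
  linarith

/-- If `X²` is constant, then so is `X⁶`. -/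
lemma BoundedIID.mom_six_le (h : BoundedIID μ X B)
    (hV : mom μ (X 0) 4 = mom μ (X 0) 2 ^ 2) : mom μ (X 0) 6 ≤ mom μ (X 0) 2 ^ 3 := by
  have h1 := h.expect_cubic_sq 0 (-mom μ (X 0) 2) 0 1
  have h2 := h.expect_cubic_sq (-mom μ (X 0) 2) 0 1 0
  have h3 : expect μ X (fun x => (0 + -mom μ (X 0) 2 * x 0 + 0 * x 0 ^ 2 + 1 * x 0 ^ 3) ^ 2) ≤
      B ^ 2 * expect μ X (fun x => (-mom μ (X 0) 2 + 0 * x 0 + 1 * x 0 ^ 2 + 0 * x 0 ^ 3) ^ 2) := by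
    rw [← expect_const_mul]
    have hc : ∀ j, IsBddWindow B 0 fun x : ℕ → ℝ => x 0 ^ j := fun j =>
      (IsBddWindow.coord le_rfl).pow j
    have hw : ∀ c0 c1 c2 c3 : ℝ, IsBddWindow B 0 fun x : ℕ → ℝ =>
        (c0 + c1 * x 0 + c2 * x 0 ^ 2 + c3 * x 0 ^ 3) ^ 2 := fun c0 c1 c2 c3 =>
      ((((IsBddWindow.const c0).add ((IsBddWindow.coord le_rfl).const_mul c1)).add
        ((hc 2).const_mul c2)).add ((hc 3).const_mul c3)).pow 2
    refine integral_mono (h.integrable_window (hw _ _ _ _) 0)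
      (h.integrable_window ((hw _ _ _ _).const_mul _) 0) fun ω => ?_
    have hb : shift X 0 ω 0 ^ 2 ≤ B ^ 2 := by
      rw [← sq_abs (shift X 0 ω 0)]
      exact pow_le_pow_left₀ (abs_nonneg _) (h.bound _ ω) 2
    have := mul_le_mul_of_nonneg_right hb (sq_nonneg (-mom μ (X 0) 2 + shift X 0 ω 0 ^ 2))
    dsimp only
    linarith
  rw [h1, h2, hV] at h3
  linarith

/-! ### Positivity of the limiting variances -/

lemma exists_coeff_ne_zero {P : ℝ[X]} (hd : 0 < P.natDegree) : P.coeff P.natDegree ≠ 0 := by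
  have : P ≠ 0 := by
    rintro rfl
    simp at hd
  exact leadingCoeff_ne_zero.mpr this

/-- The limiting variance is a sum of squares. If `deg P = 2 s + 2`, only the leading coefficient
contributes to the shape with flat steps at the levels `0` and `s`. -/
theorem BoundedIID.varE_pos_iff (h : BoundedIID μ X B) (hM : 0 < mom μ (X 0) 2) {m : ℕ} {P : ℝ[X]}
    (hP : P.natDegree ≤ m) (hd : 0 < P.natDegree) (heven : ∀ k, Odd k → P.coeff k = 0) :
    0 < varE μ (X 0) m P ↔ (0 < variance (fun ω => X 0 ω ^ 2) μ ∨ 2 < P.natDegree) := by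
  have hlead := exists_coeff_ne_zero hd
  have hne : Even P.natDegree := by
    rw [← Nat.not_odd_iff_even]
    exact fun ho => hlead (heven _ ho)
  obtain ⟨s, hs⟩ : ∃ s, P.natDegree = 2 * s + 2 := by
    obtain ⟨c, hc⟩ := hne
    exact ⟨c - 1, by omega⟩
  have hV : 0 ≤ variance (fun ω => X 0 ω ^ 2) μ := variance_nonneg _ _
  have htop : shapeCoeff m P (del 0 + del s) ≠ 0 := by
    rw [shapeCoeff_eq_leadingCoeff_mul hP fun k hk => pathCount_two_eq_zero (by omega)]
    have hp := (pathCount_two_pos s).ne'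
    rw [← hs] at hp
    exact mul_ne_zero hlead hp
  rw [varE_eq h.variance_eq heven, ← h.variance_sq_eq]
  have hsum : 0 ≤ ∑ s ∈ Finset.range m, shapeCoeff m P (del 0 + del (s + 1)) ^ 2 :=
    Finset.sum_nonneg fun _ _ => sq_nonneg _
  have h1 : 0 ≤ shapeCoeff m P (del 0 + del 0) ^ 2 * variance (fun ω => X 0 ω ^ 2) μ :=
    mul_nonneg (sq_nonneg _) hV
  have h2 : 0 ≤ (∑ s ∈ Finset.range m, shapeCoeff m P (del 0 + del (s + 1)) ^ 2)
      * mom μ (X 0) 2 ^ 2 := mul_nonneg hsum (sq_nonneg _)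
  rcases Nat.eq_zero_or_pos s with rfl | hs0
  · have hz : ∑ s ∈ Finset.range m, shapeCoeff m P (del 0 + del (s + 1)) ^ 2 = 0 := by
      refine Finset.sum_eq_zero fun s _ => ?_
      rw [shapeCoeff_eq_leadingCoeff_mul hP fun k hk => pathCount_two_eq_zero (by omega),
        pathCount_two_eq_zero (by omega), mul_zero, zero_pow two_ne_zero]
    rw [hz, zero_mul, add_zero, or_iff_left (by omega)]
    exact ⟨fun h => by_contra fun h' => by
      rw [le_antisymm (not_lt.mp h') hV, mul_zero] at h
      exact h.false, fun h => mul_pos (lt_of_le_of_ne (sq_nonneg _) (pow_ne_zero 2 htop).symm) h⟩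
  · refine iff_of_true (add_pos_of_nonneg_of_pos h1 (mul_pos ?_ (pow_pos hM 2)))
      (Or.inr (by omega))
    refine Finset.sum_pos' (fun _ _ => sq_nonneg _) ⟨s - 1, Finset.mem_range.mpr (by omega), ?_⟩
    rw [Nat.sub_add_cancel hs0]
    exact lt_of_le_of_ne (sq_nonneg _) (pow_ne_zero 2 htop).symm

end Nondegenerate


/-! ### Positivity for odd polynomials -/

section NondegeneratePerp

variable {Ω : Type*} {mΩ : MeasurableSpace Ω} {μ : Measure Ω} [IsProbabilityMeasure μ]
  {X : ℕ → Ω → ℝ} {B : ℝ}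

/-- Shape coefficients of odd polynomials of degree at most five. -/
lemma shapeCoeff_of_natDegree_le_five {m : ℕ} {P : ℝ[X]} (hP : P.natDegree ≤ m)
    (h5 : P.natDegree ≤ 5) (hodd : ∀ k, Even k → P.coeff k = 0) (β : ℤ →₀ ℕ) :
    shapeCoeff m P β = P.coeff 1 * pathCount 1 β + P.coeff 3 * pathCount 3 β
      + P.coeff 5 * pathCount 5 β := by
  rw [shapeCoeff_of_natDegree_le hP h5, shapeCoeff]
  simp only [Finset.sum_range_succ, Finset.sum_range_zero, hodd 0 (by decide), hodd 2 (by decide),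
    hodd 4 (by decide)]
  ring

lemma shapeCoeff_del_zero_of_natDegree_le_five {m : ℕ} {P : ℝ[X]} (hP : P.natDegree ≤ m)
    (h5 : P.natDegree ≤ 5) (hodd : ∀ k, Even k → P.coeff k = 0) :
    shapeCoeff m P (del 0) = P.coeff 1 + 6 * P.coeff 3 + 30 * P.coeff 5 := by
  have h1 := pathCount_del_zero_odd 0
  have h3 := pathCount_del_zero_odd 1
  have h5' := pathCount_del_zero_odd 2
  norm_num [Nat.factorial] at h1 h3 h5'
  rw [shapeCoeff_of_natDegree_le_five hP h5 hodd, h1, h3, h5']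
  ring

/-- An odd polynomial of degree at most five orthogonal to `Q_m` is determined by its coefficients
of degree three and five. -/
lemma eq_exceptional_iff {m : ℕ} {P : ℝ[X]} (hP : P.natDegree ≤ m)
    (h5 : P.natDegree ≤ 5) (hodd : ∀ k, Even k → P.coeff k = 0) (h0 : shapeCoeff m P (del 0) = 0) :
    (∃ a : ℝ, P = Polynomial.C a * (Polynomial.C (1 / 5) * Polynomial.X ^ 5
      - Polynomial.C 4 * Polynomial.X ^ 3 + Polynomial.C 18 * Polynomial.X)) ↔
      P.coeff 3 + 20 * P.coeff 5 = 0 := by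
  rw [shapeCoeff_del_zero_of_natDegree_le_five hP h5 hodd] at h0
  constructor
  · rintro ⟨a, ha⟩
    have e3 : P.coeff 3 = a * (-4) := by
      rw [ha]
      simp [coeff_X_pow]
    have e5 : P.coeff 5 = a * (1 / 5) := by
      rw [ha]
      simp [coeff_X_pow]
    rw [e3, e5]
    ring
  · intro h
    refine ⟨5 * P.coeff 5, ?_⟩
    have e3 : P.coeff 3 = -20 * P.coeff 5 := by linarith
    have e1 : P.coeff 1 = 90 * P.coeff 5 := by linarith
    ext k
    rw [coeff_C_mul, coeff_add, coeff_sub, coeff_C_mul, coeff_C_mul, coeff_C_mul, coeff_X_pow,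
      coeff_X_pow, coeff_X]
    rcases Nat.lt_or_ge 5 k with hk | hk
    · rw [coeff_eq_zero_of_natDegree_lt (by omega), if_neg (by omega), if_neg (by omega),
        if_neg (by omega)]
      ring
    · interval_cases k
      · simp [hodd 0 (by decide)]
      · norm_num [e1]
        ring
      · simp [hodd 2 (by decide)]
      · norm_num [e3]
        ring
      · simp [hodd 4 (by decide)]
      · norm_num
        ring

/-- The quadratic form of the moments that gives the limiting variance is at least the contribution
of the shapes with three distinct levels. -/
lemma BoundedIID.sum_le_varPerp (h : BoundedIID μ X B) (hM : 0 < mom μ (X 0) 2) (m : ℕ)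
    (a : ℝ) (b c : ℕ → ℝ) (S ρ : ℝ) :
    S * mom μ (X 0) 2 ^ 3 ≤ a ^ 2 * (mom μ (X 0) 6 - mom μ (X 0) 3 ^ 2)
      + ((ρ * mom μ (X 0) 2) ^ 2
        + (∑ t ∈ Finset.range m, b t ^ 2) * (mom μ (X 0) 4 - mom μ (X 0) 2 ^ 2)
        + S * mom μ (X 0) 2 ^ 2) * mom μ (X 0) 2
      + (∑ s ∈ Finset.range m, c s ^ 2) * mom μ (X 0) 2 * (mom μ (X 0) 4 - mom μ (X 0) 2 ^ 2)
      + 2 * a * (ρ * mom μ (X 0) 2) * mom μ (X 0) 4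
      + 2 * (∑ t ∈ Finset.range m, b t * c t) * mom μ (X 0) 3 ^ 2 := by
  have h1 := h.cubic_sq_nonneg (-a * mom μ (X 0) 3) (ρ * mom μ (X 0) 2) 0 a
  have h2 := h.mom_three_sq_le hM
  -- `2 b c M₃² ≥ - (b² + c²) M₃²`, and the covariance of `X` and `X²` is controlled
  have h3 : 0 ≤ (∑ t ∈ Finset.range m, b t ^ 2 + ∑ s ∈ Finset.range m, c s ^ 2)
      * (mom μ (X 0) 2 * (mom μ (X 0) 4 - mom μ (X 0) 2 ^ 2) - mom μ (X 0) 3 ^ 2) :=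
    mul_nonneg (add_nonneg (Finset.sum_nonneg fun _ _ => sq_nonneg _)
      (Finset.sum_nonneg fun _ _ => sq_nonneg _)) (sub_nonneg.mpr h2)
  have h4 : 0 ≤ (∑ t ∈ Finset.range m, b t ^ 2 + ∑ s ∈ Finset.range m, c s ^ 2
      + 2 * ∑ t ∈ Finset.range m, b t * c t) * mom μ (X 0) 3 ^ 2 := by
    refine mul_nonneg ?_ (sq_nonneg _)
    rw [Finset.mul_sum, ← Finset.sum_add_distrib, ← Finset.sum_add_distrib]
    refine Finset.sum_nonneg fun t _ => ?_
    have := sq_nonneg (b t + c t)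
    linarith
  linarith

/-- For polynomials of degree at most five, with coefficients `p` and `q` of `x³` and `x⁵`, the
limiting variance only vanishes in the exceptional case. -/
lemma BoundedIID.cubic_form_pos_iff (h : BoundedIID μ X B) (hM : 0 < mom μ (X 0) 2) {p q : ℝ}
    (hpq : q = 0 → p ≠ 0) :
    0 < (p + 10 * q) ^ 2 * (mom μ (X 0) 6 - mom μ (X 0) 3 ^ 2)
      + (((5 * q + 5 * q) * mom μ (X 0) 2) ^ 2
        + (5 * q) ^ 2 * (mom μ (X 0) 4 - mom μ (X 0) 2 ^ 2)
        + 0 * mom μ (X 0) 2 ^ 2) * mom μ (X 0) 2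
      + (5 * q) ^ 2 * mom μ (X 0) 2 * (mom μ (X 0) 4 - mom μ (X 0) 2 ^ 2)
      + 2 * (p + 10 * q) * ((5 * q + 5 * q) * mom μ (X 0) 2) * mom μ (X 0) 4
      + 2 * (5 * q * (5 * q)) * mom μ (X 0) 3 ^ 2 ↔
    ¬ (mom μ (X 0) 4 - mom μ (X 0) 2 ^ 2 = 0 ∧ p + 20 * q = 0) := by
  have h1 := h.cubic_sq_nonneg (-(p + 10 * q) * mom μ (X 0) 3) (10 * q * mom μ (X 0) 2) 0
    (p + 10 * q)
  have h3 := h.mom_three_sq_le hM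
  have h4 := h.mom_four_sq_le hM
  have h6 := h.mom_six_le
  have hV : 0 ≤ mom μ (X 0) 4 - mom μ (X 0) 2 ^ 2 := by
    rw [← h.variance_sq_eq]
    exact variance_nonneg _ _
  set M := mom μ (X 0) 2
  set M3 := mom μ (X 0) 3
  set M4 := mom μ (X 0) 4
  set M6 := mom μ (X 0) 6
  rcases hV.eq_or_lt with hV0 | hV0
  · rw [← hV0, mul_zero] at h3
    have e3 : M3 = 0 := by
      have := le_antisymm h3 (sq_nonneg _)
      simpa using this
    have e4 : M4 = M ^ 2 := by linarith
    have e6 : M6 = M ^ 3 := by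
      refine le_antisymm (h6 e4) (le_of_mul_le_mul_left ?_ hM)
      rw [e3, e4] at h4
      linarith
    rw [e3, e4, e6]
    have : (p + 10 * q) ^ 2 * (M ^ 3 - 0 ^ 2) + (((5 * q + 5 * q) * M) ^ 2
        + (5 * q) ^ 2 * (M ^ 2 - M ^ 2) + 0 * M ^ 2) * M + (5 * q) ^ 2 * M * (M ^ 2 - M ^ 2)
        + 2 * (p + 10 * q) * ((5 * q + 5 * q) * M) * M ^ 2 + 2 * (5 * q * (5 * q)) * 0 ^ 2 =
        (p + 20 * q) ^ 2 * M ^ 3 := by ring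
    rw [this, mul_pos_iff_of_pos_right (pow_pos hM 3), sub_self, sq_pos_iff]
    simp
  · refine iff_of_true ?_ fun h' => hV0.ne' h'.1
    rcases eq_or_ne q 0 with rfl | hq
    · have h5 : 0 < M6 - M3 ^ 2 := by
        refine pos_of_mul_pos_right (lt_of_lt_of_le ?_ h4) hM.le
        exact pow_pos (by linarith [sq_nonneg M]) 2
      have := mul_pos (sq_pos_iff.mpr (hpq rfl)) h5
      linarith
    · have h5 : 0 < 50 * q ^ 2 * (M * (M4 - M ^ 2)) :=
        mul_pos (mul_pos (by norm_num) (sq_pos_iff.mpr hq)) (mul_pos hM hV0)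
      have h7 : 0 ≤ 50 * q ^ 2 * M3 ^ 2 :=
        mul_nonneg (mul_nonneg (by norm_num) (sq_nonneg q)) (sq_nonneg M3)
      linarith

/-- In degree at least seven, only the leading coefficient contributes to a shape with three
distinct levels, whose coefficient enters the variance through its square; in degree at most five
the variance is an explicit quadratic form in the coefficients of `x³` and `x⁵`. -/
theorem BoundedIID.varPerp_pos_iff (h : BoundedIID μ X B) (hM : 0 < mom μ (X 0) 2) {m : ℕ}
    {P : ℝ[X]} (hP : P.natDegree ≤ m) (hd : 0 < P.natDegree)
    (hodd : ∀ k, Even k → P.coeff k = 0) (h0 : shapeCoeff m P (del 0) = 0) :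
    0 < varPerp μ (X 0) m P ↔
      ¬ (variance (fun ω => X 0 ω ^ 2) μ = 0 ∧
        ∃ a : ℝ, P = Polynomial.C a * (Polynomial.C (1 / 5) * Polynomial.X ^ 5
          - Polynomial.C 4 * Polynomial.X ^ 3 + Polynomial.C 18 * Polynomial.X)) := by
  have hlead := exists_coeff_ne_zero hd
  have hno : Odd P.natDegree := by
    rw [← Nat.not_even_iff_odd]
    exact fun ho => hlead (hodd _ ho)
  rw [varPerp_eq hodd rfl]
  rcases Nat.lt_or_ge 5 P.natDegree with h7 | h5
  · -- the shape with three distinct levels of maximal distance contributes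
    obtain ⟨n, hn⟩ : ∃ n, P.natDegree = 2 * n + 7 := by
      obtain ⟨c, hc⟩ := hno
      exact ⟨c - 3, by omega⟩
    refine iff_of_true ?_ ?_
    · refine lt_of_lt_of_le ?_ (h.sum_le_varPerp hM m _ _ _ _ _)
      refine mul_pos (Finset.sum_pos' (fun _ _ => sq_nonneg _) ⟨(0, n), ?_, ?_⟩) (pow_pos hM 3)
      · rw [Finset.mem_product, Finset.mem_range, Finset.mem_range]
        dsimp only
        omega
      · refine lt_of_le_of_ne (sq_nonneg _) (pow_ne_zero 2 ?_).symm
        rw [shapeCoeff_eq_leadingCoeff_mul hP fun k hk => pathCount_three_eq_zero (by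
          dsimp only
          omega)]
        have hp := (pathCount_three_pos n).ne'
        rw [← hn] at hp
        exact mul_ne_zero hlead hp
    · rintro ⟨-, a, ha⟩
      have h1 : P.natDegree ≤ 5 := by
        rw [ha]
        compute_degree
      omega
  · have hdel := shapeCoeff_del_zero_of_natDegree_le_five hP h5 hodd
    rw [h0] at hdel
    -- the linear polynomials are multiples of `x`, which is not orthogonal to `Q_m`
    have hm : 3 ≤ P.natDegree := by
      by_contra h3
      have h1 : P.natDegree = 1 := by
        obtain ⟨c, hc⟩ := hno
        omega
      rw [h1] at hlead
      rw [coeff_eq_zero_of_natDegree_lt (n := 3) (by omega),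
        coeff_eq_zero_of_natDegree_lt (n := 5) (by omega)] at hdel
      exact hlead (by linarith)
    have hD := fun s t => shapeCoeff_of_natDegree_le_five hP h5 hodd (del 0 + del s + del (s + t))
    have hz : ∀ s t, 2 ≤ s + t → shapeCoeff m P (del 0 + del s + del (s + t)) = 0 := by
      intro s t hst
      rw [hD, pathCount_three_eq_zero (by omega), pathCount_three_eq_zero (by omega),
        pathCount_three_eq_zero (by omega)]
      ring
    have hA : shapeCoeff m P (del 0 + del 0 + del (0 + 0)) = P.coeff 3 + 10 * P.coeff 5 := by
      rw [hD, pathCount_three_eq_zero (by omega), pathCount_three_deltas, pathCount_five_deltas]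
      ring
    have hB : shapeCoeff m P (del 0 + del 0 + del (0 + 1)) = 5 * P.coeff 5 := by
      rw [hD, pathCount_three_eq_zero (by omega), pathCount_three_eq_zero (by omega),
        pathCount_five_two_one]
      ring
    have hC : shapeCoeff m P (del 0 + del 1 + del (1 + 0)) = 5 * P.coeff 5 := by
      rw [hD, pathCount_three_eq_zero (by omega), pathCount_three_eq_zero (by omega),
        pathCount_five_one_two]
      ring
    have hone : ∀ f : ℕ → ℝ, (∀ t, 1 ≤ t → f t = 0) → ∑ t ∈ Finset.range m, f t = f 0 := by
      intro f hf
      refine Finset.sum_eq_single 0 (fun t _ ht => hf t (by omega)) fun h' => ?_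
      rw [Finset.mem_range] at h'
      omega
    rw [Finset.sum_eq_zero (s := Finset.range m ×ˢ Finset.range m) fun p _ => by
      rw [hz (p.1 + 1) (p.2 + 1) (by omega), zero_pow two_ne_zero]]
    rw [hone _ fun t ht => hz 0 (t + 1) (by omega), hone _ fun t ht => hz (t + 1) 0 (by omega),
      hone _ fun t ht => by rw [hz 0 (t + 1) (by omega), zero_pow two_ne_zero],
      hone _ fun t ht => by rw [hz (t + 1) 0 (by omega), zero_pow two_ne_zero],
      hone _ fun t ht => by rw [hz 0 (t + 1) (by omega), zero_mul]]
    simp only [zero_add] at hA hB hC ⊢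
    rw [hA, hB, hC, h.cubic_form_pos_iff hM, h.variance_sq_eq, eq_exceptional_iff hP h5 hodd h0]
    intro hq hp
    have h35 : P.natDegree = 3 ∨ P.natDegree = 5 := by
      obtain ⟨c, hc⟩ := hno
      omega
    rcases h35 with h' | h'
    · exact hlead (by rw [h', hp])
    · exact hlead (by rw [h', hq])

end NondegeneratePerp


/-! ### The decomposition of the polynomials -/

lemma mem_polySpace {m : ℕ} {P : ℝ[X]} : P ∈ polySpace m ↔ P.natDegree ≤ m := by
  rw [polySpace, mem_degreeLE, natDegree_le_iff_degree_le]

lemma Qpoly_mem_oddSpace {m : ℕ} (hm : Odd m) : Qpoly m ∈ oddSpace m := by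
  obtain ⟨n, rfl⟩ := hm
  refine ⟨Submodule.sum_mem _ fun j hj => ?_, fun k hk => ?_⟩
  · rw [Finset.mem_range] at hj
    rw [mem_polySpace]
    exact (natDegree_C_mul_X_pow_le _ _).trans (by omega)
  · simp only [Qpoly, finsetSum_coeff, coeff_C_mul, coeff_X_pow]
    refine Finset.sum_eq_zero fun j _ => ?_
    rw [if_neg, mul_zero]
    rintro rfl
    obtain ⟨c, hc⟩ := hk
    omega

lemma QSpace_le_oddSpace {m : ℕ} (hm : Odd m) : QSpace m ≤ oddSpace m :=
  (Submodule.span_singleton_le_iff_mem _ _).mpr (Qpoly_mem_oddSpace hm)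

lemma QPerpSpace_le_oddSpace (m : ℕ) : QPerpSpace m ≤ oddSpace m := fun _ h => h.1

lemma disjoint_oddSpace_evenSpace (m : ℕ) : Disjoint (oddSpace m) (evenSpace m) := by
  rw [Submodule.disjoint_def]
  intro P ho he
  ext k
  rcases Nat.even_or_odd k with hk | hk
  · rw [ho.2 k hk, coeff_zero]
  · rw [he.2 k hk, coeff_zero]

lemma coeffInner_Qpoly_self_pos {m : ℕ} (hm : Odd m) : 0 < coeffInner m (Qpoly m) (Qpoly m) := by
  refine Finset.sum_pos' (fun k _ => mul_self_nonneg _) ⟨1, ?_, ?_⟩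
  · rw [Finset.mem_range]
    have := hm.pos
    omega
  · rw [coeff_Qpoly hm.pos]
    have := pathCount_del_zero_odd 0
    norm_num at this
    rw [this]
    norm_num

lemma coeffInner_smul_left (m : ℕ) (c : ℝ) (P R : ℝ[X]) :
    coeffInner m (c • P) R = c * coeffInner m P R := by
  simp only [coeffInner, coeff_smul, smul_eq_mul, Finset.mul_sum, mul_assoc]

lemma coeffInner_smul_right (m : ℕ) (c : ℝ) (P R : ℝ[X]) :
    coeffInner m P (c • R) = c * coeffInner m P R := by
  simp only [coeffInner, coeff_smul, smul_eq_mul, Finset.mul_sum]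
  exact Finset.sum_congr rfl fun k _ => by ring

lemma mem_QPerpSpace_iff {m : ℕ} {P : ℝ[X]} :
    P ∈ QPerpSpace m ↔ P ∈ oddSpace m ∧ coeffInner m P (Qpoly m) = 0 := by
  refine and_congr_right fun _ => ⟨fun h => h _ (Submodule.mem_span_singleton_self _),
    fun h R hR => ?_⟩
  obtain ⟨c, rfl⟩ := Submodule.mem_span_singleton.mp hR
  rw [coeffInner_smul_right, h, mul_zero]

lemma disjoint_QSpace_QPerpSpace {m : ℕ} (hm : Odd m) : Disjoint (QSpace m) (QPerpSpace m) := by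
  rw [Submodule.disjoint_def]
  intro P hQ hp
  obtain ⟨c, rfl⟩ := Submodule.mem_span_singleton.mp hQ
  have h1 := (mem_QPerpSpace_iff.mp hp).2
  rw [coeffInner_smul_left] at h1
  rw [(mul_eq_zero.mp h1).resolve_right (coeffInner_Qpoly_self_pos hm).ne', zero_smul]

lemma QSpace_sup_QPerpSpace {m : ℕ} (hm : Odd m) : QSpace m ⊔ QPerpSpace m = oddSpace m := by
  refine le_antisymm (sup_le (QSpace_le_oddSpace hm) (QPerpSpace_le_oddSpace m)) fun P hP => ?_
  have hpos := coeffInner_Qpoly_self_pos hm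
  set c := coeffInner m P (Qpoly m) / coeffInner m (Qpoly m) (Qpoly m) with hc
  refine Submodule.mem_sup.mpr ⟨c • Qpoly m, Submodule.smul_mem _ _
    (Submodule.mem_span_singleton_self _), P - c • Qpoly m, mem_QPerpSpace_iff.mpr
      ⟨Submodule.sub_mem _ hP (Submodule.smul_mem _ _ (Qpoly_mem_oddSpace hm)), ?_⟩,
      add_sub_cancel _ _⟩
  have : coeffInner m (P - c • Qpoly m) (Qpoly m) =
      coeffInner m P (Qpoly m) - c * coeffInner m (Qpoly m) (Qpoly m) := by
    rw [← coeffInner_smul_left]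
    simp only [coeffInner, coeff_sub, sub_mul, Finset.sum_sub_distrib]
  rw [this, hc, div_mul_cancel₀ _ hpos.ne', sub_self]

lemma oddSpace_sup_evenSpace (m : ℕ) : oddSpace m ⊔ evenSpace m = polySpace m := by
  refine le_antisymm (sup_le (fun _ h => h.1) fun _ h => h.1) fun P hP => ?_
  set E : ℝ[X] := ∑ k ∈ (Finset.range (m + 1)).filter Even, monomial k (P.coeff k) with hE
  have hcoeff : ∀ k, E.coeff k = if Even k then P.coeff k else 0 := by
    intro k
    simp only [hE, finsetSum_coeff, coeff_monomial]
    rw [Finset.sum_ite_eq']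
    simp only [Finset.mem_filter, Finset.mem_range]
    by_cases hk : k < m + 1
    · simp [hk]
    · rw [mem_polySpace] at hP
      rw [coeff_eq_zero_of_natDegree_lt (by omega), ite_self, ite_self]
  have hEm : E ∈ evenSpace m := by
    refine ⟨Submodule.sum_mem _ fun k hk => ?_, fun k hk => ?_⟩
    · rw [Finset.mem_filter, Finset.mem_range] at hk
      rw [mem_polySpace]
      exact (natDegree_monomial_le _).trans (by omega)
    · rw [hcoeff, if_neg (Nat.not_even_iff_odd.mpr hk)]
  refine Submodule.mem_sup.mpr ⟨P - E, ⟨Submodule.sub_mem _ hP hEm.1, fun k hk => ?_⟩, E, hEm,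
    sub_add_cancel _ _⟩
  rw [coeff_sub, hcoeff, if_pos hk, sub_self]

lemma iSupIndep_three {A B C O : Submodule ℝ ℝ[X]} (hA : A ≤ O) (hB : B ≤ O) (hAB : Disjoint A B)
    (hOC : Disjoint O C) : iSupIndep ![A, B, C] := by
  have key : ∀ {A B : Submodule ℝ ℝ[X]}, A ≤ O → B ≤ O → Disjoint A B → Disjoint A (B ⊔ C) := by
    intro A B hA hB hAB
    rw [Submodule.disjoint_def] at hAB hOC ⊢
    intro x hx hx'
    obtain ⟨b, hb, c, hc, rfl⟩ := Submodule.mem_sup.mp hx'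
    have h1 : c = 0 := hOC c (by
      have := O.sub_mem (hA hx) (hB hb)
      rwa [add_sub_cancel_left] at this) hc
    rw [h1, add_zero] at hx ⊢
    exact hAB b hx hb
  intro i
  fin_cases i
  · refine (key hA hB hAB).mono_right (iSup₂_le fun j hj => ?_)
    fin_cases j
    · exact absurd rfl hj
    · exact le_sup_left
    · exact le_sup_right
  · refine (key hB hA hAB.symm).mono_right (iSup₂_le fun j hj => ?_)
    fin_cases j
    · exact le_sup_left
    · exact absurd rfl hj
    · exact le_sup_right
  · refine (hOC.symm).mono_right (iSup₂_le fun j hj => ?_)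
    fin_cases j
    · exact hA
    · exact hB
    · exact absurd rfl hj

/-! ### Truncation to a bounded sequence -/

section Truncation

variable {Ω : Type*} {mΩ : MeasurableSpace Ω} {μ : Measure Ω}
  {X Y : ℕ → Ω → ℝ}

lemma centredStat_congr (h : ∀ᵐ ω ∂μ, ∀ n, X n ω = Y n ω) (α : ℝ) (P : ℝ[X]) :
    ∀ᵐ ω ∂μ, ∀ N, centredStat μ X α P N ω = centredStat μ Y α P N ω := by
  have h1 : ∀ᵐ ω ∂μ, ∀ N, linStat X α P N ω = linStat Y α P N ω := by
    filter_upwards [h] with ω hω N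
    rw [linStat, linStat, _root_.funext hω]
  filter_upwards [h1] with ω hω N
  rw [centredStat, centredStat, hω N]
  congr 1
  exact integral_congr_ae (h1.mono fun ω hω => hω N)

lemma GaussianLimit.congr [IsProbabilityMeasure μ] {α t v : ℝ} {P : ℝ[X]}
    (hG : GaussianLimit μ X α P t v) (h : ∀ᵐ ω ∂μ, ∀ n, X n ω = Y n ω) :
    GaussianLimit μ Y α P t v := by
  refine ⟨hG.1, hG.2.congr (fun N => ?_) EventuallyEq.rfl⟩
  filter_upwards [centredStat_congr h α P] with ω hω
  rw [hω N]

lemma AlmostSureLimit.congr {α : ℝ} {P : ℝ[X]} (hG : AlmostSureLimit μ X α P)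
    (h : ∀ᵐ ω ∂μ, ∀ n, X n ω = Y n ω) : AlmostSureLimit μ Y α P := by
  obtain ⟨Z, hZ, hlim⟩ := hG
  refine ⟨Z, hZ, ?_⟩
  filter_upwards [hlim, centredStat_congr h α P] with ω h1 h2
  exact h1.congr h2

/-- An almost surely bounded i.i.d. sequence agrees almost surely with one that is bounded
everywhere. -/
lemma exists_boundedIID [IsProbabilityMeasure μ] (hmeas : ∀ n, Measurable (X n))
    (hindep : iIndepFun X μ) (hident : ∀ n, IdentDistrib (X n) (X 0) μ μ)
    (hmean : ∫ ω, X 0 ω ∂μ = 0) (hbdd : ∃ B : ℝ, ∀ n, ∀ᵐ ω ∂μ, |X n ω| < B) :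
    ∃ (Y : ℕ → Ω → ℝ) (B : ℝ), BoundedIID μ Y B ∧ ∀ᵐ ω ∂μ, ∀ n, Y n ω = X n ω := by
  obtain ⟨B, hB⟩ := hbdd
  have hφ : Measurable fun u : ℝ => max (-B) (min B u) :=
    measurable_const.max (measurable_const.min measurable_id)
  have heq : ∀ᵐ ω ∂μ, ∀ n, max (-B) (min B (X n ω)) = X n ω := by
    refine ae_all_iff.mpr fun n => ?_
    filter_upwards [hB n] with ω hω
    rw [abs_lt] at hω
    rw [min_eq_right hω.2.le, max_eq_right hω.1.le]
  have hB0 : 0 ≤ B := by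
    obtain ⟨ω, hω⟩ := (hB 0).exists
    exact (abs_nonneg _).trans hω.le
  refine ⟨fun n ω => max (-B) (min B (X n ω)), B, ⟨fun n => hφ.comp (hmeas n),
    hindep.comp _ fun _ => hφ, fun n => (hident n).comp hφ, ?_, fun n ω => ?_⟩, heq⟩
  · rw [← hmean]
    exact integral_congr_ae (heq.mono fun ω hω => hω 0)
  · rw [abs_le]
    exact ⟨le_max_left _ _, max_le (by linarith) (min_le_left _ _)⟩

end Truncation


/-! ### Dependence on the almost sure class -/

section Congruence

variable {Ω : Type*} {mΩ : MeasurableSpace Ω} {μ : Measure Ω} {Y Z : Ω → ℝ}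

lemma mom_congr (h : Y =ᵐ[μ] Z) (j : ℕ) : mom μ Y j = mom μ Z j :=
  integral_congr_ae (h.mono fun ω hω => by dsimp only; rw [hω])

lemma varQ_congr (h : Y =ᵐ[μ] Z) (m : ℕ) (P : ℝ[X]) : varQ μ Y m P = varQ μ Z m P := by
  rw [varQ, varQ, variance_congr h]

lemma varE_congr (h : Y =ᵐ[μ] Z) (m : ℕ) (P : ℝ[X]) : varE μ Y m P = varE μ Z m P := by
  rw [varE, varE, quadForm_congr fun k _ l _ _ _ => ?_]
  rw [covE, covE, mom_congr h, variance_congr h]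

lemma varPerp_congr (h : Y =ᵐ[μ] Z) (m : ℕ) (P : ℝ[X]) : varPerp μ Y m P = varPerp μ Z m P := by
  rw [varPerp, varPerp, quadForm_congr fun k _ l _ _ _ => ?_]
  simp only [covPerp, mom_congr h]

end Congruence

end DecayingSchrodinger

open DecayingSchrodinger in
theorem theorem1 {Ω : Type*} [MeasurableSpace Ω] (μ : Measure Ω) [IsProbabilityMeasure μ]
    (X : ℕ → Ω → ℝ)
    (hmeas : ∀ n, Measurable (X n))
    (hindep : iIndepFun X μ)
    (hident : ∀ n, IdentDistrib (X n) (X 0) μ μ)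
    (hmean : ∫ ω, X 0 ω ∂μ = 0)
    (hvar : 0 < variance (X 0) μ)
    (hbdd : ∃ B : ℝ, ∀ n, ∀ᵐ ω ∂μ, |X n ω| < B)
    (m : ℕ) (hm : Odd m) :
    -- the decomposition as an internal direct sum
    (iSupIndep ![DecayingSchrodinger.QSpace m, DecayingSchrodinger.QPerpSpace m,
        DecayingSchrodinger.evenSpace m] ∧
      DecayingSchrodinger.QSpace m ⊔ DecayingSchrodinger.QPerpSpace m ⊔
        DecayingSchrodinger.evenSpace m = DecayingSchrodinger.polySpace m) ∧
    ∀ P ∈ DecayingSchrodinger.polySpace m, 0 < P.natDegree → ∀ α : ℝ, 0 < α →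
      -- general polynomials
      ((α ≤ 1 / 2 → DecayingSchrodinger.GaussianLimit μ X α P (2 * α)
          (DecayingSchrodinger.varQ μ (X 0) m P)) ∧
        (1 / 2 < α → DecayingSchrodinger.AlmostSureLimit μ X α P)) ∧
      -- even polynomials
      (P ∈ DecayingSchrodinger.evenSpace m →
        (α ≤ 1 / 4 → DecayingSchrodinger.GaussianLimit μ X α P (4 * α)
            (DecayingSchrodinger.varE μ (X 0) m P)) ∧
        (0 < DecayingSchrodinger.varE μ (X 0) m P ↔
          (0 < variance (fun ω => X 0 ω ^ 2) μ ∨ 2 < P.natDegree)) ∧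
        (1 / 4 < α → DecayingSchrodinger.AlmostSureLimit μ X α P)) ∧
      -- odd polynomials orthogonal to `Q_m`
      (P ∈ DecayingSchrodinger.QPerpSpace m →
        (α ≤ 1 / 6 → DecayingSchrodinger.GaussianLimit μ X α P (6 * α)
            (DecayingSchrodinger.varPerp μ (X 0) m P)) ∧
        (0 < DecayingSchrodinger.varPerp μ (X 0) m P ↔
          ¬ (variance (fun ω => X 0 ω ^ 2) μ = 0 ∧
            ∃ a : ℝ, P = Polynomial.C a * (Polynomial.C (1 / 5) * Polynomial.X ^ 5
              - Polynomial.C 4 * Polynomial.X ^ 3 + Polynomial.C 18 * Polynomial.X))) ∧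
        (1 / 6 < α → DecayingSchrodinger.AlmostSureLimit μ X α P)) := by
  refine ⟨⟨iSupIndep_three (QSpace_le_oddSpace hm) (QPerpSpace_le_oddSpace m)
    (disjoint_QSpace_QPerpSpace hm) (disjoint_oddSpace_evenSpace m), ?_⟩, ?_⟩
  · rw [QSpace_sup_QPerpSpace hm, oddSpace_sup_evenSpace]
  intro P hP hd α hα
  rw [mem_polySpace] at hP
  obtain ⟨Y, B, h, hYX⟩ := exists_boundedIID hmeas hindep hident hmean hbdd
  have h0 : X 0 =ᵐ[μ] Y 0 := hYX.mono fun ω hω => (hω 0).symm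
  have hM : 0 < mom μ (Y 0) 2 := by rwa [← h.variance_eq, ← variance_congr h0]
  have hsq : variance (fun ω => X 0 ω ^ 2) μ = variance (fun ω => Y 0 ω ^ 2) μ :=
    variance_congr (h0.mono fun ω hω => by dsimp only; rw [hω])
  rw [varQ_congr h0, varE_congr h0, varPerp_congr h0, hsq]
  refine ⟨⟨fun hα1 => GaussianLimit.congr ?_ hYX, fun hα1 => AlmostSureLimit.congr
    (h.almostSureLimit_one hα1 P) hYX⟩, fun hE => ⟨fun hα1 => GaussianLimit.congr ?_ hYX,
      h.varE_pos_iff hM hP hd hE.2, fun hα1 => AlmostSureLimit.congr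
        (h.almostSureLimit_two hα1 hE.2) hYX⟩, fun hO => ?_⟩
  · rw [varQ, sq_abs, coeffInner_Qpoly, h.variance_eq]
    exact h.gaussianLimit_one hα (by linarith) hP
  · rw [varE_eq h.variance_eq hE.2]
    exact h.gaussianLimit_two hα (by linarith) hP hE.2
  · obtain ⟨hodd, hQ⟩ := mem_QPerpSpace_iff.mp hO
    rw [coeffInner_Qpoly] at hQ
    refine ⟨fun hα1 => GaussianLimit.congr ?_ hYX, h.varPerp_pos_iff hM hP hd hodd.2 hQ,
      fun hα1 => AlmostSureLimit.congr (h.almostSureLimit_three hα1 hP hodd.2 hQ) hYX⟩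
    obtain ⟨D, hD⟩ : ∃ D : ℕ → ℕ → ℝ,
      D = fun s t => shapeCoeff m P (del 0 + del s + del (s + t)) := ⟨_, rfl⟩
    rw [varPerp_eq hodd.2 hD]
    exact h.gaussianLimit_three hα (by linarith) hP hodd.2 hQ hD
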